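/- **Setting.** Let $u=|u|e^{i\theta}\neq 0$ and consider $w''=\{u^2f(z)+g(z)\}w$. Let $D\subset\mathbb C$ be a domain in which $f,g$ are analytic, $f$ having exactly one zero $z_0$ in $D$, a simple one ($D$ is the domain of the equation with the poles of $f,g$ removed, cut where necessary). Let $\zeta$ be analytic and injective on $D$ with $\zeta(z_0)=0$, $\zeta\zeta'^2=f$, i.e. $\xi:=\frac23\zeta^{3/2}=\int_{z_0}^z f^{1/2}(t)\,dt$. Then $W=\zeta^{-1/4}f^{1/4}w$ satisfies $$\frac{d^2W}{d\zeta^2}=\{u^2\zeta+\psi\}W,\quad \psi=\frac{5}{16\zeta^2}+\zeta\Phi,\quad \Phi=\frac{4ff''-5f'^2}{16f^3}+\frac gf \qquad(1)$$ ($\psi$ extended continuously to $\zeta=0$). *Sectors and branches.* For $j\in\{0,1,-1\}$ let $T_j=\{z\in D:|\arg(u^{2/3}\zeta e^{-2\pi ij/3})|\le\pi/3\}$, where $u^{2/3}=|u|^{2/3}e^{2i\theta/3}$. In the $j$-th branch, powers of $\zeta$ (hence $\xi$ and $f^{1/2}=\zeta^{1/2}\zeta'$) are taken with $\arg(u^{2/3}\zeta)\in(\frac{2\pi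 j}{3}-\pi,\frac{2\pi j}3+\pi]$. So for $j=0$, $\mathrm{Re}(u\xi)>0$ inside $T_0$ and $<0$ inside $T_{\pm1}$; for $j=\pm1$, $\mathrm{Re}(u\xi)<0$ inside $T_j$ and $>0$ inside $T_0,T_{-j}$; the three branches agree inside $T_0$. Put $\varepsilon_0=-1$, $\varepsilon_{\pm1}=1$. *Coefficients.* $\hat F_1=\frac12\Phi$, $\hat F_{s+1}=-\frac12f^{-1/2}\hat F_s'-\frac12\sum_{i=1}^{s-1}\hat F_i\hat F_{s-i}$ ($s\ge1$). For odd $s$, $\hat E_s=\int\hat F_sf^{1/2}dz$, with $\zeta^{1/2}\hat E_s$ single valued and analytic in $D\setminus\{z_0\}$ and meromorphic at $z_0$; the even ones are given by the formal expansion $\sum_{s\ge1}\hat E_{2s}u^{-2s}=-\frac12\ln\{1+\sum_{s\ge0}\hat F_{2s+1}u^{-2s-2}\}+\sum_{s\ge1}\alpha_{2s}u^{-2s}$ with arbitrary constants $\alpha_{2s}$. *Progressive paths.* Let $z^{(0)},z^{(1)},z^{(-1)}$ be points of the extended plane. A progressive path from $z^{(j)}$ to $z^{(k)}$ is a finite chain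 of $R_2$ arcs (twice continuously differentiable with nonvanishing derivative, endpoints included, in the chart $z$ or $1/z$), whose interior lies in $D\setminus\{z_0\}$, which lies in $T_j$ near $z^{(j)}$ and in $T_k$ near $z^{(k)}$, and along which $\mathrm{Re}\{(-1)^ju\xi\}$ ($j$-th branch) is nonincreasing and runs from $+\infty$ to $-\infty$. *Hypothesis.* Each $z^{(j)}$ is one of the following. - A pole of $f$ of order $m>2$ at which $g$ is meromorphic and either is analytic or has a pole of order less than $\frac12m+1$. - A double pole of both $f$ and $g$ with $(z-z^{(j)})^2g\to-\frac14$. - Infinity, with convergent expansions $f=z^m\sum_{s\ge0} f_sz^{-s}$, $g=z^p\sum_{s\ge0} g_sz^{-s}$ near $\infty$, $m,p$ integers, $f_0\ne0$, and either $m>-2$, $p<\frac12m-1$, or $m=p=-2$, $g_0=-\frac14$. Moreover $T_j$ has a single end at $z^{(j)}$: every neighbourhood $N$ of $z^{(j)}$ contains a neighbourhood $N'$ such that $T_j\cap N'$ lies in one connected subset of $T_j\cap N$. Finally, for all $j\ne k$ there is a progressive path from $z^{(j)}$ to $z^{(k)}$. *Solutions.* $W_j$ ($j=0,\pm1$) denotes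 a solution of (1), analytic on $\zeta(D)$, such that $\zeta^{1/4}e^{-\varepsilon_ju\xi}W_j\to1$ ($j$-th branch) as $z\to z^{(j)}$ along progressive paths. For $n\ge1$ its error term $\eta_{n,j}$ is defined by $$W_j=\frac1{\zeta^{1/4}}\exp\Big\{\varepsilon_ju\xi+\sum_{s=1}^{n-1}\varepsilon_j^s\frac{\hat E_s(z)-\hat E_s(z^{(j)})}{u^s}\Big\}\{1+\eta_{n,j}(u,z)\}\quad(j\text{-th branch}).$$ **Lemma 2.1.** Under the hypothesis the following hold. (i) For $s\ge1$, $\hat E_s$ ($j$-th branch) has a limit $\hat E_s(z^{(j)})$ as $z\to z^{(j)}$ along progressive paths, the same for all of them. For every $u\neq0$ with $\arg u=\theta$, $n\ge1$ and $j\ne k$, $\eta_{n,j}(u,z)$ has a limit $\eta_{n,j}(u,z^{(k)})$ as $z\to z^{(k)}$ along progressive paths from $z^{(j)}$, the same for all of them. (ii) If $W_1$ and $W_{-1}$ are linearly independent, then $1+\eta_{n,\pm1}(u,z^{(\mp1)})\ne0$ for all $n\ge1$, and there are constants $\lambda_1,\lambda_{-1}$ (depending on $u$, not on $n$) such that, with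 $\lambda_0=1$, $$\lambda_{-1}W_{-1}(u,\zeta)=iW_0(u,\zeta)+\lambda_1W_1(u,\zeta)$$ on $\zeta(D)$, and for all $n\ge1$ and $j=0,\pm1$ $$\lambda_j\exp\Big\{-\sum_{s=1}^{n-1}\varepsilon_j^s\frac{\hat E_s(z^{(j)})}{u^s}\Big\}=\mu_n(u)\{1+\delta_{n,j}(u)\},\qquad \mu_n(u)=\exp\Big\{-\sum_{s=1}^{n-1}(-1)^s\frac{\hat E_s(z^{(0)})}{u^s}\Big\},$$ $$\delta_{n,\pm1}(u)=\frac{\eta_{n,0}(u,z^{(\mp1)})-\eta_{n,\pm1}(u,z^{(\mp1)})}{1+\eta_{n,\pm1}(u,z^{(\mp1)})},\qquad \delta_{n,0}(u)=0.$$ (iii) For fixed $\theta$ there is $R>0$ such that $W_1$ and $W_{-1}$ are linearly independent whenever $|u|\ge R$. -/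

import Mathlib

open Filter Topology Complex

noncomputable section

namespace TurningPointLG

/-- The turning point problem `w'' = (u² f + g) w`. The set `D` is the `z`-domain, with the poles of
`f`, `g` removed (and cut, where this is needed to make `ζ` single valued), so that `f` and `g` are
analytic in `D`; `z₀` is the only zero of `f` in `D` and it is simple. The function `ζ` is the
Liouville variable: the relation `(2/3) ζ^{3/2} = ∫_{z₀}^z f^{1/2}` is expressed, free of branches,
by `ζ (ζ')² = f`, `ζ z₀ = 0`, and `ζ` is a change of variable on `D`. -/
structure Problem where
  D : Set ℂ
  z₀ : ℂ
  f : ℂ → ℂ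
  g : ℂ → ℂ
  ζ : ℂ → ℂ
  isOpen_D : IsOpen D
  isConnected_D : IsConnected D
  z₀_mem : z₀ ∈ D
  analytic_f : DifferentiableOn ℂ f D
  analytic_g : DifferentiableOn ℂ g D
  f_z₀ : f z₀ = 0
  deriv_f_z₀ : deriv f z₀ ≠ 0
  f_ne_zero : ∀ z ∈ D, z ≠ z₀ → f z ≠ 0
  analytic_ζ : DifferentiableOn ℂ ζ D
  ζ_z₀ : ζ z₀ = 0
  ζ_eq : ∀ z ∈ D, ζ z * deriv ζ z ^ 2 = f z
  injOn_ζ : Set.InjOn ζ D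

/-! ### Branches. The index `j = 0, 1, -1` is an element of `SignType`, and `θ = arg u`. -/

/-- `u^{2/3} ζ e^{-2πij/3}` up to the positive factor `|u|^{2/3}`. -/
def rot (θ : ℝ) (j : SignType) (ζ : ℂ) : ℂ :=
  Complex.exp (((2 * θ / 3 - 2 * Real.pi * (j : ℝ) / 3 : ℝ) : ℂ) * I) * ζ

/-- The closed sector `𝐓_j = {ζ : |arg (u^{2/3} ζ e^{-2πij/3})| ≤ π/3}`. -/
def sectorT (θ : ℝ) (j : SignType) : Set ℂ :=
  {ζ | |Complex.arg (rot θ j ζ)| ≤ Real.pi / 3}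

/-- The determination of `arg ζ` used with the `j`-th solution: it is such that
`arg (u^{2/3} ζ)` lies in `(2πj/3 - π, 2πj/3 + π]`. The cut is thus opposite to `𝐓_j`, and the three
determinations agree in the interior of `𝐓_0`. -/
def argBr (θ : ℝ) (j : SignType) (ζ : ℂ) : ℝ :=
  Complex.arg (rot θ j ζ) + 2 * Real.pi * (j : ℝ) / 3 - 2 * θ / 3

/-- The power `ζ^a` in the `j`-th branch. -/
def powBr (θ : ℝ) (j : SignType) (a : ℝ) (ζ : ℂ) : ℂ :=
  ((‖ζ‖ ^ a : ℝ) : ℂ) * Complex.exp (((a * argBr θ j ζ : ℝ) : ℂ) * I)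

/-- `ξ = (2/3) ζ^{3/2}` in the `j`-th branch. One has `Re (u ξ) > 0` inside `𝐓_0`, `< 0` inside
`𝐓_{±1}` if `j = 0`, and `Re (u ξ) < 0` inside `𝐓_j`, `> 0` inside `𝐓_0`, `𝐓_{-j}` if `j = ±1`. -/
def xi (θ : ℝ) (j : SignType) (ζ : ℂ) : ℂ := (2 / 3 : ℂ) * powBr θ j (3 / 2) ζ

/-- The sign of `u ξ` in the exponent of the `j`-th solution, i.e. `-(-1)^j`. -/
def eps (j : SignType) : ℤ := if j = 0 then -1 else 1

/-- The real part of `(-1)^j u ξ`, up to the positive factor `|u|`. -/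
def height (θ : ℝ) (j : SignType) (ζ : ℂ) : ℝ :=
  -(eps j : ℝ) * (Complex.exp ((θ : ℂ) * I) * xi θ j ζ).re

/-! ### The coefficients -/

namespace Problem

variable (P : Problem)

/-- `Φ = (4 f f'' - 5 f'²) / (16 f³) + g / f`. -/
def Phi (z : ℂ) : ℂ :=
  (4 * P.f z * deriv (deriv P.f) z - 5 * deriv P.f z ^ 2) / (16 * P.f z ^ 3) + P.g z / P.f z

/-- `ψ = (5/16) ζ⁻² + ζ Φ`, for `z ≠ z₀`, as a function of `z`. -/
def psi (z : ℂ) : ℂ := 5 / 16 * (P.ζ z ^ 2)⁻¹ + P.ζ z * P.Phi z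

/-- The `j`-th branch of `f^{1/2} = dξ/dz`. -/
def sqrtf (θ : ℝ) (j : SignType) (z : ℂ) : ℂ := powBr θ j (1 / 2) (P.ζ z) * deriv P.ζ z

/-- `F̂_1 = Φ/2` and `F̂_{s+1} = -(1/2) f^{-1/2} F̂_s' - (1/2) ∑_{i=1}^{s-1} F̂_i F̂_{s-i}`, `s ≥ 1`,
with the `j`-th branch of `f^{1/2}` (below `s` is shifted by one and `i` starts at zero). -/
def Fhat (θ : ℝ) (j : SignType) : ℕ → ℂ → ℂ
  | 0 => fun _ => 0
  | 1 => fun z => P.Phi z / 2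
  | (s + 2) => fun z =>
      -(1 / 2) * (P.sqrtf θ j z)⁻¹ * deriv (Fhat θ j (s + 1)) z
        - (1 / 2) * ∑ i : Fin s, Fhat θ j ((i : ℕ) + 1) z * Fhat θ j (s - (i : ℕ)) z
  termination_by s => s
  decreasing_by all_goals omega

/-- The coefficient of `x^k` in the formal power series
`ln (1 + ∑_{i ≥ 1} a_i x^i) = ∑_{m ≥ 1} ((-1)^{m+1} / m) (∑_{i ≥ 1} a_i x^i)^m`. -/
def logCoeff (a : ℕ → ℂ) (k : ℕ) : ℂ :=
  ∑ m ∈ Finset.Icc 1 k, (-1) ^ (m + 1) / (m : ℂ) *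
    PowerSeries.coeff k ((PowerSeries.mk fun i => if i = 0 then 0 else a i) ^ m)

/-- The `j`-th branch of `Ê_s`. For even `s = 2k` this is the coefficient of `x^k`, `x = u⁻²`, in
`-(1/2) ln (1 + ∑_{i ≥ 1} F̂_{2i-1} x^i) + ∑_{i ≥ 1} α_i x^i`, with arbitrary constants `α_i` (the
constants `α_{2i}` of the literature). For odd `s` it is `ζ^{-1/2} G_s`, where `G` is
subject to `IsOddCoeff` below. -/
def Ehat (α : ℕ → ℂ) (G : ℕ → ℂ → ℂ) (θ : ℝ) (j : SignType) (s : ℕ) (z : ℂ) : ℂ :=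
  if Even s then
    -(1 / 2) * logCoeff (fun i => P.Fhat θ j (2 * i - 1) z) (s / 2) + α (s / 2)
  else powBr θ j (-1 / 2) (P.ζ z) * G s z

/-- For odd `s`, `Ê_s = ζ^{-1/2} G_s` is an antiderivative of `F̂_s f^{1/2}` off the cut, in each
branch, with `G_s = ζ^{1/2} Ê_s` analytic in `D` except for a pole at `z₀`. Since `ζ` has a
simple zero at `z₀`, meromorphy of `ζ^{1/2} Ê_s` at `z₀` is that of `(z - z₀)^{1/2} Ê_s`. -/
def IsOddCoeff (θ : ℝ) (G : ℕ → ℂ → ℂ) : Prop :=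
  ∀ s : ℕ, Odd s →
    DifferentiableOn ℂ (G s) (P.D \ {P.z₀}) ∧ MeromorphicAt (G s) P.z₀ ∧
    ∀ j : SignType, ∀ z ∈ P.D, rot θ j (P.ζ z) ∈ Complex.slitPlane →
      HasDerivAt (fun v => powBr θ j (-1 / 2) (P.ζ v) * G s v)
        (P.Fhat θ j s z * P.sqrtf θ j z) z

/-! ### The reference points `z^{(j)}` -/

/-- `w` is an admissible pole of the equation. -/
def AdmissiblePole (w : ℂ) : Prop :=
  MeromorphicAt P.f w ∧ MeromorphicAt P.g w ∧
  ((∃ m : ℕ, 2 < m ∧ meromorphicOrderAt P.f w = ((-(m : ℤ) : ℤ) : WithTop ℤ) ∧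
      (0 ≤ meromorphicOrderAt P.g w ∨
        ∃ p : ℕ, meromorphicOrderAt P.g w = ((-(p : ℤ) : ℤ) : WithTop ℤ) ∧
          (p : ℝ) < (m : ℝ) / 2 + 1)) ∨
    (meromorphicOrderAt P.f w = ((-2 : ℤ) : WithTop ℤ) ∧
      meromorphicOrderAt P.g w = ((-2 : ℤ) : WithTop ℤ) ∧
      Tendsto (fun z => (z - w) ^ 2 * P.g z) (𝓝[≠] w) (𝓝 (-1 / 4))))

/-- The point at infinity is admissible: `f = z^m ∑ f_s z^{-s}`, `g = z^p ∑ g_s z^{-s}` near infinity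
with `f_0 ≠ 0` and either `m > -2`, `p < m/2 - 1`, or `m = p = -2`, `g_0 = -1/4`. -/
def AdmissibleInfinity : Prop :=
  ∃ (m p : ℤ) (F G : ℂ → ℂ), AnalyticAt ℂ F 0 ∧ AnalyticAt ℂ G 0 ∧ F 0 ≠ 0 ∧
    (∀ᶠ z in Bornology.cobounded ℂ, P.f z = z ^ m * F z⁻¹) ∧
    (∀ᶠ z in Bornology.cobounded ℂ, P.g z = z ^ p * G z⁻¹) ∧
    ((-2 < m ∧ (p : ℝ) < (m : ℝ) / 2 - 1) ∨ (m = -2 ∧ p = -2 ∧ G 0 = -1 / 4))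

/-- A point of the extended plane that is an admissible pole or an admissible infinity. -/
def Admissible (a : OnePoint ℂ) : Prop :=
  (∃ w : ℂ, a = (w : OnePoint ℂ) ∧ P.AdmissiblePole w) ∨
    (a = OnePoint.infty ∧ P.AdmissibleInfinity)

/-- The part of the region `T_j` close to `a` is connected: it lies, near `a`, in one
connected piece, however small, so that `z → a` in `T_j` refers to a single end of `T_j`. -/
def OneEnded (θ : ℝ) (j : SignType) (a : OnePoint ℂ) : Prop :=
  ∀ N ∈ 𝓝 a, ∃ N' ∈ 𝓝 a, ∃ C : Set ℂ, IsPreconnected C ∧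
    (∀ z ∈ C, z ∈ P.D ∧ P.ζ z ∈ sectorT θ j ∧ (z : OnePoint ℂ) ∈ N) ∧
    (∀ z ∈ P.D, P.ζ z ∈ sectorT θ j → (z : OnePoint ℂ) ∈ N' → z ∈ C)

end Problem

/-- `γ`, restricted to the open interval `(a, b)`, is the interior of an `R₂` arc of the extended
plane: in one of the charts `z`, `1/z` it is given by a function `c` that is twice continuously
differentiable, with nonvanishing derivative, on the closed interval. -/
def IsR2Arc (γ : ℝ → ℂ) (a b : ℝ) : Prop :=
  ∃ c : ℝ → ℂ, ContDiffOn ℝ 2 c (Set.Icc a b) ∧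
    (∀ t ∈ Set.Icc a b, derivWithin c (Set.Icc a b) t ≠ 0) ∧
    ((∀ t ∈ Set.Ioo a b, γ t = c t) ∨ (∀ t ∈ Set.Ioo a b, c t ≠ 0 ∧ γ t = (c t)⁻¹))

/-- A progressive path from `e j` to `e k`, parametrized by `(0, 1)`: a finite chain of `R₂` arcs in
`D`, avoiding the turning point, on which the real part of `(-1)^j u ξ` is nonincreasing (from
`+∞` to `-∞`), and whose ends lie in `T_j` and `T_k`, respectively. -/
structure IsProgressive (P : Problem) (θ : ℝ) (e : SignType → OnePoint ℂ) (j k : SignType)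
    (γ : ℝ → ℂ) : Prop where
  continuousOn : ContinuousOn γ (Set.Ioo 0 1)
  chain : ∃ (N : ℕ) (τ : Fin (N + 1) → ℝ), StrictMono τ ∧ τ 0 = 0 ∧ τ (Fin.last N) = 1 ∧
    ∀ i : Fin N, IsR2Arc γ (τ i.castSucc) (τ i.succ)
  mem : ∀ t ∈ Set.Ioo (0 : ℝ) 1, γ t ∈ P.D ∧ γ t ≠ P.z₀
  start : Tendsto (fun t => (γ t : OnePoint ℂ)) (𝓝[>] 0) (𝓝 (e j))
  finish : Tendsto (fun t => (γ t : OnePoint ℂ)) (𝓝[<] 1) (𝓝 (e k))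
  start_sector : ∀ᶠ t in 𝓝[>] 0, P.ζ (γ t) ∈ sectorT θ j
  finish_sector : ∀ᶠ t in 𝓝[<] 1, P.ζ (γ t) ∈ sectorT θ k
  antitone : AntitoneOn (fun t => height θ j (P.ζ (γ t))) (Set.Ioo 0 1)
  start_height : Tendsto (fun t => height θ j (P.ζ (γ t))) (𝓝[>] 0) atTop
  finish_height : Tendsto (fun t => height θ j (P.ζ (γ t))) (𝓝[<] 1) atBot

/-- The standing hypothesis on the points `z^{(j)} = e j`. -/
structure StandingHyp (P : Problem) (θ : ℝ) (e : SignType → OnePoint ℂ) : Prop where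
  admissible : ∀ j, P.Admissible (e j)
  oneEnded : ∀ j, P.OneEnded θ j (e j)
  linked : ∀ j k, j ≠ k → ∃ γ, IsProgressive P θ e j k γ

/-! ### The Liouville-Green solutions and their error terms -/

/-- `W` is an (analytic) solution of `d²W/dζ² = (u² ζ + ψ(ζ)) W` on the image of `D`. At `ζ = 0`,
where `ψ` is defined by continuity, the equation is implied by continuity. -/
def IsSolution (P : Problem) (u : ℂ) (W : ℂ → ℂ) : Prop :=
  DifferentiableOn ℂ W (P.ζ '' P.D) ∧
    ∀ z ∈ P.D, z ≠ P.z₀ → deriv (deriv W) (P.ζ z) = (u ^ 2 * P.ζ z + P.psi z) * W (P.ζ z)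

/-- `W` is the solution `W_j`: it solves the equation, and it is recessive at `z^{(j)}`, with
`ζ^{1/4} e^{u ξ} W_0 → 1` for `j = 0` and `ζ^{1/4} e^{-u ξ} W_j → 1` for `j = ±1`, as `z → z^{(j)}`
along progressive paths. -/
def IsLGSolution (P : Problem) (θ : ℝ) (e : SignType → OnePoint ℂ) (u : ℂ) (j : SignType)
    (W : ℂ → ℂ) : Prop :=
  IsSolution P u W ∧ ∀ k, j ≠ k → ∀ γ, IsProgressive P θ e j k γ →
    Tendsto (fun t => powBr θ j (1 / 4) (P.ζ (γ t)) *
        Complex.exp (-((eps j : ℂ) * u * xi θ j (P.ζ (γ t)))) * W (P.ζ (γ t)))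
      (𝓝[>] 0) (𝓝 1)

/-- The relative error `η_{n,j}(u, z)`, i.e. the function with
`W_j = ζ^{-1/4} exp {ε u ξ + ∑_{s=1}^{n-1} ε^s (Ê_s(z) - Ê_s(z^{(j)})) / u^s} (1 + η_{n,j})`,
`ε = -1` for `j = 0` and `ε = 1` for `j = ±1`. Here `E s z` is `Ê_s(z)` in the `j`-th branch and
`Ej s` is `Ê_s(z^{(j)})`. -/
def eta (P : Problem) (θ : ℝ) (u : ℂ) (j : SignType) (E : ℕ → ℂ → ℂ) (Ej : ℕ → ℂ) (W : ℂ → ℂ)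
    (n : ℕ) (z : ℂ) : ℂ :=
  powBr θ j (1 / 4) (P.ζ z) * W (P.ζ z) *
    Complex.exp (-((eps j : ℂ) * u * xi θ j (P.ζ z) +
      ∑ s ∈ Finset.Ico 1 n, (eps j : ℂ) ^ s * ((E s z - Ej s) / u ^ s))) - 1

/-- `μ_n(u) = exp {-∑_{s=1}^{n-1} (-1)^s Ê_s(z^{(0)}) / u^s}`. -/
def mu (u : ℂ) (E0 : ℕ → ℂ) (n : ℕ) : ℂ :=
  Complex.exp (-∑ s ∈ Finset.Ico 1 n, (-1) ^ s * (E0 s / u ^ s))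

/-- `δ_{n,0} = 0`, and `δ_{n,j} = (η_{n,0}(z^{(-j)}) - η_{n,j}(z^{(-j)})) / (1 + η_{n,j}(z^{(-j)}))` for
`j = ±1`, where `η j k` stands for `η_{n,j}(u, z^{(k)})`. -/
def delta (η : SignType → SignType → ℂ) (j : SignType) : ℂ :=
  if j = 0 then 0 else (η 0 (-j) - η j (-j)) / (1 + η j (-j))

/-- `W_1` and `W_{-1}` are linearly independent on `D`. -/
def Independent (P : Problem) (W : SignType → ℂ → ℂ) : Prop :=
  ∀ a b : ℂ, (∀ z ∈ P.D, a * W 1 (P.ζ z) + b * W (-1) (P.ζ z) = 0) → a = 0 ∧ b = 0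

end TurningPointLG

end

/-! Put u = r e^{iθ} and X = (-1)^j e^{iθ} ξ in the j-th branch (`tallVar`), so that the height of a
progressive path is Re X. For Y = ζ^{1/4} W equation (1) becomes d²Y/dX² = (r² + e^{-2iθ} Φ) Y, and
W_j satisfies e^{rX} Y → 1 as Re X → +∞. Split e^{rX} Y = A + b into amplitudes belonging to e^{-rX}
and e^{rX} (`ampA`, `ampB`). Along a path they obey a system driven by e^{-2iθ} Φ dX (`IsLGFlow`),
and the Volterra kernel for b has modulus at most one because Re X does not increase. When ∫ |Φ
f^{1/2} dz| is finite, A → 1 and b → 0 at the start, and A → c and b → 0 at the end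
(`IsLGFlow.exists_limit`). If the integral is at most r/4, then c ≠ 0.

A Wronskian identifies c. A progressive path stays off the cut and inside T_j ∪ T_k; over T_k, X
changes sign between the branches j and k. The reversed path is therefore progressive from z^{(k)}
to z^{(j)}. In the amplitudes of W_j and W_k the Wronskian is, up to a constant phase, 2r (b_j b_k -
A_j A_k) (`amp_wronskian`), which tends to -2rc at z^{(k)}. Hence c is a fixed multiple of the
constant Wronskian (`IsProgressive.tendsto_connection`): it does not depend on the path, and 1 +
η_{n,j}(z^{(k)}) is c times an explicit exponential. That c ≠ 0 for large r gives (iii).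

The relation among the three solutions is the three-term identity with Wronskian coefficients, so
λ_{±1} are quotients of two constants c at z^{(∓1)}. When these are rewritten through η, the values
of Ê_s at z^{(∓1)} cancel (`endSum_identity`) and the stated δ remains. This uses that, at an end,
the even Ê_s have the same limit in every branch while the odd ones follow the sign of ζ^{-1/2}.

The rest is local analysis. In the coordinate v = z - w or 1/z, f dz² = v^{-m} h dv² with m ≥ 2, and
admissibility makes Φ equal to v^{⌊m/2⌋} times an analytic function (`IsEnd`). So Φ f^{1/2} dz is
O(|v|^{-1/2}) dv, which is integrable along an R_2 arc because |v| ≥ κt there. The recursion keeps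
this form for the odd F̂_s (`IsEnd.exists_Fhat_eq`). Hence the odd Ê_s have limits, unique because
T_j has one end; in the even Ê_s only the constants α survive. -/

namespace TurningPointLG

/-! ### Powers in the three branches -/

/-- The shift of the argument of the `j`-th branch. -/
noncomputable def brShift (θ : ℝ) (j : SignType) : ℝ := 2 * Real.pi * (j : ℝ) / 3 - 2 * θ / 3

/-- The logarithm in the `j`-th branch. -/
noncomputable def logBr (θ : ℝ) (j : SignType) (ζ : ℂ) : ℂ :=
  Complex.log (rot θ j ζ) + (brShift θ j : ℂ) * I

theorem rot_eq (θ : ℝ) (j : SignType) (ζ : ℂ) :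
    rot θ j ζ = Complex.exp (-((brShift θ j : ℂ) * I)) * ζ := by
  unfold rot brShift
  congr 2
  push_cast
  ring

theorem rot_ne_zero {θ : ℝ} {j : SignType} {ζ : ℂ} (h : ζ ≠ 0) : rot θ j ζ ≠ 0 := by
  rw [rot_eq]
  exact mul_ne_zero (Complex.exp_ne_zero _) h

theorem norm_rot (θ : ℝ) (j : SignType) (ζ : ℂ) : ‖rot θ j ζ‖ = ‖ζ‖ := by
  unfold rot
  rw [norm_mul, Complex.norm_exp_ofReal_mul_I, one_mul]

theorem ne_zero_of_rot {θ : ℝ} {j : SignType} {ζ : ℂ} (h : rot θ j ζ ∈ Complex.slitPlane) :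
    ζ ≠ 0 := by
  rintro rfl
  simp [rot] at h

theorem exp_logBr {θ : ℝ} {j : SignType} {ζ : ℂ} (h : ζ ≠ 0) :
    Complex.exp (logBr θ j ζ) = ζ := by
  unfold logBr
  rw [Complex.exp_add, Complex.exp_log (rot_ne_zero h), rot_eq, Complex.exp_neg]
  field_simp [Complex.exp_ne_zero]

theorem logBr_im (θ : ℝ) (j : SignType) (ζ : ℂ) : (logBr θ j ζ).im = argBr θ j ζ := by
  unfold logBr argBr brShift
  simp [Complex.log_im]
  ring

theorem logBr_re (θ : ℝ) (j : SignType) (ζ : ℂ) : (logBr θ j ζ).re = Real.log ‖ζ‖ := by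
  unfold logBr
  simp [Complex.log_re, norm_rot]

theorem powBr_eq_exp {θ : ℝ} {j : SignType} {ζ : ℂ} (a : ℝ) (h : ζ ≠ 0) :
    powBr θ j a ζ = Complex.exp (a * logBr θ j ζ) := by
  have h1 : logBr θ j ζ = (Real.log ‖ζ‖ : ℂ) + (argBr θ j ζ : ℂ) * I := by
    rw [← logBr_re θ j, ← logBr_im, Complex.re_add_im]
  unfold powBr
  rw [h1, mul_add, Complex.exp_add, Real.rpow_def_of_pos (norm_pos_iff.2 h), Complex.ofReal_exp]
  congr 2
  · push_cast; ring
  · push_cast; ring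

theorem powBr_mul {θ : ℝ} {j : SignType} {ζ : ℂ} (a b : ℝ) (h : ζ ≠ 0) :
    powBr θ j a ζ * powBr θ j b ζ = powBr θ j (a + b) ζ := by
  rw [powBr_eq_exp a h, powBr_eq_exp b h, powBr_eq_exp _ h, ← Complex.exp_add]
  push_cast
  ring_nf

theorem powBr_natCast {θ : ℝ} {j : SignType} {ζ : ℂ} (n : ℕ) (h : ζ ≠ 0) :
    powBr θ j n ζ = ζ ^ n := by
  rw [powBr_eq_exp _ h, Complex.ofReal_natCast, Complex.exp_nat_mul, exp_logBr h]

theorem hasDerivAt_logBr {θ : ℝ} {j : SignType} {ζ : ℂ} (h : rot θ j ζ ∈ Complex.slitPlane) :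
    HasDerivAt (logBr θ j) ζ⁻¹ ζ := by
  have hz := ne_zero_of_rot h
  have h1 : HasDerivAt (rot θ j) (Complex.exp (-((brShift θ j : ℂ) * I))) ζ := by
    have := (hasDerivAt_id ζ).const_mul (Complex.exp (-((brShift θ j : ℂ) * I)))
    simp only [mul_one] at this
    refine this.congr_of_eventuallyEq (Filter.Eventually.of_forall fun x => ?_)
    rw [rot_eq]; rfl
  have h2 := (h1.clog h).add_const ((brShift θ j : ℂ) * I)
  refine h2.congr_deriv ?_
  rw [rot_eq]
  field_simp [Complex.exp_ne_zero]

theorem continuous_rot (θ : ℝ) (j : SignType) : Continuous (rot θ j) := by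
  unfold rot; fun_prop

theorem isOpen_slit (θ : ℝ) (j : SignType) : IsOpen {ζ | rot θ j ζ ∈ Complex.slitPlane} :=
  Complex.isOpen_slitPlane.preimage (continuous_rot θ j)

theorem hasDerivAt_powBr {θ : ℝ} {j : SignType} {ζ : ℂ} (a : ℝ)
    (h : rot θ j ζ ∈ Complex.slitPlane) :
    HasDerivAt (powBr θ j a) (a * powBr θ j (a - 1) ζ) ζ := by
  have hz := ne_zero_of_rot h
  have h1 := ((hasDerivAt_logBr h).const_mul (a : ℂ)).cexp
  have h2 : HasDerivAt (powBr θ j a) (Complex.exp (a * logBr θ j ζ) * (a * ζ⁻¹)) ζ := by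
    refine h1.congr_of_eventuallyEq ?_
    filter_upwards [isOpen_ne.mem_nhds hz] with x hx using powBr_eq_exp a hx
  refine h2.congr_deriv ?_
  have h3 : powBr θ j a ζ = powBr θ j (a - 1) ζ * ζ := by
    have := powBr_mul (θ := θ) (j := j) (a - 1) (1 : ℕ) hz
    rw [powBr_natCast _ hz, pow_one] at this
    rw [this]; simp
  rw [← powBr_eq_exp a hz, h3]
  field_simp

/-! ### The variable `X_j = (-1)^j e^{iθ} ξ` -/

/-- `(-1)^j e^{iθ} ξ` in the `j`-th branch; its real part is `height`. -/
noncomputable def tallVar (θ : ℝ) (j : SignType) (ζ : ℂ) : ℂ :=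
  -(eps j : ℂ) * Complex.exp ((θ : ℂ) * I) * xi θ j ζ

theorem tallVar_re (θ : ℝ) (j : SignType) (ζ : ℂ) : (tallVar θ j ζ).re = height θ j ζ := by
  unfold tallVar height
  have : -(eps j : ℂ) = ((-(eps j : ℝ) : ℝ) : ℂ) := by push_cast; rfl
  rw [this, mul_assoc, Complex.re_ofReal_mul]

theorem eps_sq (j : SignType) : (eps j : ℂ) * eps j = 1 := by
  unfold eps; split_ifs <;> simp

theorem eps_ne_zero (j : SignType) : (eps j : ℂ) ≠ 0 := by
  unfold eps; split_ifs <;> simp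

theorem exp_pi_mul_sign (j : SignType) :
    Complex.exp (Real.pi * ((j : ℝ) : ℂ) * I) = -(eps j : ℂ) := by
  fin_cases j
  · simp [eps]
  · simp [eps, Complex.exp_neg]
  · simp [eps]

/-- The shift of the logarithm contributes e^{iπj - iθ} to ζ^{3/2}, and the prefactor (-1)^j e^{iθ}
cancels it. So the height is one and the same function of `rot θ j ζ` for all three j. -/
theorem tallVar_eq {θ : ℝ} {j : SignType} {ζ : ℂ} (h : ζ ≠ 0) :
    tallVar θ j ζ = 2 / 3 * Complex.exp (3 / 2 * Complex.log (rot θ j ζ)) := by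
  unfold tallVar xi
  have e1 : ((3 / 2 : ℝ) : ℂ) * logBr θ j ζ =
      3 / 2 * Complex.log (rot θ j ζ) + (Real.pi * ((j : ℝ) : ℂ) * I - (θ : ℂ) * I) := by
    unfold logBr brShift; push_cast; ring
  rw [powBr_eq_exp _ h, e1, Complex.exp_add, Complex.exp_sub, exp_pi_mul_sign]
  have := eps_sq j
  field_simp [Complex.exp_ne_zero]
  linear_combination this

theorem height_eq {θ : ℝ} {j : SignType} {ζ : ℂ} (h : ζ ≠ 0) :
    height θ j ζ = 2 / 3 * (‖ζ‖ ^ (3 / 2 : ℝ) * Real.cos (3 / 2 * Complex.arg (rot θ j ζ))) := by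
  rw [← tallVar_re, tallVar_eq h]
  have e : (2 / 3 : ℂ) = ((2 / 3 : ℝ) : ℂ) := by push_cast; rfl
  have e2 : (3 / 2 : ℂ) = ((3 / 2 : ℝ) : ℂ) := by push_cast; rfl
  rw [e, Complex.re_ofReal_mul, Complex.exp_re, e2, Complex.re_ofReal_mul, Complex.im_ofReal_mul,
    Complex.log_im, Complex.log_re, norm_rot, Real.rpow_def_of_pos (norm_pos_iff.2 h)]
  congr 3
  ring

theorem hasDerivAt_tallVar {θ : ℝ} {j : SignType} {ζ : ℂ} (h : rot θ j ζ ∈ Complex.slitPlane) :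
    HasDerivAt (tallVar θ j) (-(eps j : ℂ) * Complex.exp ((θ : ℂ) * I) * powBr θ j (1 / 2) ζ) ζ := by
  have h1 := (hasDerivAt_powBr (3 / 2) h).const_mul
    (-(eps j : ℂ) * Complex.exp ((θ : ℂ) * I) * (2 / 3 : ℂ))
  refine (h1.congr_deriv ?_).congr_of_eventuallyEq (Filter.Eventually.of_forall fun x => ?_)
  · norm_num
    ring
  · simp only [tallVar, xi]; ring

/-! ### Comparison of the branches -/

/-- The number of turns between the branches `j` and `k` over `𝐓_k`. -/
def turn (j k : SignType) : ℤ :=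
  if j = 1 ∧ k = -1 then -1 else if j = -1 ∧ k = 1 then 1 else 0

theorem exists_logBr_eq {θ : ℝ} {ζ : ℂ} (h : ζ ≠ 0) (j k : SignType) :
    ∃ n : ℤ, logBr θ k ζ = logBr θ j ζ + n * (2 * Real.pi * I) ∧
      Complex.arg (rot θ k ζ) =
        Complex.arg (rot θ j ζ) + 2 * Real.pi / 3 * ((j : ℝ) - (k : ℝ)) + 2 * Real.pi * n := by
  have h1 : Complex.exp (logBr θ k ζ) = Complex.exp (logBr θ j ζ) := by
    rw [exp_logBr h, exp_logBr h]
  obtain ⟨n, hn⟩ := Complex.exp_eq_exp_iff_exists_int.1 h1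
  refine ⟨n, hn, ?_⟩
  have h2 := congrArg Complex.im hn
  rw [Complex.add_im, logBr_im, logBr_im] at h2
  have h3 : ((n : ℂ) * (2 * Real.pi * I)).im = n * (2 * Real.pi) := by
    simp
  rw [h3] at h2
  unfold argBr at h2
  linarith

theorem int_eq_of_pi_bounds {n m : ℤ} (h1 : Real.pi * (m - 1) < Real.pi * n)
    (h2 : Real.pi * n < Real.pi * (m + 1)) : n = m := by
  have h3 := lt_of_mul_lt_mul_left h1 Real.pi_pos.le
  have h4 := lt_of_mul_lt_mul_left h2 Real.pi_pos.le
  have h5 : m - 1 < n := by exact_mod_cast h3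
  have h6 : n < m + 1 := by exact_mod_cast h4
  omega

theorem slit_iff_arg {z : ℂ} (h : z ≠ 0) : z ∈ Complex.slitPlane ↔ Complex.arg z < Real.pi := by
  rw [Complex.mem_slitPlane_iff_arg]
  have := Complex.arg_le_pi z
  constructor
  · exact fun h' => lt_of_le_of_ne this h'.1
  · exact fun h' => ⟨h'.ne, h⟩

/-- One argument lies in [-π/3, π/3], the other strictly inside (-π, π); for each pair this leaves
one integer number of turns. Strictness is needed: on the cut the count can be ambiguous. -/
theorem logBr_eq_of_mem_sectorT {θ : ℝ} {ζ : ℂ} {j k : SignType} (hjk : j ≠ k)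
    (hk : ζ ∈ sectorT θ k) (hj : rot θ j ζ ∈ Complex.slitPlane) :
    logBr θ k ζ = logBr θ j ζ + turn j k * (2 * Real.pi * I) := by
  have h := ne_zero_of_rot hj
  obtain ⟨n, hn, ha⟩ := exists_logBr_eq (θ := θ) h j k
  rw [slit_iff_arg (rot_ne_zero h)] at hj
  have hj' := Complex.neg_pi_lt_arg (rot θ j ζ)
  have hp := Real.pi_pos
  have hk0 : |Complex.arg (rot θ k ζ)| ≤ Real.pi / 3 := hk
  obtain ⟨hk1, hk2⟩ := abs_le.1 hk0
  suffices n = turn j k by rw [hn, this]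
  clear hn hk hk0
  generalize Complex.arg (rot θ j ζ) = a at *
  generalize Complex.arg (rot θ k ζ) = b at *
  apply int_eq_of_pi_bounds <;> revert hjk <;> fin_cases j <;> fin_cases k <;> intro hjk <;>
    first
    | exact absurd rfl hjk
    | (simp [turn] at ha ⊢; nlinarith)

end TurningPointLG

namespace TurningPointLG

/-! ### Heights and sectors -/

theorem powBr_eq_of_mem_sectorT {θ : ℝ} {ζ : ℂ} {j k : SignType} (hjk : j ≠ k)
    (hk : ζ ∈ sectorT θ k) (hj : rot θ j ζ ∈ Complex.slitPlane) (a : ℝ) :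
    powBr θ k a ζ = powBr θ j a ζ * Complex.exp (2 * Real.pi * (a * turn j k) * I) := by
  have h := ne_zero_of_rot hj
  rw [powBr_eq_exp a h, powBr_eq_exp a h, logBr_eq_of_mem_sectorT hjk hk hj, ← Complex.exp_add]
  congr 1
  ring

/-- The pair {1, -1} is the only one with a nonzero turn, and among distinct indices the only one
with ε_j ε_k = 1. -/
theorem exp_turn_pi {j k : SignType} (hjk : j ≠ k) :
    Complex.exp (Real.pi * turn j k * I) = -(eps j : ℂ) * eps k := by
  fin_cases j <;> fin_cases k <;>
    first
    | exact absurd rfl hjk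
    | simp [turn, eps, Complex.exp_neg]

theorem exp_three_turn_pi {j k : SignType} (hjk : j ≠ k) :
    Complex.exp (3 * Real.pi * turn j k * I) = -(eps j : ℂ) * eps k := by
  have : (3 * Real.pi * turn j k * I : ℂ) = (3 : ℕ) * (Real.pi * turn j k * I) := by
    push_cast; ring
  rw [this, Complex.exp_nat_mul, exp_turn_pi hjk]
  linear_combination (-(eps j : ℂ) * eps k ^ 3) * eps_sq j - (eps j : ℂ) * eps k * eps_sq k

/-- Exactly one of two signs flips: that of ε when one index is 0, that of ξ (through the turn in
ζ^{3/2}) for the pair ±1. -/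
theorem tallVar_eq_neg {θ : ℝ} {ζ : ℂ} {j k : SignType} (hjk : j ≠ k)
    (hk : ζ ∈ sectorT θ k) (hj : rot θ j ζ ∈ Complex.slitPlane) :
    tallVar θ k ζ = -tallVar θ j ζ := by
  unfold tallVar xi
  rw [powBr_eq_of_mem_sectorT hjk hk hj]
  have e1 : (2 * Real.pi * (((3 / 2 : ℝ) : ℂ) * turn j k) * I : ℂ) = 3 * Real.pi * turn j k * I := by
    push_cast; ring
  rw [e1, exp_three_turn_pi hjk]
  linear_combination (eps j * Complex.exp ((θ : ℂ) * I) * (2 / 3 * powBr θ j (3 / 2) ζ)) * eps_sq k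

theorem height_eq_zero_of_not_slit {θ : ℝ} {j : SignType} {ζ : ℂ} (h : ζ ≠ 0)
    (hs : rot θ j ζ ∉ Complex.slitPlane) : height θ j ζ = 0 := by
  have ha : Complex.arg (rot θ j ζ) = Real.pi := by
    rw [slit_iff_arg (rot_ne_zero h)] at hs
    exact le_antisymm (Complex.arg_le_pi _) (not_lt.1 hs)
  have : Real.cos (3 / 2 * Real.pi) = 0 := Real.cos_eq_zero_iff.2 ⟨1, by push_cast; ring⟩
  rw [height_eq h, ha, this]
  ring

/-- On the cut of the j-th branch, where `tallVar_eq_neg` does not apply, both heights vanish: 3/2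
times either argument is an odd multiple of π/2. -/
theorem height_eq_neg {θ : ℝ} {ζ : ℂ} {j k : SignType} (hjk : j ≠ k)
    (hk : ζ ∈ sectorT θ k) (h : ζ ≠ 0) : height θ k ζ = -height θ j ζ := by
  by_cases hj : rot θ j ζ ∈ Complex.slitPlane
  · rw [← tallVar_re, ← tallVar_re, tallVar_eq_neg hjk hk hj, Complex.neg_re]
  · have ha : Complex.arg (rot θ j ζ) = Real.pi := by
      rw [slit_iff_arg (rot_ne_zero h)] at hj
      exact le_antisymm (Complex.arg_le_pi _) (not_lt.1 hj)
    obtain ⟨n, -, hn⟩ := exists_logBr_eq (θ := θ) h j k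
    have hj0 : ∃ p : ℤ, (j : ℝ) = p := by
      fin_cases j
      exacts [⟨0, by simp⟩, ⟨-1, by simp⟩, ⟨1, by simp⟩]
    have hk0 : ∃ p : ℤ, (k : ℝ) = p := by
      fin_cases k
      exacts [⟨0, by simp⟩, ⟨-1, by simp⟩, ⟨1, by simp⟩]
    obtain ⟨p, hp⟩ := hj0
    obtain ⟨q, hq⟩ := hk0
    have : Real.cos (3 / 2 * Complex.arg (rot θ k ζ)) = 0 := by
      refine Real.cos_eq_zero_iff.2 ⟨1 + p - q + 3 * n, ?_⟩
      rw [hn, ha, hp, hq]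
      push_cast
      ring
    rw [height_eq_zero_of_not_slit h hj, height_eq h, this]
    ring

theorem height_pos_factor {ζ : ℂ} (h : ζ ≠ 0) : 0 < ‖ζ‖ ^ (3 / 2 : ℝ) :=
  Real.rpow_pos_of_pos (norm_pos_iff.2 h) _

theorem height_neg_of_arg {θ : ℝ} {ζ : ℂ} {j : SignType} (h : ζ ≠ 0)
    (h1 : Real.pi / 3 < |Complex.arg (rot θ j ζ)|) (h2 : |Complex.arg (rot θ j ζ)| < Real.pi) :
    height θ j ζ < 0 := by
  rw [height_eq h, ← Real.cos_abs, abs_mul, abs_of_pos (by norm_num : (0 : ℝ) < 3 / 2)]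
  have := Real.cos_neg_of_pi_div_two_lt_of_lt (x := 3 / 2 * |Complex.arg (rot θ j ζ)|)
    (by linarith) (by linarith)
  nlinarith [mul_pos (height_pos_factor h) (neg_pos.2 this)]

theorem height_nonneg_of_mem {θ : ℝ} {ζ : ℂ} {j : SignType} (h : ζ ≠ 0)
    (h1 : |Complex.arg (rot θ j ζ)| ≤ Real.pi / 3) : 0 ≤ height θ j ζ := by
  rw [height_eq h, ← Real.cos_abs, abs_mul, abs_of_pos (by norm_num : (0 : ℝ) < 3 / 2)]
  have := Real.cos_nonneg_of_neg_pi_div_two_le_of_le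
    (x := 3 / 2 * |Complex.arg (rot θ j ζ)|)
    (by have := abs_nonneg (Complex.arg (rot θ j ζ)); linarith [Real.pi_pos]) (by linarith)
  have := height_pos_factor h
  positivity

theorem rot_slit_of_mem_sectorT {θ : ℝ} {ζ : ℂ} {j : SignType} (h : ζ ≠ 0)
    (hj : ζ ∈ sectorT θ j) : rot θ j ζ ∈ Complex.slitPlane := by
  rw [slit_iff_arg (rot_ne_zero h)]
  have h1 : |Complex.arg (rot θ j ζ)| ≤ Real.pi / 3 := hj
  linarith [le_abs_self (Complex.arg (rot θ j ζ)), Real.pi_pos]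

theorem abs_arg_lt_of_slit {z : ℂ} (hz : z ∈ Complex.slitPlane) :
    |Complex.arg z| < Real.pi := by
  rw [abs_lt]
  exact ⟨Complex.neg_pi_lt_arg _, (slit_iff_arg (Complex.slitPlane_ne_zero hz)).1 hz⟩

/-- The imaginary axis lies in π/3 < |arg| < π, where the height is negative. It is a barrier
between the region of positive height and the cut, where the height is zero. -/
theorem re_rot_ne_zero_of_height_nonneg {θ : ℝ} {ζ : ℂ} {j : SignType} (h : ζ ≠ 0)
    (h0 : 0 ≤ height θ j ζ) : (rot θ j ζ).re ≠ 0 := by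
  intro hre
  have h1 : |Complex.arg (rot θ j ζ)| ≤ Real.pi / 2 :=
    Complex.abs_arg_le_pi_div_two_iff.2 hre.ge
  have h2 : ¬ |Complex.arg (rot θ j ζ)| < Real.pi / 2 := by
    rw [Complex.abs_arg_lt_pi_div_two_iff]
    rintro (h3 | h3)
    · exact h3.ne' hre
    · exact rot_ne_zero h h3
  have hp := Real.pi_pos
  have := height_neg_of_arg (θ := θ) (j := j) h (by linarith) (by linarith)
  linarith

theorem re_rot_pos_of_height_pos {θ : ℝ} {ζ : ℂ} {j : SignType} (h : ζ ≠ 0)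
    (h0 : 0 < height θ j ζ) : 0 < (rot θ j ζ).re := by
  have hs : rot θ j ζ ∈ Complex.slitPlane := by
    by_contra hs
    rw [height_eq_zero_of_not_slit h hs] at h0
    exact h0.false
  have h1 : |Complex.arg (rot θ j ζ)| ≤ Real.pi / 3 := by
    by_contra! h1
    exact (height_neg_of_arg h h1 (abs_arg_lt_of_slit hs)).not_gt h0
  have hp := Real.pi_pos
  exact (Complex.abs_arg_lt_pi_div_two_iff.1 (by linarith)).resolve_right (rot_ne_zero h)

theorem no_sign_change {f : ℝ → ℝ} {s : Set ℝ} (hs : IsPreconnected s) (hf : ContinuousOn f s)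
    (h0 : ∀ t ∈ s, f t ≠ 0) {a b : ℝ} (ha : a ∈ s) (hb : b ∈ s) (h1 : f a < 0) (h2 : 0 < f b) :
    False := by
  obtain ⟨t, ht, h⟩ := hs.intermediate_value ha hb hf (⟨h1.le, h2.le⟩ : (0 : ℝ) ∈ Set.Icc _ _)
  exact h0 t ht h

/-- The sign of `arg (rot θ j ζ)` on `𝐓_k`. -/
def side (j k : SignType) : ℝ :=
  if (j = 0 ∧ k = 1) ∨ (j = 1 ∧ k = -1) ∨ (j = -1 ∧ k = 0) then 1 else -1

/-- Removing 𝐓_j and the opposite cut leaves two components, one in each of the other sectors; the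
sign of the imaginary part tells them apart. -/
theorem mem_sectorT_iff_side {θ : ℝ} {ζ : ℂ} {j k : SignType} (hjk : j ≠ k)
    (hs : rot θ j ζ ∈ Complex.slitPlane) (ha : Real.pi / 3 < |Complex.arg (rot θ j ζ)|) :
    ζ ∈ sectorT θ k ↔ 0 < side j k * (rot θ j ζ).im := by
  have h := ne_zero_of_rot hs
  have him : (rot θ j ζ).im < 0 ↔ Complex.arg (rot θ j ζ) < 0 := Complex.arg_neg_iff.symm
  have him0 : (rot θ j ζ).im ≠ 0 := by
    intro h0
    have h1 : 0 ≤ Complex.arg (rot θ j ζ) := Complex.arg_nonneg_iff.2 h0.ge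
    rcases Complex.mem_slitPlane_iff.1 hs with h2 | h2
    · rw [Complex.arg_eq_zero_iff.2 ⟨h2.le, h0⟩] at ha
      simp at ha
      linarith [Real.pi_pos]
    · exact h2 h0
  obtain ⟨n, -, hn⟩ := exists_logBr_eq (θ := θ) h j k
  have hlt := abs_arg_lt_of_slit hs
  have hb1 := Complex.neg_pi_lt_arg (rot θ k ζ)
  have hb2 := Complex.arg_le_pi (rot θ k ζ)
  change |Complex.arg (rot θ k ζ)| ≤ Real.pi / 3 ↔ _
  generalize Complex.arg (rot θ j ζ) = a at *
  generalize Complex.arg (rot θ k ζ) = b at *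
  generalize (rot θ j ζ).im = y at *
  have hp := Real.pi_pos
  have key : (0 < side j k * y ↔ 0 < side j k * a) := by
    unfold side
    split_ifs
    · rw [one_mul, one_mul]
      rcases lt_or_gt_of_ne him0 with h1 | h1
      · have := him.1 h1
        constructor <;> intro <;> linarith
      · have : 0 ≤ a := not_lt.1 fun h2 => (him.2 h2).not_gt h1
        rcases this.eq_or_lt with h3 | h3
        · rw [← h3] at ha; simp at ha; linarith
        · constructor <;> intro <;> linarith
    · rw [neg_one_mul, neg_one_mul, neg_pos, neg_pos, him]
  rw [key]
  obtain ⟨hlt1, hlt2⟩ := abs_lt.1 hlt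
  rw [lt_abs] at ha
  rw [abs_le]
  clear key him him0
  have hd : |(j : ℝ) - (k : ℝ)| ≤ 2 := by
    fin_cases j <;> fin_cases k <;> norm_num
  obtain ⟨hd1, hd2⟩ := abs_le.1 hd
  have hn1 : n < 2 := by
    have : (n : ℝ) < 2 := by
      by_contra! h2
      nlinarith
    exact_mod_cast this
  have hn2 : -2 < n := by
    have : (-2 : ℝ) < n := by
      by_contra! h2
      nlinarith
    exact_mod_cast this
  clear hd hd1 hd2
  have hn3 : n = -1 ∨ n = 0 ∨ n = 1 := by omega
  clear hn1 hn2
  revert hjk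
  fin_cases j <;> fin_cases k <;> intro hjk <;>
    first
    | exact absurd rfl hjk
    | (simp [side] at hn ⊢
       rcases hn3 with rfl | rfl | rfl <;> rcases ha with ha | ha <;> push_cast at hn <;>
         first
         | (exfalso; linarith)
         | (constructor
            · intro h5; linarith
            · intro h5; first | (exfalso; linarith) | (constructor <;> linarith)))

/-! ### Progressive paths avoid the cut and the third sector -/

section Paths

variable {P : Problem} {θ : ℝ} {e : SignType → OnePoint ℂ} {j k : SignType} {γ : ℝ → ℂ}

theorem Problem.ζ_ne_zero (P : Problem) {z : ℂ} (hz : z ∈ P.D) (h : z ≠ P.z₀) : P.ζ z ≠ 0 := by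
  intro h0
  exact h (P.injOn_ζ hz P.z₀_mem (h0.trans P.ζ_z₀.symm))

theorem IsProgressive.ζ_ne_zero (h : IsProgressive P θ e j k γ) {t : ℝ}
    (ht : t ∈ Set.Ioo (0 : ℝ) 1) : P.ζ (γ t) ≠ 0 :=
  P.ζ_ne_zero (h.mem t ht).1 (h.mem t ht).2

theorem IsProgressive.continuousOn_ζ (h : IsProgressive P θ e j k γ) :
    ContinuousOn (fun t => P.ζ (γ t)) (Set.Ioo 0 1) :=
  P.analytic_ζ.continuousOn.comp h.continuousOn fun t ht => (h.mem t ht).1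

theorem IsProgressive.continuousOn_rot (h : IsProgressive P θ e j k γ) (i : SignType) :
    ContinuousOn (fun t => rot θ i (P.ζ (γ t))) (Set.Ioo 0 1) :=
  (continuous_rot θ i).comp_continuousOn h.continuousOn_ζ

/-- On the cut the height is zero, so up to that time it is nonnegative by monotonicity. The path
starts with positive real part and would have to reach the cut, where the real part is negative,
without crossing the imaginary axis. -/
theorem IsProgressive.slit (h : IsProgressive P θ e j k γ) {t : ℝ}
    (ht : t ∈ Set.Ioo (0 : ℝ) 1) : rot θ j (P.ζ (γ t)) ∈ Complex.slitPlane := by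
  by_contra hs
  have h0 := height_eq_zero_of_not_slit (h.ζ_ne_zero ht) hs
  obtain ⟨s, hs1, hs2, hs3⟩ : ∃ s, 0 < s ∧ s < t ∧ 0 < height θ j (P.ζ (γ s)) := by
    have h1 := h.start_height.eventually_gt_atTop 0
    have h2 : ∀ᶠ s in 𝓝[>] (0 : ℝ), s ∈ Set.Ioo 0 t := Ioo_mem_nhdsGT ht.1
    obtain ⟨s, hs, hs'⟩ := (h1.and h2).exists
    exact ⟨s, hs'.1, hs'.2, hs⟩
  have hsub : Set.Icc s t ⊆ Set.Ioo (0 : ℝ) 1 := fun x hx =>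
    ⟨hs1.trans_le hx.1, hx.2.trans_lt ht.2⟩
  refine no_sign_change (f := fun t => (rot θ j (P.ζ (γ t))).re) (s := Set.Icc s t) (a := t)
    (b := s) isPreconnected_Icc
    (Complex.continuous_re.comp_continuousOn ((h.continuousOn_rot j).mono hsub)) ?_
    ⟨hs2.le, le_rfl⟩ ⟨le_rfl, hs2.le⟩ ?_
    (re_rot_pos_of_height_pos (h.ζ_ne_zero (hsub ⟨le_rfl, hs2.le⟩)) hs3)
  · intro x hx
    refine re_rot_ne_zero_of_height_nonneg (h.ζ_ne_zero (hsub hx)) ?_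
    rw [← h0]
    exact h.antitone (hsub hx) ht hx.2
  · rw [Complex.mem_slitPlane_iff, not_or, not_not, not_lt] at hs
    refine lt_of_le_of_ne hs.1 fun h1 => ?_
    exact rot_ne_zero (h.ζ_ne_zero ht) (Complex.ext h1 hs.2)

/-- Outside 𝐓_j the height is negative and stays so, hence the path cannot return to 𝐓_j. It cannot
reach the cut either, so it is trapped in one of the two remaining components, and this must be the
one where it ends. -/
theorem IsProgressive.mem_sectors (h : IsProgressive P θ e j k γ) (hjk : j ≠ k) {t : ℝ}
    (ht : t ∈ Set.Ioo (0 : ℝ) 1) : P.ζ (γ t) ∈ sectorT θ j ∨ P.ζ (γ t) ∈ sectorT θ k := by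
  by_contra! hn
  have ha : Real.pi / 3 < |Complex.arg (rot θ j (P.ζ (γ t)))| := not_le.1 hn.1
  have hneg := height_neg_of_arg (h.ζ_ne_zero ht) ha (abs_arg_lt_of_slit (h.slit ht))
  obtain ⟨s, hs1, hs2, hs3⟩ : ∃ s, t < s ∧ s < 1 ∧ P.ζ (γ s) ∈ sectorT θ k := by
    have h2 : ∀ᶠ s in 𝓝[<] (1 : ℝ), s ∈ Set.Ioo t 1 := Ioo_mem_nhdsLT ht.2
    obtain ⟨s, hs, hs'⟩ := (h.finish_sector.and h2).exists
    exact ⟨s, hs'.1, hs'.2, hs⟩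
  have hsub : Set.Icc t s ⊆ Set.Ioo (0 : ℝ) 1 := fun x hx =>
    ⟨ht.1.trans_le hx.1, hx.2.trans_lt hs2⟩
  have harg : ∀ x ∈ Set.Icc t s, Real.pi / 3 < |Complex.arg (rot θ j (P.ζ (γ x)))| := by
    intro x hx
    by_contra! h1
    have h2 := height_nonneg_of_mem (h.ζ_ne_zero (hsub hx)) h1
    have h3 : height θ j (P.ζ (γ x)) ≤ height θ j (P.ζ (γ t)) := h.antitone ht (hsub hx) hx.1
    linarith
  have hside : side j k = 1 ∨ side j k = -1 := by unfold side; split_ifs <;> simp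
  have hne : ∀ x ∈ Set.Icc t s, (rot θ j (P.ζ (γ x))).im ≠ 0 := by
    intro x hx h0
    have h1 := harg x hx
    have hp := Real.pi_pos
    have h4 : 0 ≤ Complex.arg (rot θ j (P.ζ (γ x))) := Complex.arg_nonneg_iff.2 h0.ge
    rcases Complex.mem_slitPlane_iff.1 (h.slit (hsub hx)) with h2 | h2
    · rw [Complex.arg_eq_zero_iff.2 ⟨h2.le, h0⟩] at h1
      simp at h1
      linarith
    · exact h2 h0
  have hi := mem_sectorT_iff_side hjk (h.slit ht) ha
  have hm : t ∈ Set.Icc t s := ⟨le_rfl, hs1.le⟩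
  have hm' : s ∈ Set.Icc t s := ⟨hs1.le, le_rfl⟩
  refine no_sign_change (f := fun t => side j k * (rot θ j (P.ζ (γ t))).im) (s := Set.Icc t s)
    (a := t) (b := s) isPreconnected_Icc
    (continuousOn_const.mul
      (Complex.continuous_im.comp_continuousOn ((h.continuousOn_rot j).mono hsub))) ?_ hm hm'
    ?_ ((mem_sectorT_iff_side hjk (h.slit (hsub hm')) (harg s hm')).1 hs3)
  · intro x hx
    exact mul_ne_zero (by rcases hside with h5 | h5 <;> rw [h5] <;> norm_num) (hne x hx)
  · refine lt_of_le_of_ne (not_lt.1 fun h6 => hn.2 (hi.2 h6)) ?_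
    exact mul_ne_zero (by rcases hside with h5 | h5 <;> rw [h5] <;> norm_num) (hne t hm)

theorem IsProgressive.height_neg (h : IsProgressive P θ e j k γ) (hjk : j ≠ k) {t : ℝ}
    (ht : t ∈ Set.Ioo (0 : ℝ) 1) : height θ k (P.ζ (γ t)) = -height θ j (P.ζ (γ t)) := by
  rcases h.mem_sectors hjk ht with h1 | h1
  · rw [height_eq_neg hjk.symm h1 (h.ζ_ne_zero ht), neg_neg]
  · exact height_eq_neg hjk h1 (h.ζ_ne_zero ht)

theorem IsR2Arc.reverse {γ : ℝ → ℂ} {a b : ℝ} (hab : a < b) (h : IsR2Arc γ a b) :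
    IsR2Arc (fun t => γ (1 - t)) (1 - b) (1 - a) := by
  obtain ⟨c, hc, hd, hγ⟩ := h
  have hmap : Set.MapsTo (fun t : ℝ => 1 - t) (Set.Icc (1 - b) (1 - a)) (Set.Icc a b) := by
    intro t ht
    exact ⟨by linarith [ht.2], by linarith [ht.1]⟩
  have hmap' : ∀ t ∈ Set.Ioo (1 - b) (1 - a), 1 - t ∈ Set.Ioo a b := by
    intro t ht
    exact ⟨by linarith [ht.2], by linarith [ht.1]⟩
  refine ⟨fun t => c (1 - t), ?_, ?_, ?_⟩
  · exact hc.comp (contDiff_const.sub contDiff_id).contDiffOn hmap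
  · intro t ht
    have h1 : HasDerivWithinAt c (derivWithin c (Set.Icc a b) (1 - t)) (Set.Icc a b) (1 - t) :=
      ((hc.differentiableOn (by norm_num)) _ (hmap ht)).hasDerivWithinAt
    have h2 : HasDerivWithinAt (fun t : ℝ => 1 - t) (-1) (Set.Icc (1 - b) (1 - a)) t := by
      simpa using ((hasDerivAt_id t).const_sub 1).hasDerivWithinAt
    have h3 := h1.scomp t h2 hmap
    have h4 : derivWithin (fun t => c (1 - t)) (Set.Icc (1 - b) (1 - a)) t = _ :=
      h3.derivWithin (uniqueDiffOn_Icc (by linarith) t ht)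
    rw [h4]
    simpa using hd _ (hmap ht)
  · rcases hγ with hγ | hγ
    · exact Or.inl fun t ht => hγ _ (hmap' t ht)
    · exact Or.inr fun t ht => hγ _ (hmap' t ht)

theorem tendsto_one_sub_zero : Tendsto (fun t : ℝ => 1 - t) (𝓝[>] 0) (𝓝[<] 1) := by
  refine tendsto_nhdsWithin_iff.2 ⟨?_, ?_⟩
  · have : Tendsto (fun t : ℝ => 1 - t) (𝓝 0) (𝓝 (1 - 0)) := tendsto_const_nhds.sub tendsto_id
    rw [sub_zero] at this
    exact this.mono_left nhdsWithin_le_nhds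
  · filter_upwards [self_mem_nhdsWithin] with t ht
    have : (0 : ℝ) < t := ht
    show 1 - t < 1
    linarith

theorem tendsto_one_sub_one : Tendsto (fun t : ℝ => 1 - t) (𝓝[<] 1) (𝓝[>] 0) := by
  refine tendsto_nhdsWithin_iff.2 ⟨?_, ?_⟩
  · have : Tendsto (fun t : ℝ => 1 - t) (𝓝 1) (𝓝 (1 - 1)) := tendsto_const_nhds.sub tendsto_id
    rw [sub_self] at this
    exact this.mono_left nhdsWithin_le_nhds
  · filter_upwards [self_mem_nhdsWithin] with t ht
    have : t < (1 : ℝ) := ht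
    show 0 < 1 - t
    linarith

/-- Since the path stays in 𝐓_j ∪ 𝐓_k, the two heights are opposite along all of it, not only at its
ends. Through this lemma every statement about a start applies to an end. -/
theorem IsProgressive.reverse (h : IsProgressive P θ e j k γ) (hjk : j ≠ k) :
    IsProgressive P θ e k j (fun t => γ (1 - t)) := by
  have hmap : ∀ t ∈ Set.Ioo (0 : ℝ) 1, 1 - t ∈ Set.Ioo (0 : ℝ) 1 := fun t ht =>
    ⟨by linarith [ht.2], by linarith [ht.1]⟩
  have hI0 : ∀ᶠ t in 𝓝[>] (0 : ℝ), t ∈ Set.Ioo (0 : ℝ) 1 := Ioo_mem_nhdsGT one_pos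
  have hI1 : ∀ᶠ t in 𝓝[<] (1 : ℝ), t ∈ Set.Ioo (0 : ℝ) 1 := Ioo_mem_nhdsLT one_pos
  refine ⟨?_, ?_, fun t ht => h.mem _ (hmap t ht), h.finish.comp tendsto_one_sub_zero,
    h.start.comp tendsto_one_sub_one, tendsto_one_sub_zero.eventually h.finish_sector,
    tendsto_one_sub_one.eventually h.start_sector, ?_, ?_, ?_⟩
  · exact h.continuousOn.comp (by fun_prop) hmap
  · obtain ⟨N, τ, hτ, h0, h1, hc⟩ := h.chain
    refine ⟨N, fun i => 1 - τ (Fin.rev i), ?_, ?_, ?_, ?_⟩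
    · intro a b hab
      have := hτ (Fin.rev_lt_rev.2 hab)
      show 1 - τ a.rev < 1 - τ b.rev
      linarith
    · simp [h1]
    · simp [h0]
    · intro i
      have h2 := hc i.rev
      have h3 := IsR2Arc.reverse (hτ (Fin.castSucc_lt_succ (i := i.rev))) h2
      show IsR2Arc _ (1 - τ i.castSucc.rev) (1 - τ i.succ.rev)
      rw [Fin.rev_castSucc, Fin.rev_succ]
      exact h3
  · intro s hs t ht hst
    show height θ k (P.ζ (γ (1 - t))) ≤ height θ k (P.ζ (γ (1 - s)))
    rw [h.height_neg hjk (hmap s hs), h.height_neg hjk (hmap t ht), neg_le_neg_iff]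
    exact h.antitone (hmap t ht) (hmap s hs) (by linarith)
  · refine (tendsto_neg_atBot_atTop.comp (h.finish_height.comp tendsto_one_sub_zero)).congr' ?_
    filter_upwards [hI0] with t ht
    exact (h.height_neg hjk (hmap t ht)).symm
  · refine (tendsto_neg_atTop_atBot.comp (h.start_height.comp tendsto_one_sub_one)).congr' ?_
    filter_upwards [hI1] with t ht
    exact (h.height_neg hjk (hmap t ht)).symm

end Paths

end TurningPointLG

namespace TurningPointLG

/-! ### The Liouville-Green system along a path -/

/-- The system `A' = -m (A + b) / (2r)`, `(e^{-2rx} b)' = e^{-2rx} m (A + b) / (2r)` on `(0, 1)`, where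
`Re x` decreases from `+∞` to `-∞`, `m` is integrable, and `A + b → 1` at the beginning. -/
structure IsLGFlow (r : ℝ) (x m A b : ℝ → ℂ) : Prop where
  pos : 0 < r
  cont_x : ContinuousOn x (Set.Ioo 0 1)
  cont_A : ContinuousOn A (Set.Ioo 0 1)
  cont_b : ContinuousOn b (Set.Ioo 0 1)
  deriv_off : ∃ S : Set ℝ, S.Countable ∧ ∀ t ∈ Set.Ioo (0 : ℝ) 1 \ S,
    HasDerivAt A (-(m t * (A t + b t)) / (2 * r)) t ∧
    HasDerivAt (fun t => Complex.exp (-(2 * r * x t)) * b t)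
      (Complex.exp (-(2 * r * x t)) * (m t * (A t + b t)) / (2 * r)) t
  integrable : IntervalIntegrable m MeasureTheory.volume 0 1
  antitone : AntitoneOn (fun t => (x t).re) (Set.Ioo 0 1)
  start : Tendsto (fun t => (x t).re) (𝓝[>] 0) atTop
  finish : Tendsto (fun t => (x t).re) (𝓝[<] 1) atBot
  init : Tendsto (fun t => A t + b t) (𝓝[>] 0) (𝓝 1)

namespace IsLGFlow

variable {r : ℝ} {x m A b : ℝ → ℂ}

/-- The variation `∫_0^t |m|`. -/
noncomputable def variation (m : ℝ → ℂ) (t : ℝ) : ℝ := ∫ s in (0 : ℝ)..t, ‖m s‖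

theorem integrable_sub (h : IsLGFlow r x m A b) {s t : ℝ} (hs : 0 ≤ s) (hst : s ≤ t)
    (ht : t ≤ 1) : IntervalIntegrable m MeasureTheory.volume s t :=
  h.integrable.mono_set (by
    rw [Set.uIcc_of_le hst, Set.uIcc_of_le zero_le_one]
    exact Set.Icc_subset_Icc hs ht)

theorem integral_norm_eq (h : IsLGFlow r x m A b) {s t : ℝ} (hs : 0 ≤ s) (hst : s ≤ t)
    (ht : t ≤ 1) : ∫ y in s..t, ‖m y‖ = variation m t - variation m s := by
  unfold variation
  rw [intervalIntegral.integral_interval_sub_left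
    (h.integrable_sub le_rfl (hs.trans hst) ht).norm
    (h.integrable_sub le_rfl hs (hst.trans ht)).norm]

theorem variation_mono (h : IsLGFlow r x m A b) {s t : ℝ} (hs : 0 ≤ s) (hst : s ≤ t)
    (ht : t ≤ 1) : variation m s ≤ variation m t := by
  have := h.integral_norm_eq hs hst ht
  have h2 : 0 ≤ ∫ y in s..t, ‖m y‖ :=
    intervalIntegral.integral_nonneg hst fun _ _ => norm_nonneg _
  linarith

theorem variation_continuousOn (h : IsLGFlow r x m A b) :
    ContinuousOn (variation m) (Set.Icc 0 1) := by
  have := intervalIntegral.continuousOn_primitive_interval' h.integrable.norm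
    (a := 0) (Set.left_mem_uIcc)
  rwa [Set.uIcc_of_le zero_le_one] at this

theorem variation_zero : variation m 0 = 0 := intervalIntegral.integral_same

theorem variation_nonneg (h : IsLGFlow r x m A b) {t : ℝ} (ht : 0 ≤ t) (ht1 : t ≤ 1) :
    0 ≤ variation m t := by
  rw [← variation_zero (m := m)]
  exact h.variation_mono le_rfl ht ht1

theorem variation_tendsto_zero (h : IsLGFlow r x m A b) :
    Tendsto (variation m) (𝓝[>] 0) (𝓝 0) := by
  have h1 := (h.variation_continuousOn 0 ⟨le_rfl, zero_le_one⟩).tendsto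
  rw [variation_zero] at h1
  refine h1.mono_left ?_
  rw [← nhdsWithin_Ioo_eq_nhdsGT (zero_lt_one' ℝ)]
  exact nhdsWithin_mono _ Set.Ioo_subset_Icc_self

theorem variation_tendsto_one (h : IsLGFlow r x m A b) :
    Tendsto (variation m) (𝓝[<] 1) (𝓝 (variation m 1)) := by
  have h1 := (h.variation_continuousOn 1 ⟨zero_le_one, le_rfl⟩).tendsto
  refine h1.mono_left ?_
  rw [← nhdsWithin_Ioo_eq_nhdsLT (zero_lt_one' ℝ)]
  exact nhdsWithin_mono _ Set.Ioo_subset_Icc_self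

theorem sub_le (h : IsLGFlow r x m A b) {s t M : ℝ} (hs : 0 < s) (hst : s ≤ t) (ht : t < 1)
    (hM : ∀ y ∈ Set.Icc s t, ‖A y + b y‖ ≤ M) :
    ‖A t - A s‖ ≤ M / (2 * r) * (variation m t - variation m s) := by
  obtain ⟨S, hS, hd⟩ := h.deriv_off
  have hr := h.pos
  have hsub : Set.Icc s t ⊆ Set.Ioo (0 : ℝ) 1 := fun y hy =>
    ⟨hs.trans_le hy.1, hy.2.trans_lt ht⟩
  have hint : IntervalIntegrable (fun y => -(m y * (A y + b y)) / (2 * r))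
      MeasureTheory.volume s t := by
    refine IntervalIntegrable.div_const (IntervalIntegrable.neg ?_) _
    refine (h.integrable_sub hs.le hst ht.le).mul_continuousOn ?_
    rw [Set.uIcc_of_le hst]
    exact (h.cont_A.add h.cont_b).mono hsub
  have e := MeasureTheory.integral_eq_of_hasDerivAt_off_countable_of_le A _ hst hS
    (h.cont_A.mono hsub)
    (fun y hy => (hd y ⟨hsub (Set.Ioo_subset_Icc_self hy.1), hy.2⟩).1) hint
  rw [← e, ← h.integral_norm_eq hs.le hst ht.le, ← intervalIntegral.integral_const_mul]
  refine intervalIntegral.norm_integral_le_of_norm_le hst ?_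
    ((h.integrable_sub hs.le hst ht.le).norm.const_mul _)
  refine Filter.Eventually.of_forall fun y hy => ?_
  have h2 : ‖(2 * r : ℂ)‖ = 2 * r := by simp [abs_of_pos hr]
  rw [norm_div, norm_neg, norm_mul, h2, div_mul_eq_mul_div, mul_comm M]
  gcongr
  exact hM y ⟨hy.1.le, hy.2⟩

/-- Variation of constants; the kernel e^{2r(x(t) - x(y))} has modulus at most one for y ≤ t because
Re x is nonincreasing. -/
theorem norm_b_le (h : IsLGFlow r x m A b) {s t M : ℝ} (hs : 0 < s) (hst : s ≤ t) (ht : t < 1)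
    (hM : ∀ y ∈ Set.Icc s t, ‖A y + b y‖ ≤ M) :
    ‖b t‖ ≤ Real.exp (2 * r * ((x t).re - (x s).re)) * ‖b s‖ +
      M / (2 * r) * (variation m t - variation m s) := by
  obtain ⟨S, hS, hd⟩ := h.deriv_off
  have hr := h.pos
  have hsub : Set.Icc s t ⊆ Set.Ioo (0 : ℝ) 1 := fun y hy =>
    ⟨hs.trans_le hy.1, hy.2.trans_lt ht⟩
  have hE : ContinuousOn (fun t => Complex.exp (-(2 * r * x t))) (Set.Icc s t) :=
    ((continuousOn_const.mul (h.cont_x.mono hsub)).neg).cexp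
  have hint : IntervalIntegrable
      (fun y => Complex.exp (-(2 * r * x y)) * (m y * (A y + b y)) / (2 * r))
      MeasureTheory.volume s t := by
    refine IntervalIntegrable.div_const ?_ _
    refine IntervalIntegrable.continuousOn_mul ?_ (by rwa [Set.uIcc_of_le hst])
    refine (h.integrable_sub hs.le hst ht.le).mul_continuousOn ?_
    rw [Set.uIcc_of_le hst]
    exact (h.cont_A.add h.cont_b).mono hsub
  have e := MeasureTheory.integral_eq_of_hasDerivAt_off_countable_of_le
    (fun t => Complex.exp (-(2 * r * x t)) * b t) _ hst hS
    (hE.mul (h.cont_b.mono hsub))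
    (fun y hy => (hd y ⟨hsub (Set.Ioo_subset_Icc_self hy.1), hy.2⟩).2) hint
  have e2 : b t = Complex.exp (2 * r * (x t - x s)) * b s +
      ∫ y in s..t, Complex.exp (2 * r * (x t - x y)) * (m y * (A y + b y)) / (2 * r) := by
    have e3 : ∀ y, Complex.exp (2 * r * (x t - x y)) * (m y * (A y + b y)) / (2 * r) =
        Complex.exp (2 * r * x t) *
          (Complex.exp (-(2 * r * x y)) * (m y * (A y + b y)) / (2 * r)) := by
      intro y
      rw [mul_sub, sub_eq_add_neg, Complex.exp_add]
      ring
    simp only [e3]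
    rw [intervalIntegral.integral_const_mul, e, mul_sub, sub_eq_add_neg (2 * r * x t),
      Complex.exp_add, Complex.exp_neg, Complex.exp_neg]
    field_simp [Complex.exp_ne_zero]
    ring
  have hn : ∀ y, ‖Complex.exp (2 * r * (x t - x y))‖ =
      Real.exp (2 * r * ((x t).re - (x y).re)) := by
    intro y
    rw [Complex.norm_exp]
    congr 1
    have : (2 * r * (x t - x y) : ℂ) = ((2 * r : ℝ) : ℂ) * (x t - x y) := by push_cast; ring
    rw [this, Complex.re_ofReal_mul, Complex.sub_re]
  rw [e2]
  refine (norm_add_le _ _).trans (add_le_add ?_ ?_)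
  · rw [norm_mul, hn]
  rw [← h.integral_norm_eq hs.le hst ht.le, ← intervalIntegral.integral_const_mul]
  refine intervalIntegral.norm_integral_le_of_norm_le hst ?_
    ((h.integrable_sub hs.le hst ht.le).norm.const_mul _)
  refine Filter.Eventually.of_forall fun y hy => ?_
  have h2 : ‖(2 * r : ℂ)‖ = 2 * r := by simp [abs_of_pos hr]
  have hy' : y ∈ Set.Icc s t := ⟨hy.1.le, hy.2⟩
  have h3 : (x t).re ≤ (x y).re := h.antitone (hsub hy') (hsub ⟨hst, le_rfl⟩) hy.2
  have h4 : Real.exp (2 * r * ((x t).re - (x y).re)) ≤ 1 := by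
    rw [Real.exp_le_one_iff]
    exact mul_nonpos_of_nonneg_of_nonpos (by positivity) (by linarith)
  rw [norm_div, norm_mul, norm_mul, h2, hn, div_mul_eq_mul_div, mul_comm M]
  refine (div_le_div_iff_of_pos_right (by positivity)).2 ?_
  calc _ ≤ 1 * (‖m y‖ * ‖A y + b y‖) := by gcongr
    _ ≤ ‖m y‖ * M := by rw [one_mul]; gcongr; exact hM y hy'

theorem exp_tendsto_zero (h : IsLGFlow r x m A b) (t : ℝ) :
    Tendsto (fun s => Real.exp (2 * r * ((x t).re - (x s).re))) (𝓝[>] 0) (𝓝 0) := by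
  refine Real.tendsto_exp_atBot.comp ?_
  have hr := h.pos
  refine Tendsto.const_mul_atBot (by positivity) ?_
  exact tendsto_atBot_add_const_left _ _ (tendsto_neg_atTop_atBot.comp h.start)

theorem exists_start (h : IsLGFlow r x m A b) :
    ∃ δ, 0 < δ ∧ δ < 1 ∧ ∀ y, 0 < y → y ≤ δ → ‖A y + b y‖ ≤ 2 := by
  have h1 : ∀ᶠ t in 𝓝[>] (0 : ℝ), ‖A t + b t‖ < 2 :=
    h.init.norm.eventually_lt_const (by norm_num)
  obtain ⟨δ, hδ, hδ'⟩ := mem_nhdsGT_iff_exists_Ioc_subset.1 h1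
  have hδ0 : (0 : ℝ) < δ := hδ
  refine ⟨min δ (1 / 2), by positivity, by
    exact (min_le_right _ _).trans_lt (by norm_num), fun y hy hy' => ?_⟩
  exact (hδ' ⟨hy, hy'.trans (min_le_left _ _)⟩).le

/-- Only A + b is controlled at the start. A has finite variation there, so A, and with it b, is
bounded separately. -/
theorem exists_b_bound (h : IsLGFlow r x m A b) :
    ∃ δ K, 0 < δ ∧ δ < 1 ∧ ∀ y, 0 < y → y ≤ δ → ‖b y‖ ≤ K := by
  obtain ⟨δ, h0, h1, hδ⟩ := h.exists_start
  refine ⟨δ, 2 + (‖A δ‖ + 2 / (2 * r) * (variation m δ - 0)), h0, h1, fun y hy hy' => ?_⟩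
  have e1 := h.sub_le hy hy' h1 (M := 2) fun z hz => hδ z (hy.trans_le hz.1) hz.2
  have e2 := hδ y hy hy'
  have e3 : ‖b y‖ ≤ ‖A y + b y‖ + ‖A y‖ := by
    have : b y = (A y + b y) - A y := by ring
    calc ‖b y‖ = ‖(A y + b y) - A y‖ := by rw [← this]
      _ ≤ _ := norm_sub_le _ _
  have e4 : ‖A y‖ ≤ ‖A δ‖ + ‖A δ - A y‖ := by
    have : A y = A δ - (A δ - A y) := by ring
    calc ‖A y‖ = ‖A δ - (A δ - A y)‖ := by rw [← this]
      _ ≤ _ := norm_sub_le _ _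
  have e5 : 2 / (2 * r) * (variation m δ - variation m y) ≤
      2 / (2 * r) * (variation m δ - 0) := by
    have := h.pos
    gcongr
    exact h.variation_nonneg hy.le (hy'.trans h1.le)
  linarith

/-- Let s → 0 in `norm_b_le`: as b is bounded and Re x(s) → +∞, the exponential removes the initial
value. This excludes a dominant component in a solution normalized at the start. -/
theorem norm_b_le_variation (h : IsLGFlow r x m A b) {t M : ℝ} (ht0 : 0 < t) (ht : t < 1)
    (hM : ∀ y, 0 < y → y ≤ t → ‖A y + b y‖ ≤ M) : ‖b t‖ ≤ M / (2 * r) * variation m t := by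
  obtain ⟨δ, K, h0, h1, hK⟩ := h.exists_b_bound
  have hr := h.pos
  have l1 : Tendsto (fun s => Real.exp (2 * r * ((x t).re - (x s).re)) * K +
      M / (2 * r) * (variation m t - variation m s)) (𝓝[>] 0)
      (𝓝 (0 * K + M / (2 * r) * (variation m t - 0))) :=
    ((h.exp_tendsto_zero t).mul_const K).add
      ((tendsto_const_nhds.sub h.variation_tendsto_zero).const_mul _)
  rw [zero_mul, zero_add, sub_zero] at l1
  refine ge_of_tendsto l1 ?_
  filter_upwards [Ioo_mem_nhdsGT (lt_min h0 ht0)] with s hs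
  have hs1 := hs.2.trans_le (min_le_left _ _)
  have hs2 := hs.2.trans_le (min_le_right _ _)
  refine (h.norm_b_le hs.1 hs2.le ht (M := M)
    fun y hy => hM y (hs.1.trans_le hy.1) hy.2).trans ?_
  gcongr
  exact hK s hs.1 hs1.le

/-- At the beginning of the path `b → 0`. -/
theorem b_tendsto_zero (h : IsLGFlow r x m A b) : Tendsto b (𝓝[>] 0) (𝓝 0) := by
  obtain ⟨δ, h0, h1, hδ⟩ := h.exists_start
  have l1 : Tendsto (fun t => 2 / (2 * r) * variation m t) (𝓝[>] 0) (𝓝 (2 / (2 * r) * 0)) :=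
    h.variation_tendsto_zero.const_mul _
  rw [mul_zero] at l1
  refine squeeze_zero_norm' ?_ l1
  filter_upwards [Ioo_mem_nhdsGT h0] with t ht
  exact h.norm_b_le_variation ht.1 (ht.2.trans h1) fun y hy hy' =>
    hδ y hy (hy'.trans ht.2.le)

theorem A_tendsto_one (h : IsLGFlow r x m A b) : Tendsto A (𝓝[>] 0) (𝓝 1) := by
  have := h.init.sub h.b_tendsto_zero
  simpa using this

theorem norm_A_sub_one_le (h : IsLGFlow r x m A b) {t M : ℝ} (ht0 : 0 < t) (ht : t < 1)
    (hM : ∀ y, 0 < y → y ≤ t → ‖A y + b y‖ ≤ M) : ‖A t - 1‖ ≤ M / (2 * r) * variation m t := by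
  have l1 : Tendsto (fun s => M / (2 * r) * (variation m t - variation m s)) (𝓝[>] 0)
      (𝓝 (M / (2 * r) * (variation m t - 0))) :=
    (tendsto_const_nhds.sub h.variation_tendsto_zero).const_mul _
  rw [sub_zero] at l1
  have l2 : Tendsto (fun s => ‖A t - A s‖) (𝓝[>] 0) (𝓝 ‖A t - 1‖) :=
    (tendsto_const_nhds.sub h.A_tendsto_one).norm
  refine le_of_tendsto_of_tendsto l2 l1 ?_
  filter_upwards [Ioo_mem_nhdsGT ht0] with s hs
  exact h.sub_le hs.1 hs.2.le ht fun y hy => hM y (hs.1.trans_le hy.1) hy.2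

theorem norm_sub_one_le (h : IsLGFlow r x m A b) {t M : ℝ} (ht0 : 0 < t) (ht : t < 1)
    (hM : ∀ y, 0 < y → y ≤ t → ‖A y + b y‖ ≤ M) :
    ‖A t + b t - 1‖ ≤ M / r * variation m t := by
  have h1 := h.norm_A_sub_one_le ht0 ht hM
  have h2 := h.norm_b_le_variation ht0 ht hM
  have h3 : A t + b t - 1 = (A t - 1) + b t := by ring
  have h4 : M / r * variation m t = M / (2 * r) * variation m t + M / (2 * r) * variation m t := by
    have := h.pos
    field_simp
    ring
  rw [h3, h4]
  exact (norm_add_le _ _).trans (add_le_add h1 h2)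

/-- Beyond a time s with little variation left, A and b each grow by at most a quarter of the
maximum of ‖A + b‖, so half of the maximum can be absorbed. -/
theorem bounded (h : IsLGFlow r x m A b) :
    ∃ M, 0 ≤ M ∧ ∀ t ∈ Set.Ioo (0 : ℝ) 1, ‖A t + b t‖ ≤ M := by
  have hr := h.pos
  obtain ⟨δ, h0, h1, hδ⟩ := h.exists_start
  obtain ⟨s, hs1, hs2, hs3⟩ : ∃ s, δ < s ∧ s < 1 ∧ variation m 1 - variation m s < r / 2 := by
    have e1 : ∀ᶠ s in 𝓝[<] (1 : ℝ), variation m 1 - r / 2 < variation m s :=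
      h.variation_tendsto_one.eventually_const_lt (by linarith)
    have e2 : ∀ᶠ s in 𝓝[<] (1 : ℝ), s ∈ Set.Ioo δ 1 := Ioo_mem_nhdsLT h1
    obtain ⟨s, hs, hs'⟩ := (e1.and e2).exists
    exact ⟨s, hs'.1, hs'.2, by linarith⟩
  have hs0 := h0.trans hs1
  have hcont : ContinuousOn (fun t => ‖A t + b t‖) (Set.Ioo 0 1) := (h.cont_A.add h.cont_b).norm
  obtain ⟨M1, hM1⟩ := (isCompact_Icc (a := δ) (b := s)).bddAbove_image
    (hcont.mono fun y hy => ⟨h0.trans_le hy.1, hy.2.trans_lt hs2⟩)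
  -- The three bounds serve the start, the compact middle and the tail; the factor 2 comes from the
  -- absorption.
  refine ⟨max (max 2 M1) (2 * (‖A s‖ + ‖b s‖)), by positivity, fun t ht => ?_⟩
  rcases le_total t δ with h3 | h3
  · exact (hδ t ht.1 h3).trans ((le_max_left _ _).trans (le_max_left _ _))
  rcases le_total t s with h4 | h4
  · exact (hM1 ⟨t, ⟨h3, h4⟩, rfl⟩).trans ((le_max_right _ _).trans (le_max_left _ _))
  refine le_trans ?_ (le_max_right _ _)
  have hsub : Set.Icc s t ⊆ Set.Ioo (0 : ℝ) 1 := fun y hy =>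
    ⟨hs0.trans_le hy.1, hy.2.trans_lt ht.2⟩
  obtain ⟨y, hy, hmax⟩ := (isCompact_Icc (a := s) (b := t)).exists_isMaxOn ⟨s, le_rfl, h4⟩
    (hcont.mono hsub)
  have hM : ∀ z ∈ Set.Icc s y, ‖A z + b z‖ ≤ ‖A y + b y‖ := fun z hz =>
    hmax ⟨hz.1, hz.2.trans hy.2⟩
  have hy1 : y < 1 := hy.2.trans_lt ht.2
  have e1 := h.sub_le hs0 hy.1 hy1 hM
  have e2 := h.norm_b_le hs0 hy.1 hy1 hM
  have e3 : variation m y - variation m s ≤ r / 2 := by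
    have := h.variation_mono (hs0.le.trans hy.1) hy1.le le_rfl
    linarith
  have e4 : ‖A y + b y‖ / (2 * r) * (variation m y - variation m s) ≤ ‖A y + b y‖ / 4 := by
    calc _ ≤ ‖A y + b y‖ / (2 * r) * (r / 2) := by gcongr
      _ = _ := by field_simp; ring
  have e5 : Real.exp (2 * r * ((x y).re - (x s).re)) * ‖b s‖ ≤ ‖b s‖ := by
    have h5 : (x y).re ≤ (x s).re := h.antitone ⟨hs0, hs2⟩ (hsub hy) hy.1
    have h6 : Real.exp (2 * r * ((x y).re - (x s).re)) ≤ 1 := by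
      rw [Real.exp_le_one_iff]
      exact mul_nonpos_of_nonneg_of_nonpos (by positivity) (by linarith)
    calc _ ≤ 1 * ‖b s‖ := by gcongr
      _ = _ := one_mul _
  have e6 : ‖A y + b y‖ ≤ ‖A s‖ + ‖A y - A s‖ + ‖b y‖ := by
    have : A y + b y = A s + (A y - A s) + b y := by ring
    rw [this]
    exact norm_add₃_le
  have e7 : ‖A t + b t‖ ≤ ‖A y + b y‖ := hmax ⟨h4, le_rfl⟩
  linarith

/-- At the end of the path `A` has a limit and `b → 0`. -/
theorem exists_limit (h : IsLGFlow r x m A b) :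
    ∃ c, Tendsto A (𝓝[<] 1) (𝓝 c) ∧ Tendsto b (𝓝[<] 1) (𝓝 0) ∧
      (variation m 1 ≤ r / 4 → c ≠ 0) := by
  have hr := h.pos
  obtain ⟨M, hM0, hM⟩ := h.bounded
  have hI1 : ∀ {s : ℝ}, s < 1 → ∀ᶠ t in 𝓝[<] (1 : ℝ), t ∈ Set.Ioo s 1 := fun hs =>
    Ioo_mem_nhdsLT hs
  have hsmall : ∀ ε, 0 < ε → ∃ s, 0 < s ∧ s < 1 ∧
      M / (2 * r) * (variation m 1 - variation m s) < ε := by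
    intro ε hε
    have l1 : Tendsto (fun s => M / (2 * r) * (variation m 1 - variation m s)) (𝓝[<] 1)
        (𝓝 (M / (2 * r) * (variation m 1 - variation m 1))) :=
      (tendsto_const_nhds.sub h.variation_tendsto_one).const_mul _
    rw [sub_self, mul_zero] at l1
    obtain ⟨s, hs, hs'⟩ := ((l1.eventually_lt_const hε).and (hI1 one_pos)).exists
    exact ⟨s, hs'.1, hs'.2, hs⟩
  have hle : ∀ {s t : ℝ}, 0 < s → s ≤ t → t < 1 →
      M / (2 * r) * (variation m t - variation m s) ≤
        M / (2 * r) * (variation m 1 - variation m s) := by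
    intro s t hs hst ht
    gcongr
    exact h.variation_mono (hs.le.trans hst) ht.le le_rfl
  have hMs : ∀ {s t : ℝ}, 0 < s → t < 1 → ∀ y ∈ Set.Icc s t, ‖A y + b y‖ ≤ M :=
    fun hs ht y hy => hM y ⟨hs.trans_le hy.1, hy.2.trans_lt ht⟩
  have hC : Cauchy (map A (𝓝[<] 1)) := by
    refine Metric.cauchy_iff.2 ⟨inferInstance, fun ε hε => ?_⟩
    obtain ⟨s, hs0, hs1, hs⟩ := hsmall (ε / 2) (by positivity)
    refine ⟨A '' Set.Ioo s 1, image_mem_map (Ioo_mem_nhdsLT hs1), ?_⟩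
    have hd : ∀ t ∈ Set.Ioo s 1, dist (A t) (A s) < ε / 2 := by
      intro t ht
      rw [dist_eq_norm]
      exact ((h.sub_le hs0 ht.1.le ht.2 (hMs hs0 ht.2)).trans
        (hle hs0 ht.1.le ht.2)).trans_lt hs
    rintro _ ⟨t, ht, rfl⟩ _ ⟨t', ht', rfl⟩
    have := dist_triangle_right (A t) (A t') (A s)
    have h1 := hd t ht
    have h2 := hd t' ht'
    linarith
  obtain ⟨c, hc⟩ := CompleteSpace.complete hC
  have hb : Tendsto b (𝓝[<] 1) (𝓝 0) := by
    rw [tendsto_zero_iff_norm_tendsto_zero]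
    refine tendsto_order.2 ⟨fun a ha => Filter.Eventually.of_forall fun t =>
      ha.trans_le (norm_nonneg _), fun ε hε => ?_⟩
    -- Choose s first, so that the integral from s to t is small for all t; then e^{2r Re(x(t) -
    -- x(s))} → 0 disposes of `b s`.
    obtain ⟨s, hs0, hs1, hs⟩ := hsmall (ε / 2) (by positivity)
    have l1 : Tendsto (fun t => Real.exp (2 * r * ((x t).re - (x s).re)) * ‖b s‖) (𝓝[<] 1)
        (𝓝 (0 * ‖b s‖)) := by
      refine Tendsto.mul_const _ (Real.tendsto_exp_atBot.comp ?_)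
      exact Tendsto.const_mul_atBot (by positivity)
        (tendsto_atBot_add_const_right _ (-(x s).re) h.finish)
    rw [zero_mul] at l1
    filter_upwards [l1.eventually_lt_const (half_pos hε), hI1 hs1] with t ht1 ht
    have := h.norm_b_le hs0 ht.1.le ht.2 (hMs hs0 ht.2)
    have := hle hs0 ht.1.le ht.2
    linarith
  refine ⟨c, hc, hb, fun hV hc0 => ?_⟩
  have hne : (Set.Ioo (0 : ℝ) 1).Nonempty := ⟨1 / 2, by norm_num, by norm_num⟩
  -- With total variation at most r/4, ‖A + b - 1‖ ≤ N/4 on the whole path; hence N ≤ 4/3 and ‖c -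
  -- 1‖ ≤ 1/3, which excludes c = 0.
  set N := sSup ((fun t => ‖A t + b t‖) '' Set.Ioo (0 : ℝ) 1)
  have hbdd : BddAbove ((fun t => ‖A t + b t‖) '' Set.Ioo (0 : ℝ) 1) :=
    ⟨M, by rintro _ ⟨t, ht, rfl⟩; exact hM t ht⟩
  have hN : ∀ t ∈ Set.Ioo (0 : ℝ) 1, ‖A t + b t‖ ≤ N := fun t ht => le_csSup hbdd ⟨t, ht, rfl⟩
  have hN0 : 0 ≤ N := (norm_nonneg _).trans (hN _ hne.some_mem)
  have hd : ∀ t ∈ Set.Ioo (0 : ℝ) 1, ‖A t + b t - 1‖ ≤ N / 4 := by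
    intro t ht
    refine (h.norm_sub_one_le ht.1 ht.2 fun y hy hy' => hN y ⟨hy, hy'.trans_lt ht.2⟩).trans ?_
    have := h.variation_mono ht.1.le ht.2.le le_rfl
    calc N / r * variation m t ≤ N / r * (r / 4) := by gcongr; linarith
      _ = N / 4 := by field_simp
  have hN1 : N ≤ 1 + N / 4 := by
    refine csSup_le (hne.image _) ?_
    rintro _ ⟨t, ht, rfl⟩
    have h1 := hd t ht
    have h2 : ‖A t + b t‖ ≤ ‖(1 : ℂ)‖ + ‖A t + b t - 1‖ := by
      have : A t + b t = 1 + (A t + b t - 1) := by ring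
      calc ‖A t + b t‖ = ‖1 + (A t + b t - 1)‖ := by rw [← this]
        _ ≤ _ := norm_add_le _ _
    rw [norm_one] at h2
    show ‖A t + b t‖ ≤ _
    linarith
  have l2 : Tendsto (fun t => ‖A t + b t - 1‖) (𝓝[<] 1) (𝓝 ‖c + 0 - 1‖) :=
    ((Tendsto.add hc hb).sub_const 1).norm
  have h3 : ‖c + 0 - 1‖ ≤ N / 4 := by
    refine le_of_tendsto l2 ?_
    filter_upwards [hI1 one_pos] with t ht using hd t ht
  rw [hc0] at h3
  norm_num at h3
  linarith

end IsLGFlow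

end TurningPointLG

namespace TurningPointLG

/-! ### Local form of the equation at the reference points -/

/-- The local coordinate at a point of the extended plane: `z - w` at `w`, and `1 / z` at infinity. -/
noncomputable def chart (a : OnePoint ℂ) (z : ℂ) : ℂ := a.elim z⁻¹ fun w => z - w

/-- The derivative of `chart`. -/
noncomputable def dchart (a : OnePoint ℂ) (z : ℂ) : ℂ := a.elim (-(z ^ 2)⁻¹) fun _ => 1

@[simp] theorem chart_coe (w z : ℂ) : chart (w : OnePoint ℂ) z = z - w := rfl
@[simp] theorem chart_infty (z : ℂ) : chart OnePoint.infty z = z⁻¹ := rfl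
@[simp] theorem dchart_coe (w z : ℂ) : dchart (w : OnePoint ℂ) z = 1 := rfl
@[simp] theorem dchart_infty (z : ℂ) : dchart OnePoint.infty z = -(z ^ 2)⁻¹ := rfl

theorem hasDerivAt_chart {a : OnePoint ℂ} {z : ℂ} (h : chart a z ≠ 0) :
    HasDerivAt (chart a) (dchart a z) z := by
  induction a using OnePoint.rec with
  | infty =>
    have hz : z ≠ 0 := by simpa using h
    exact hasDerivAt_inv hz
  | coe w => exact (hasDerivAt_id z).sub_const w

theorem dchart_ne_zero {a : OnePoint ℂ} {z : ℂ} (h : chart a z ≠ 0) : dchart a z ≠ 0 := by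
  induction a using OnePoint.rec with
  | infty =>
    have hz : z ≠ 0 := by simpa using h
    simp [hz]
  | coe w => simp

theorem isOpen_chart (a : OnePoint ℂ) (ε : ℝ) :
    IsOpen {z | chart a z ≠ 0 ∧ ‖chart a z‖ < ε} := by
  rw [isOpen_iff_mem_nhds]
  rintro z ⟨h1, h2⟩
  have hc := (hasDerivAt_chart h1).continuousAt
  filter_upwards [hc.eventually_ne h1, hc.norm.eventually_lt continuousAt_const h2] with y hy hy'
  exact ⟨hy, hy'⟩

/-- Near `a`, in the coordinate `v`, `f dz² = v^{-m} h(v) dv²` and `Φ = v^{⌊m/2⌋} A(v)`. -/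
structure IsEnd (P : Problem) (a : OnePoint ℂ) (ε : ℝ) (m : ℕ) (h A : ℂ → ℂ) : Prop where
  pos : 0 < ε
  two_le : 2 ≤ m
  diff_h : DifferentiableOn ℂ h (Metric.ball 0 ε)
  diff_A : DifferentiableOn ℂ A (Metric.ball 0 ε)
  h_ne : ∀ v ∈ Metric.ball (0 : ℂ) ε, h v ≠ 0
  f_eq : ∀ z, chart a z ≠ 0 → ‖chart a z‖ < ε →
    P.f z = h (chart a z) / chart a z ^ m * dchart a z ^ 2
  Phi_eq : ∀ z, chart a z ≠ 0 → ‖chart a z‖ < ε →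
    P.Phi z = chart a z ^ (m / 2) * A (chart a z)

/-- With R = f'/f one has f'' = f (R² + R'), so that only R, R' and one factor 1/f survive. -/
theorem schwarzian_of_log_deriv {f R : ℂ → ℂ} {R' z : ℂ} {U : Set ℂ} (hU : IsOpen U)
    (hf : ∀ y ∈ U, HasDerivAt f (f y * R y) y) (hz : z ∈ U) (hR : HasDerivAt R R' z)
    (h0 : f z ≠ 0) :
    (4 * f z * deriv (deriv f) z - 5 * deriv f z ^ 2) / (16 * f z ^ 3) =
      (4 * R' - R z ^ 2) / (16 * f z) := by
  have h1 : deriv f =ᶠ[𝓝 z] fun y => f y * R y := by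
    filter_upwards [hU.mem_nhds hz] with y hy using (hf y hy).deriv
  have h2 : HasDerivAt (fun y => f y * R y) (f z * R z * R z + f z * R') z := (hf z hz).mul hR
  rw [h1.deriv_eq, h1.eq_of_nhds, h2.deriv]
  field_simp
  ring

/-- The logarithmic derivative `v d/dv ln (v^{-m} h)`. -/
noncomputable def eulerLog (m : ℕ) (h : ℂ → ℂ) (v : ℂ) : ℂ := -m + v * deriv h v / h v

theorem differentiableOn_eulerLog {m : ℕ} {h : ℂ → ℂ} {ε : ℝ}
    (hh : DifferentiableOn ℂ h (Metric.ball 0 ε)) (h0 : ∀ v ∈ Metric.ball (0 : ℂ) ε, h v ≠ 0) :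
    DifferentiableOn ℂ (eulerLog m h) (Metric.ball 0 ε) :=
  ((differentiableOn_id.mul (hh.deriv Metric.isOpen_ball)).div hh h0).const_add _

/-- The left side is the Schwarzian derivative of ∫ f^{1/2} divided by 2f. A Möbius change of
variable adds no term to it, so z - w and 1/z lead to the same formula. -/
theorem schwarzian_eq {P : Problem} {a : OnePoint ℂ} {ε : ℝ} {m : ℕ} {h : ℂ → ℂ}
    (hh : DifferentiableOn ℂ h (Metric.ball 0 ε)) (h0 : ∀ v ∈ Metric.ball (0 : ℂ) ε, h v ≠ 0)
    (hf : ∀ z, chart a z ≠ 0 → ‖chart a z‖ < ε →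
      P.f z = h (chart a z) / chart a z ^ m * dchart a z ^ 2) {z : ℂ}
    (hz0 : chart a z ≠ 0) (hz : ‖chart a z‖ < ε) :
    (4 * P.f z * deriv (deriv P.f) z - 5 * deriv P.f z ^ 2) / (16 * P.f z ^ 3) =
      (4 * (chart a z * deriv (eulerLog m h) (chart a z)) - 4 * eulerLog m h (chart a z) -
        eulerLog m h (chart a z) ^ 2) * dchart a z ^ 2 / (16 * P.f z * chart a z ^ 2) := by
  have hb : ∀ {y}, ‖chart a y‖ < ε → chart a y ∈ Metric.ball (0 : ℂ) ε := fun hy => by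
    simpa using hy
  have hd : ∀ {y}, ‖chart a y‖ < ε → HasDerivAt h (deriv h (chart a y)) (chart a y) := fun hy =>
    ((hh _ (hb hy)).differentiableAt (Metric.isOpen_ball.mem_nhds (hb hy))).hasDerivAt
  have hL : HasDerivAt (eulerLog m h) (deriv (eulerLog m h) (chart a z)) (chart a z) :=
    ((differentiableOn_eulerLog hh h0 _ (hb hz)).differentiableAt
      (Metric.isOpen_ball.mem_nhds (hb hz))).hasDerivAt
  have hfz : P.f z ≠ 0 := by
    rw [hf z hz0 hz]
    exact mul_ne_zero (div_ne_zero (h0 _ (hb hz)) (pow_ne_zero _ hz0))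
      (pow_ne_zero _ (dchart_ne_zero hz0))
  have hpow : ∀ v : ℂ, v ≠ 0 → (m : ℂ) * v ^ (m - 1) = m * v ^ m / v := by
    intro v hv
    rcases m with _ | m
    · simp
    · rw [Nat.add_sub_cancel, pow_succ]
      field_simp
  induction a using OnePoint.rec with
  | coe w =>
    rw [schwarzian_of_log_deriv (R := fun y => eulerLog m h (y - w) / (y - w))
      (R' := (deriv (eulerLog m h) (z - w) * (z - w) - eulerLog m h (z - w)) / (z - w) ^ 2)
      (isOpen_chart w ε) ?_ ⟨hz0, hz⟩ ?_ hfz]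
    · simp only [chart_coe] at hz0
      simp only [chart_coe, dchart_coe]
      field_simp
    · rintro y ⟨hy0, hy⟩
      have e1 := ((hd hy).comp y (hasDerivAt_chart hy0)).div
        ((hasDerivAt_chart hy0).pow m) (pow_ne_zero _ hy0)
      have e2 : P.f =ᶠ[𝓝 y] ((h ∘ chart w) / (chart (w : OnePoint ℂ) ^ m)) := by
        filter_upwards [(isOpen_chart w ε).mem_nhds ⟨hy0, hy⟩] with x hx
        rw [hf x hx.1 hx.2]
        simp
      refine (e1.congr_of_eventuallyEq e2).congr_deriv ?_
      rw [hf y hy0 hy]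
      have h3 := h0 _ (hb hy)
      have h4 := hpow _ hy0
      simp only [chart_coe, dchart_coe, eulerLog, Pi.pow_apply, Function.comp] at hy0 h3 h4 ⊢
      rw [h4]
      field_simp
      ring
    · have e1 : HasDerivAt (fun y => eulerLog m h (y - w)) (deriv (eulerLog m h) (z - w)) z :=
        (hL.comp z (hasDerivAt_chart hz0)).congr_deriv (by simp)
      exact (e1.div ((hasDerivAt_id z).sub_const w) hz0).congr_deriv (by simp)
  | infty =>
    have hz1 : z ≠ 0 := by simpa using hz0
    -- The 4 is the exponent of (dv/dz)² = v⁴ at v = 1/z.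
    rw [schwarzian_of_log_deriv (R := fun y => -(y⁻¹ * (eulerLog m h y⁻¹ + 4)))
      (R' := -(-(z ^ 2)⁻¹ * (eulerLog m h z⁻¹ + 4) +
        z⁻¹ * (deriv (eulerLog m h) z⁻¹ * -(z ^ 2)⁻¹)))
      (isOpen_chart OnePoint.infty ε) ?_ ⟨hz0, hz⟩ ?_ hfz]
    · simp only [chart_infty, dchart_infty]
      field_simp
      ring
    · rintro y ⟨hy0, hy⟩
      have hy1 : y ≠ 0 := by simpa using hy0
      have e1 := (((hd hy).comp y (hasDerivAt_chart hy0)).div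
        ((hasDerivAt_chart hy0).pow m) (pow_ne_zero _ hy0)).mul
          (((hasDerivAt_chart hy0)).pow 4)
      have e2 : P.f =ᶠ[𝓝 y] ((h ∘ chart OnePoint.infty) / (chart OnePoint.infty ^ m)) *
          chart OnePoint.infty ^ 4 := by
        filter_upwards [(isOpen_chart OnePoint.infty ε).mem_nhds ⟨hy0, hy⟩] with x hx
        rw [hf x hx.1 hx.2]
        have : (-(x ^ 2)⁻¹) ^ 2 = (x⁻¹) ^ 4 := by
          rw [neg_sq, inv_pow, inv_pow, ← pow_mul]
        simp [this]
      refine (e1.congr_of_eventuallyEq e2).congr_deriv ?_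
      rw [hf y hy0 hy]
      have h3 := h0 _ (hb hy)
      have h4 := hpow _ hy0
      simp only [chart_infty, dchart_infty, eulerLog, Pi.pow_apply, Pi.div_apply,
        Function.comp] at hy0 h3 h4 ⊢
      rw [h4]
      have h6 : y⁻¹ ^ m ≠ 0 := pow_ne_zero _ hy0
      generalize h y⁻¹ = H at *
      generalize deriv h y⁻¹ = H' at *
      generalize y⁻¹ ^ m = V at *
      simp only [Nat.reduceSub, inv_pow]
      push_cast
      field_simp
      ring
    · have e1 : HasDerivAt (fun y => eulerLog m h y⁻¹)
          (deriv (eulerLog m h) z⁻¹ * -(z ^ 2)⁻¹) z :=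
        (hL.comp z (hasDerivAt_chart hz0)).congr_deriv (by simp)
      exact ((hasDerivAt_inv hz1).mul (e1.add_const 4)).neg

/-- The Schwarzian part of Φ carries v^{m-2} and g/f carries v^{m-q}. For m ≥ 3 both exponents are
at least ⌊m/2⌋. For m = 2 both are zero, and the constant terms 1/4 and -1/4 cancel: this is the
role of the condition on the double pole of g. -/
theorem exists_isEnd {P : Problem} {a : OnePoint ℂ} {ε : ℝ} {m q : ℕ} {h G : ℂ → ℂ} (hε : 0 < ε)
    (hh : DifferentiableOn ℂ h (Metric.ball 0 ε)) (h0 : ∀ v ∈ Metric.ball (0 : ℂ) ε, h v ≠ 0)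
    (hG : DifferentiableOn ℂ G (Metric.ball 0 ε))
    (hf : ∀ z, chart a z ≠ 0 → ‖chart a z‖ < ε →
      P.f z = h (chart a z) / chart a z ^ m * dchart a z ^ 2)
    (hg : ∀ z, chart a z ≠ 0 → ‖chart a z‖ < ε →
      P.g z = G (chart a z) / chart a z ^ q * dchart a z ^ 2)
    (hm : (3 ≤ m ∧ q = (m + 1) / 2) ∨ (m = 2 ∧ q = 2 ∧ G 0 = -1 / 4)) :
    ∃ A, IsEnd P a ε m h A := by
  have hL := differentiableOn_eulerLog (m := m) hh h0
  set N : ℂ → ℂ := fun v => (4 * (v * deriv (eulerLog m h) v) - 4 * eulerLog m h v -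
    eulerLog m h v ^ 2) / 16 with hN
  have hNd : DifferentiableOn ℂ N (Metric.ball 0 ε) := by
    refine DifferentiableOn.div_const ?_ _
    exact (((differentiableOn_id.mul (hL.deriv Metric.isOpen_ball)).const_mul 4).sub
      (hL.const_mul 4)).sub (hL.pow 2)
  have hPhi : ∀ z, chart a z ≠ 0 → ‖chart a z‖ < ε →
      P.Phi z = (N (chart a z) * chart a z ^ m / chart a z ^ 2 +
        G (chart a z) * chart a z ^ m / chart a z ^ q) / h (chart a z) := by
    intro z hz0 hz
    have hb : chart a z ∈ Metric.ball (0 : ℂ) ε := by simpa using hz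
    have h1 := h0 _ hb
    have h2 := dchart_ne_zero hz0
    unfold Problem.Phi
    rw [schwarzian_eq hh h0 hf hz0 hz, hf z hz0 hz, hg z hz0 hz, hN]
    dsimp only
    have h3 := pow_ne_zero m hz0
    have h4 := pow_ne_zero q hz0
    generalize chart a z ^ m = V at *
    generalize chart a z ^ q = V' at *
    field_simp
  have hball : (0 : ℂ) ∈ Metric.ball (0 : ℂ) ε := by simpa using hε
  rcases hm with ⟨hm, hq⟩ | ⟨hm, hq, hG0⟩
  · refine ⟨fun v => (N v * v ^ (m - 2 - m / 2) + G v) / h v, hε, by omega, hh,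
      ((hNd.mul (differentiableOn_pow _)).add hG).div hh h0, h0, hf, fun z hz0 hz => ?_⟩
    rw [hPhi z hz0 hz]
    have e1 : chart a z ^ m = chart a z ^ (m / 2) * chart a z ^ (m - 2 - m / 2) *
        chart a z ^ 2 := by
      rw [← pow_add, ← pow_add]; congr 1; omega
    have e2 : chart a z ^ m = chart a z ^ (m / 2) * chart a z ^ q := by
      rw [← pow_add]; congr 1; omega
    have e3 : N (chart a z) * chart a z ^ m / chart a z ^ 2 =
        N (chart a z) * (chart a z ^ (m / 2) * chart a z ^ (m - 2 - m / 2)) := by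
      rw [e1]; field_simp
    have e4 : G (chart a z) * chart a z ^ m / chart a z ^ q =
        G (chart a z) * chart a z ^ (m / 2) := by
      rw [e2]; field_simp
    rw [e3, e4]
    ring
  · subst hm hq
    have hN0 : N 0 + G 0 = 0 := by
      rw [hG0, hN]
      simp only [eulerLog]
      norm_num
    have hNG := hNd.add hG
    refine ⟨fun v => dslope (fun v => N v + G v) 0 v / h v, hε, le_rfl, hh,
      DifferentiableOn.div ?_ hh h0, h0, hf, fun z hz0 hz => ?_⟩
    · exact (Complex.differentiableOn_dslope (Metric.isOpen_ball.mem_nhds hball)).2 hNG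
    · rw [hPhi z hz0 hz]
      have e := sub_smul_dslope (fun v => N v + G v) 0 (chart a z)
      simp only [sub_zero, smul_eq_mul, hN0] at e
      rw [← mul_div_assoc, Nat.div_self two_pos, pow_one, e]
      field_simp

theorem exists_ball {p : ℂ → Prop} (h : ∀ᶠ v in 𝓝 (0 : ℂ), p v) :
    ∃ ε, 0 < ε ∧ ∀ v ∈ Metric.ball (0 : ℂ) ε, p v := by
  obtain ⟨ε, hε, h⟩ := Metric.eventually_nhds_iff_ball.1 h
  exact ⟨ε, hε, h⟩

theorem exists_zpow_form {g : ℂ → ℂ} {w : ℂ} {q : ℕ} (hg : MeromorphicAt g w)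
    (hq : ((-(q : ℤ) : ℤ) : WithTop ℤ) ≤ meromorphicOrderAt g w) :
    ∃ G : ℂ → ℂ, AnalyticAt ℂ G w ∧ ∀ᶠ z in 𝓝[≠] w, g z = G z / (z - w) ^ q := by
  by_cases ht : meromorphicOrderAt g w = ⊤
  · refine ⟨fun _ => 0, analyticAt_const, ?_⟩
    filter_upwards [meromorphicOrderAt_eq_top_iff.1 ht] with z hz
    simp [hz]
  · obtain ⟨n, hn⟩ := WithTop.ne_top_iff_exists.1 ht
    rw [← hn] at hq
    have hq' : -(q : ℤ) ≤ n := by exact_mod_cast hq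
    obtain ⟨G0, hG0, -, hG⟩ := (meromorphicOrderAt_eq_int_iff hg).1 hn.symm
    obtain ⟨k, hk⟩ : ∃ k : ℕ, n + q = k := ⟨(n + q).toNat, by omega⟩
    refine ⟨fun z => (z - w) ^ k * G0 z, by fun_prop, ?_⟩
    filter_upwards [hG, self_mem_nhdsWithin] with z hz hz'
    have h1 : z - w ≠ 0 := sub_ne_zero.2 hz'
    rw [hz, smul_eq_mul, eq_div_iff (pow_ne_zero _ h1), ← zpow_natCast (z - w) k, ← hk,
      zpow_add₀ h1, zpow_natCast]
    ring

theorem eventually_shift {p : ℂ → Prop} {w : ℂ} (h : ∀ᶠ z in 𝓝 w, p z) :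
    ∀ᶠ v in 𝓝 (0 : ℂ), p (v + w) := by
  have : Tendsto (fun v : ℂ => v + w) (𝓝 0) (𝓝 (0 + w)) :=
    (continuous_id.add continuous_const).tendsto 0
  rw [zero_add] at this
  exact this.eventually h

theorem AdmissiblePole.exists_isEnd {P : Problem} {w : ℂ} (h : P.AdmissiblePole w) :
    w ∉ P.D ∧ ∃ ε m h A, IsEnd P w ε m h A := by
  obtain ⟨hf, hg, hcase⟩ := h
  obtain ⟨m, q, hm, hfo, hgo⟩ : ∃ m q : ℕ,
      ((3 ≤ m ∧ q = (m + 1) / 2) ∨ (m = 2 ∧ q = 2 ∧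
        Tendsto (fun z => (z - w) ^ 2 * P.g z) (𝓝[≠] w) (𝓝 (-1 / 4)))) ∧
      meromorphicOrderAt P.f w = ((-(m : ℤ) : ℤ) : WithTop ℤ) ∧
      ((-(q : ℤ) : ℤ) : WithTop ℤ) ≤ meromorphicOrderAt P.g w := by
    rcases hcase with ⟨m, hm, hfo, hgo⟩ | ⟨hfo, hgo, hlim⟩
    · refine ⟨m, (m + 1) / 2, Or.inl ⟨hm, rfl⟩, hfo, ?_⟩
      rcases hgo with hgo | ⟨p, hgo, hp⟩
      · refine le_trans ?_ hgo
        exact_mod_cast (by omega : -(((m + 1) / 2 : ℕ) : ℤ) ≤ 0)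
      · rw [hgo]
        -- For integers, p < m/2 + 1 means p ≤ ⌈m/2⌉, which is q.
        have h1 : (2 * p : ℝ) < m + 2 := by linarith
        have h2 : 2 * p < m + 2 := by exact_mod_cast h1
        have h3 : -(((m + 1) / 2 : ℕ) : ℤ) ≤ -(p : ℤ) := by omega
        exact_mod_cast h3
    · exact ⟨2, 2, Or.inr ⟨rfl, rfl, hlim⟩, hfo, hgo.ge⟩
  have hm0 : 0 < m := by omega
  constructor
  · intro hw
    have h1 : Tendsto P.f (𝓝[≠] w) (𝓝 (P.f w)) :=
      ((P.analytic_f w hw).differentiableAt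
        (P.isOpen_D.mem_nhds hw)).continuousAt.tendsto.mono_left nhdsWithin_le_nhds
    have h2 : Tendsto P.f (𝓝[≠] w) (Bornology.cobounded ℂ) := by
      refine tendsto_cobounded_of_meromorphicOrderAt_neg ?_
      rw [hfo]
      exact_mod_cast (by omega : -(m : ℤ) < 0)
    exact h1.not_tendsto (Metric.disjoint_nhds_cobounded _) h2
  obtain ⟨h, hh, hh0, hfh⟩ := (meromorphicOrderAt_eq_int_iff hf).1 hfo
  obtain ⟨G, hG, hgG⟩ := exists_zpow_form hg hgo
  have hG2 : m = 2 → q = 2 → Tendsto (fun z => (z - w) ^ 2 * P.g z) (𝓝[≠] w) (𝓝 (-1 / 4)) →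
      G w = -1 / 4 := by
    intro _ hq hlim
    subst hq
    have h1 : Tendsto G (𝓝[≠] w) (𝓝 (G w)) :=
      hG.continuousAt.tendsto.mono_left nhdsWithin_le_nhds
    refine tendsto_nhds_unique h1 (hlim.congr' ?_)
    filter_upwards [hgG, self_mem_nhdsWithin] with z hz hz'
    have : z - w ≠ 0 := sub_ne_zero.2 hz'
    rw [hz]
    field_simp
  have hne : ∀ᶠ z in 𝓝 w, h z ≠ 0 := hh.continuousAt.eventually_ne hh0
  obtain ⟨ε, hε, hall⟩ := exists_ball (eventually_shift
    (hh.eventually_analyticAt.and (hG.eventually_analyticAt.and (hne.and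
      ((eventually_nhdsWithin_iff.1 hfh).and (eventually_nhdsWithin_iff.1 hgG))))))
  have hshift : ∀ v : ℂ, HasDerivAt (fun v : ℂ => v + w) 1 v := fun v =>
    (hasDerivAt_id v).add_const w
  have hfz : ∀ z, chart w z ≠ 0 → ‖chart w z‖ < ε →
      P.f z = h (chart w z + w) / chart w z ^ m * dchart w z ^ 2 := by
    intro z hz0 hz
    simp only [chart_coe, dchart_coe] at hz0 hz ⊢
    have h1 := (hall (z - w) (by simpa using hz)).2.2.2.1
    rw [sub_add_cancel] at h1 ⊢
    rw [h1 (sub_ne_zero.1 hz0), zpow_neg, zpow_natCast, smul_eq_mul]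
    field_simp
  have hgz : ∀ z, chart w z ≠ 0 → ‖chart w z‖ < ε →
      P.g z = G (chart w z + w) / chart w z ^ q * dchart w z ^ 2 := by
    intro z hz0 hz
    simp only [chart_coe, dchart_coe] at hz0 hz ⊢
    have h1 := (hall (z - w) (by simpa using hz)).2.2.2.2
    rw [sub_add_cancel] at h1 ⊢
    rw [h1 (sub_ne_zero.1 hz0)]
    ring
  obtain ⟨A, hA⟩ := TurningPointLG.exists_isEnd (h := fun v => h (v + w)) (G := fun v => G (v + w))
    hε
    (fun v hv => ((hall v hv).1.differentiableAt.comp v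
      (hshift v).differentiableAt).differentiableWithinAt)
    (fun v hv => (hall v hv).2.2.1)
    (fun v hv => ((hall v hv).2.1.differentiableAt.comp v
      (hshift v).differentiableAt).differentiableWithinAt) hfz hgz
    (hm.imp id fun ⟨h1, h2, h3⟩ => ⟨h1, h2, by simpa using hG2 h1 h2 h3⟩)
  exact ⟨ε, m, _, A, hA⟩

theorem AdmissibleInfinity.exists_isEnd {P : Problem} (h : P.AdmissibleInfinity) :
    ∃ ε m h A, IsEnd P OnePoint.infty ε m h A := by
  obtain ⟨m0, p, F, G, hF, hG, hF0, hf, hg, hcase⟩ := h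
  -- At v = 1/z, dz² = v^{-4} dv², so the exponents m0 and p turn into pole orders m0 + 4 and p + 4.
  -- The surplus k = q - (p + 4) is absorbed into G.
  obtain ⟨m, q, k, hm, hmm, hpq⟩ : ∃ m q k : ℕ,
      ((3 ≤ m ∧ q = (m + 1) / 2) ∨ (m = 2 ∧ q = 2 ∧ 0 ^ k * G 0 = -1 / 4)) ∧
      (m0 = m - 4) ∧ (p + k = q - 4) := by
    rcases hcase with ⟨h1, h2⟩ | ⟨h1, h2, h3⟩
    · obtain ⟨m, hm⟩ : ∃ m : ℕ, m0 + 4 = m := ⟨(m0 + 4).toNat, by omega⟩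
      have h3 : (2 * p : ℝ) < m0 - 2 := by linarith
      have h4 : 2 * p < m0 - 2 := by exact_mod_cast h3
      obtain ⟨k, hk⟩ : ∃ k : ℕ, (((m + 1) / 2 : ℕ) : ℤ) - 4 - p = k :=
        ⟨((((m + 1) / 2 : ℕ) : ℤ) - 4 - p).toNat, by omega⟩
      exact ⟨m, (m + 1) / 2, k, Or.inl ⟨by omega, rfl⟩, by omega, by omega⟩
    · exact ⟨2, 2, 0, Or.inr ⟨rfl, rfl, by simpa using h3⟩, by omega, by omega⟩
  have hne : ∀ᶠ z in 𝓝 (0 : ℂ), F z ≠ 0 := hF.continuousAt.eventually_ne hF0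
  have hfg : ∀ᶠ v in 𝓝[≠] (0 : ℂ), P.f v⁻¹ = v⁻¹ ^ m0 * F v ∧ P.g v⁻¹ = v⁻¹ ^ p * G v := by
    filter_upwards [tendsto_inv₀_nhdsNE_zero.eventually (hf.and hg)] with v hv
    rwa [inv_inv] at hv
  obtain ⟨ε, hε, hall⟩ := exists_ball
    (hF.eventually_analyticAt.and (hG.eventually_analyticAt.and (hne.and
      (eventually_nhdsWithin_iff.1 hfg))))
  have key : ∀ {z : ℂ}, chart OnePoint.infty z ≠ 0 → ‖chart OnePoint.infty z‖ < ε →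
      P.f z = z ^ m0 * F z⁻¹ ∧ P.g z = z ^ p * G z⁻¹ := by
    intro z hz0 hz
    have := (hall z⁻¹ (by simpa using hz)).2.2.2 hz0
    rwa [inv_inv] at this
  obtain ⟨A, hA⟩ := TurningPointLG.exists_isEnd (P := P) (a := OnePoint.infty) (m := m) (q := q)
    (h := F) (G := fun v => v ^ k * G v) hε
    (fun v hv => (hall v hv).1.differentiableAt.differentiableWithinAt)
    (fun v hv => (hall v hv).2.2.1)
    (fun v hv => ((differentiableAt_pow k).mul
      (hall v hv).2.1.differentiableAt).differentiableWithinAt)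
    (by
      intro z hz0 hz
      have hz1 : z ≠ 0 := by simpa using hz0
      rw [(key hz0 hz).1, hmm]
      simp only [chart_infty, dchart_infty]
      rw [zpow_sub₀ hz1, zpow_natCast, inv_pow]
      have e : (z ^ (4 : ℤ) : ℂ) = z ^ 4 := by norm_cast
      rw [e]
      field_simp)
    (by
      intro z hz0 hz
      have hz1 : z ≠ 0 := by simpa using hz0
      have hp : p = (q : ℤ) - 4 - k := by omega
      rw [(key hz0 hz).2, hp]
      simp only [chart_infty, dchart_infty]
      rw [zpow_sub₀ hz1, zpow_sub₀ hz1, zpow_natCast, zpow_natCast, inv_pow, inv_pow]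
      have e : (z ^ (4 : ℤ) : ℂ) = z ^ 4 := by norm_cast
      rw [e]
      field_simp)
    hm
  exact ⟨ε, m, _, A, hA⟩

/-- Points of `D` near `a` have small nonzero coordinate. -/
theorem eventually_chart {D : Set ℂ} {a : OnePoint ℂ} (ha : ∀ w : ℂ, a = w → w ∉ D) {ε : ℝ}
    (hε : 0 < ε) :
    ∀ᶠ p in 𝓝 a, ∀ z ∈ D, p = (z : OnePoint ℂ) → chart a z ≠ 0 ∧ ‖chart a z‖ < ε := by
  induction a using OnePoint.rec with
  | coe w =>
    rw [OnePoint.nhds_coe_eq, eventually_map]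
    filter_upwards [Metric.ball_mem_nhds w hε] with y hy z hz hyz
    obtain rfl : y = z := OnePoint.coe_injective hyz
    refine ⟨sub_ne_zero.2 ?_, by simpa [dist_eq_norm] using hy⟩
    rintro rfl
    exact ha y rfl hz
  | infty =>
    rw [OnePoint.nhds_infty_eq, eventually_sup]
    refine ⟨?_, by simp⟩
    rw [eventually_map, Filter.coclosedCompact_eq_cocompact, ← Metric.cobounded_eq_cocompact]
    have h1 := tendsto_norm_cobounded_atTop (E := ℂ)
    filter_upwards [h1.eventually_gt_atTop (1 / ε), h1.eventually_gt_atTop 0] with y hy hy0 z hz hyz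
    obtain rfl : y = z := OnePoint.coe_injective hyz
    refine ⟨inv_ne_zero (norm_pos_iff.1 hy0), ?_⟩
    rw [chart_infty, norm_inv]
    exact inv_lt_of_inv_lt₀ hε (by simpa using hy)

theorem Admissible.exists_isEnd {P : Problem} {a : OnePoint ℂ} (h : P.Admissible a) :
    (∀ w : ℂ, a = w → w ∉ P.D) ∧ ∃ ε m h A, IsEnd P a ε m h A := by
  rcases h with ⟨w, rfl, hw⟩ | ⟨rfl, h⟩
  · obtain ⟨h1, h2⟩ := AdmissiblePole.exists_isEnd hw
    exact ⟨fun w' hw' => by rwa [← OnePoint.coe_injective hw'], h2⟩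
  · exact ⟨fun w hw => absurd hw (OnePoint.infty_ne_coe w), AdmissibleInfinity.exists_isEnd h⟩

end TurningPointLG

namespace TurningPointLG

/-! ### The coefficients near the reference points -/

section Coefficients

variable {P : Problem} {θ : ℝ} {j : SignType} {a : OnePoint ℂ} {ε : ℝ} {m : ℕ} {h A : ℂ → ℂ}

/-- The part of `D` off the cut of the `j`-th branch. -/
def slitD (P : Problem) (θ : ℝ) (j : SignType) : Set ℂ :=
  {z | z ∈ P.D ∧ rot θ j (P.ζ z) ∈ Complex.slitPlane}

theorem isOpen_slitD (P : Problem) (θ : ℝ) (j : SignType) : IsOpen (slitD P θ j) :=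
  P.analytic_ζ.continuousOn.isOpen_inter_preimage P.isOpen_D (isOpen_slit θ j)

theorem Problem.hasDerivAt_ζ (P : Problem) {z : ℂ} (hz : z ∈ P.D) :
    HasDerivAt P.ζ (deriv P.ζ z) z :=
  ((P.analytic_ζ z hz).differentiableAt (P.isOpen_D.mem_nhds hz)).hasDerivAt

theorem Problem.differentiableAt_deriv_ζ (P : Problem) {z : ℂ} (hz : z ∈ P.D) :
    DifferentiableAt ℂ (deriv P.ζ) z :=
  (P.analytic_ζ.deriv P.isOpen_D z hz).differentiableAt (P.isOpen_D.mem_nhds hz)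

theorem sqrtf_sq {z : ℂ} (hz : z ∈ slitD P θ j) : P.sqrtf θ j z ^ 2 = P.f z := by
  have h0 := ne_zero_of_rot hz.2
  have h1 : powBr θ j (1 / 2) (P.ζ z) * powBr θ j (1 / 2) (P.ζ z) = P.ζ z := by
    rw [powBr_mul _ _ h0]
    have := powBr_natCast (θ := θ) (j := j) 1 h0
    norm_num at this ⊢
    exact this
  unfold Problem.sqrtf
  rw [← P.ζ_eq z hz.1]
  linear_combination deriv P.ζ z ^ 2 * h1

theorem differentiableAt_sqrtf {z : ℂ} (hz : z ∈ slitD P θ j) :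
    DifferentiableAt ℂ (P.sqrtf θ j) z :=
  (((hasDerivAt_powBr (1 / 2) hz.2).comp z (P.hasDerivAt_ζ hz.1)).differentiableAt).mul
    (P.differentiableAt_deriv_ζ hz.1)

/-- The part of `slitD` where the coordinate at `a` is smaller than `ε`. -/
def nearEnd (P : Problem) (θ : ℝ) (j : SignType) (a : OnePoint ℂ) (ε : ℝ) : Set ℂ :=
  slitD P θ j ∩ {z | chart a z ≠ 0 ∧ ‖chart a z‖ < ε}

theorem isOpen_nearEnd (P : Problem) (θ : ℝ) (j : SignType) (a : OnePoint ℂ) (ε : ℝ) :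
    IsOpen (nearEnd P θ j a ε) :=
  (isOpen_slitD P θ j).inter (isOpen_chart a ε)

/-- `f^{1/2} dz / dv`. -/
noncomputable def localSqrt (P : Problem) (θ : ℝ) (j : SignType) (a : OnePoint ℂ) (z : ℂ) : ℂ :=
  P.sqrtf θ j z / dchart a z

theorem differentiableAt_dchart {z : ℂ} (hz : chart a z ≠ 0) :
    DifferentiableAt ℂ (dchart a) z := by
  induction a using OnePoint.rec with
  | infty =>
    have hz : z ≠ 0 := by simpa using hz
    have : DifferentiableAt ℂ (fun z : ℂ => -(z ^ 2)⁻¹) z :=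
      ((differentiableAt_id.pow 2).inv (pow_ne_zero 2 hz)).neg
    exact this
  | coe w => exact differentiableAt_const 1

theorem mem_ball_of_nearEnd {z : ℂ} (hz : z ∈ nearEnd P θ j a ε) :
    chart a z ∈ Metric.ball (0 : ℂ) ε := by
  simpa using hz.2.2

theorem IsEnd.localSqrt_sq (hE : IsEnd P a ε m h A) {z : ℂ} (hz : z ∈ nearEnd P θ j a ε) :
    localSqrt P θ j a z ^ 2 = h (chart a z) / chart a z ^ m := by
  unfold localSqrt
  have h1 := dchart_ne_zero hz.2.1
  rw [div_pow, sqrtf_sq hz.1, hE.f_eq z hz.2.1 hz.2.2]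
  field_simp

theorem IsEnd.localSqrt_ne_zero (hE : IsEnd P a ε m h A) {z : ℂ} (hz : z ∈ nearEnd P θ j a ε) :
    localSqrt P θ j a z ≠ 0 := by
  intro h0
  have h1 := hE.localSqrt_sq hz
  rw [h0] at h1
  have h2 := div_ne_zero (hE.h_ne _ (mem_ball_of_nearEnd hz)) (pow_ne_zero m hz.2.1)
  rw [← h1] at h2
  simp at h2

theorem hasDerivAt_of_ball {g : ℂ → ℂ} (hg : DifferentiableOn ℂ g (Metric.ball 0 ε)) {z : ℂ}
    (hz : z ∈ nearEnd P θ j a ε) :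
    HasDerivAt (fun y => g (chart a y)) (deriv g (chart a z) * dchart a z) z :=
  ((hg _ (mem_ball_of_nearEnd hz)).differentiableAt
    (Metric.isOpen_ball.mem_nhds (mem_ball_of_nearEnd hz))).hasDerivAt.comp z (hasDerivAt_chart hz.2.1)

theorem IsEnd.hasDerivAt_localSqrt (hE : IsEnd P a ε m h A) {z : ℂ} (hz : z ∈ nearEnd P θ j a ε) :
    HasDerivAt (localSqrt P θ j a)
      (localSqrt P θ j a z * (dchart a z * eulerLog m h (chart a z) / (2 * chart a z))) z := by
  have hd : DifferentiableAt ℂ (localSqrt P θ j a) z :=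
    (differentiableAt_sqrtf hz.1).div (differentiableAt_dchart hz.2.1) (dchart_ne_zero hz.2.1)
  have e1 := hd.hasDerivAt.pow 2
  have e2 : HasDerivAt (fun y => h (chart a y) / chart a y ^ m) _ z :=
    (hasDerivAt_of_ball hE.diff_h hz).div ((hasDerivAt_chart hz.2.1).pow m)
      (pow_ne_zero m hz.2.1)
  have e3 : (localSqrt P θ j a ^ 2) =ᶠ[𝓝 z] fun y => h (chart a y) / chart a y ^ m := by
    filter_upwards [(isOpen_nearEnd P θ j a ε).mem_nhds hz] with y hy using hE.localSqrt_sq hy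
  have e4 := e1.unique (e2.congr_of_eventuallyEq e3)
  have hq := hE.localSqrt_ne_zero hz
  refine hd.hasDerivAt.congr_deriv ?_
  have hsq := hE.localSqrt_sq hz
  have hv := hz.2.1
  have hh := hE.h_ne _ (mem_ball_of_nearEnd hz)
  have hpow : (m : ℂ) * chart a z ^ (m - 1) = m * chart a z ^ m / chart a z := by
    obtain ⟨n, hn⟩ := Nat.exists_eq_add_of_le hE.two_le
    rw [hn, show 2 + n - 1 = n + 1 by omega, show 2 + n = n + 1 + 1 by omega, pow_succ _ (n + 1)]
    field_simp
  have hV := pow_ne_zero m hv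
  rw [hpow] at e4
  unfold eulerLog
  norm_num at e4
  have key : 2 * localSqrt P θ j a z * deriv (localSqrt P θ j a) z =
      2 * localSqrt P θ j a z * (localSqrt P θ j a z *
        (dchart a z * (-m + chart a z * deriv h (chart a z) / h (chart a z)) /
          (2 * chart a z))) := by
    rw [e4]
    have : ∀ x, 2 * localSqrt P θ j a z * (localSqrt P θ j a z * x) =
        2 * localSqrt P θ j a z ^ 2 * x := fun x => by ring
    rw [this, hsq]
    generalize chart a z ^ m = V at *
    field_simp
    ring
  exact mul_left_cancel₀ (mul_ne_zero two_ne_zero hq) key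

/-- The coefficients `F̂_s` in the local coordinate. -/
theorem IsEnd.exists_Fhat_eq (hE : IsEnd P a ε m h A) (s : ℕ) (hs : 1 ≤ s) :
    ∃ B : ℂ → ℂ, DifferentiableOn ℂ B (Metric.ball 0 ε) ∧
      ∀ z ∈ nearEnd P θ j a ε, P.Fhat θ j s z =
        if Odd s then chart a z ^ (m / 2) * B (chart a z)
        else localSqrt P θ j a z * chart a z ^ m * B (chart a z) := by
  have hm := hE.two_le
  induction s using Nat.strong_induction_on with
  | _ s ih =>
  obtain _ | _ | s := s
  · omega
  · refine ⟨fun v => A v / 2, hE.diff_A.div_const 2, fun z hz => ?_⟩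
    simp only [zero_add, odd_one, if_true]
    rw [Problem.Fhat]
    show P.Phi z / 2 = _
    rw [hE.Phi_eq z hz.2.1 hz.2.2]
    ring
  choose! B hB hF using ih
  have hsum : ∀ z, P.Fhat θ j (s + 2) z =
      -(1 / 2) * (P.sqrtf θ j z)⁻¹ * deriv (P.Fhat θ j (s + 1)) z
        - (1 / 2) * ∑ i : Fin s, P.Fhat θ j ((i : ℕ) + 1) z * P.Fhat θ j (s - (i : ℕ)) z := by
    intro z
    rw [Problem.Fhat]
  have hB1 := hB (s + 1) (by omega) (by omega)
  have hD1 : DifferentiableOn ℂ (deriv (B (s + 1))) (Metric.ball 0 ε) :=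
    hB1.deriv Metric.isOpen_ball
  have hL := differentiableOn_eulerLog (m := m) hE.diff_h hE.h_ne
  have hBi : ∀ i : Fin s, DifferentiableOn ℂ (B ((i : ℕ) + 1)) (Metric.ball 0 ε) := fun i =>
    hB _ (by omega) (by omega)
  have hBi' : ∀ i : Fin s, DifferentiableOn ℂ (B (s - (i : ℕ))) (Metric.ball 0 ε) := fun i =>
    hB _ (by omega) (by omega)
  have hsq : ∀ z, P.sqrtf θ j z = localSqrt P θ j a z * dchart a z ∨ chart a z = 0 := by
    intro z
    by_cases hz : chart a z = 0
    · exact Or.inr hz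
    · left
      unfold localSqrt
      rw [div_mul_cancel₀ _ (dchart_ne_zero hz)]
  rcases Nat.even_or_odd s with hev | hodd
  -- Even target: the derivative of an odd coefficient is divided by f^{1/2}, and each product pairs
  -- an odd with an even index, so exactly one factor `localSqrt` appears.
  · have ho1 : Odd (s + 1) := hev.add_one
    have ho2 : ¬ Odd (s + 2) := by
      rw [Nat.not_odd_iff_even]; exact hev.add even_two
    refine ⟨fun v => -(1 / 2) * (v ^ (m / 2 - 1) *
        (((m / 2 : ℕ) : ℂ) * B (s + 1) v + v * deriv (B (s + 1)) v) / h v) -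
        (1 / 2) * ∑ i : Fin s, v ^ (m / 2) * (B ((i : ℕ) + 1) v * B (s - (i : ℕ)) v), ?_, ?_⟩
    · refine DifferentiableOn.sub (DifferentiableOn.const_mul ?_ _)
        (DifferentiableOn.const_mul (DifferentiableOn.fun_sum fun i _ => ?_) _)
      · exact ((differentiableOn_pow _).mul ((hB1.const_mul _).add
          (differentiableOn_id.mul hD1))).div hE.diff_h hE.h_ne
      · exact (differentiableOn_pow _).mul ((hBi i).mul (hBi' i))
    · intro z hz
      rw [if_neg ho2, hsum]
      have hv := hz.2.1
      have hq := hE.localSqrt_ne_zero hz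
      have hdv := dchart_ne_zero hv
      have hh := hE.h_ne _ (mem_ball_of_nearEnd hz)
      have e1 : P.Fhat θ j (s + 1) =ᶠ[𝓝 z]
          fun y => chart a y ^ (m / 2) * B (s + 1) (chart a y) := by
        filter_upwards [(isOpen_nearEnd P θ j a ε).mem_nhds hz] with y hy
        rw [hF (s + 1) (by omega) (by omega) y hy, if_pos ho1]
      have e2 : HasDerivAt (fun y => chart a y ^ (m / 2) * B (s + 1) (chart a y)) _ z :=
        ((hasDerivAt_chart hv).pow (m / 2)).mul (hasDerivAt_of_ball hB1 hz)
      have e3 : ∀ i : Fin s, P.Fhat θ j ((i : ℕ) + 1) z * P.Fhat θ j (s - (i : ℕ)) z =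
          localSqrt P θ j a z * chart a z ^ m * (chart a z ^ (m / 2) *
            (B ((i : ℕ) + 1) (chart a z) * B (s - (i : ℕ)) (chart a z))) := by
        intro i
        rw [hF _ (by omega) (by omega) z hz, hF _ (by omega) (by omega) z hz]
        rcases Nat.even_or_odd (i : ℕ) with hi | hi
        · have o1 : Odd ((i : ℕ) + 1) := hi.add_one
          have o2 : ¬ Odd (s - (i : ℕ)) := by
            rw [Nat.not_odd_iff_even]; exact hev.tsub hi
          rw [if_pos o1, if_neg o2]
          ring
        · have o1 : ¬ Odd ((i : ℕ) + 1) := by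
            rw [Nat.not_odd_iff_even]; exact hi.add_one
          have o2 : Odd (s - (i : ℕ)) := Nat.Even.sub_odd i.2.le hev hi
          rw [if_neg o1, if_pos o2]
          ring
      rw [e1.deriv_eq, e2.deriv, Finset.sum_congr rfl fun i _ => e3 i, ← Finset.mul_sum,
        (hsq z).resolve_right hv]
      have hk : chart a z ^ (m / 2) = chart a z ^ (m / 2 - 1) * chart a z := by
        rw [← pow_succ]; congr 1; omega
      have hlsq := hE.localSqrt_sq hz
      have hV := pow_ne_zero m hv
      have h6 : h (chart a z) = localSqrt P θ j a z ^ 2 * chart a z ^ m := by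
        rw [hlsq]; field_simp
      have h5 : ((chart a ^ (m / 2)) z) = chart a z ^ (m / 2) := rfl
      rw [h5]
      simp only []
      rw [h6]
      rw [hk]
      generalize chart a z ^ m = V at *
      generalize chart a z ^ (m / 2 - 1) = K at *
      field_simp
  -- Odd target: f^{-1/2} cancels the square root in the differentiated even coefficient. Products
  -- pair equal parities, and two even factors give (f^{1/2} dz/dv)² v^{2m} = v^m h.
  · have ho1 : ¬ Odd (s + 1) := by
      rw [Nat.not_odd_iff_even]; exact hodd.add_one
    have ho2 : Odd (s + 2) := by
      exact hodd.add_even even_two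
    refine ⟨fun v => -(1 / 2) * (v ^ (m - 1 - m / 2) *
        (eulerLog m h v / 2 * B (s + 1) v + m * B (s + 1) v + v * deriv (B (s + 1)) v)) -
        (1 / 2) * ∑ i : Fin s, (if Odd ((i : ℕ) + 1) then v ^ (m / 2) else
          h v * v ^ (m - m / 2)) * (B ((i : ℕ) + 1) v * B (s - (i : ℕ)) v), ?_, ?_⟩
    · refine DifferentiableOn.sub (DifferentiableOn.const_mul ?_ _)
        (DifferentiableOn.const_mul (DifferentiableOn.fun_sum fun i _ => ?_) _)
      · exact (differentiableOn_pow _).mul ((((hL.div_const 2).mul hB1).add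
          (hB1.const_mul _)).add (differentiableOn_id.mul hD1))
      · refine DifferentiableOn.mul ?_ ((hBi i).mul (hBi' i))
        split_ifs
        · exact differentiableOn_pow _
        · exact hE.diff_h.mul (differentiableOn_pow _)
    · intro z hz
      rw [if_pos ho2, hsum]
      have hv := hz.2.1
      have hq := hE.localSqrt_ne_zero hz
      have hdv := dchart_ne_zero hv
      have hh := hE.h_ne _ (mem_ball_of_nearEnd hz)
      have e1 : P.Fhat θ j (s + 1) =ᶠ[𝓝 z]
          fun y => localSqrt P θ j a y * chart a y ^ m * B (s + 1) (chart a y) := by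
        filter_upwards [(isOpen_nearEnd P θ j a ε).mem_nhds hz] with y hy
        rw [hF (s + 1) (by omega) (by omega) y hy, if_neg ho1]
      have e2 : HasDerivAt (fun y => localSqrt P θ j a y * chart a y ^ m *
          B (s + 1) (chart a y)) _ z :=
        ((hE.hasDerivAt_localSqrt hz).mul ((hasDerivAt_chart hv).pow m)).mul
          (hasDerivAt_of_ball hB1 hz)
      have hlsq := hE.localSqrt_sq hz
      have hV := pow_ne_zero m hv
      have h6 : h (chart a z) = localSqrt P θ j a z ^ 2 * chart a z ^ m := by
        rw [hlsq]; field_simp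
      have e3 : ∀ i : Fin s, P.Fhat θ j ((i : ℕ) + 1) z * P.Fhat θ j (s - (i : ℕ)) z =
          chart a z ^ (m / 2) * ((if Odd ((i : ℕ) + 1) then chart a z ^ (m / 2) else
          h (chart a z) * chart a z ^ (m - m / 2)) *
            (B ((i : ℕ) + 1) (chart a z) * B (s - (i : ℕ)) (chart a z))) := by
        intro i
        rw [hF _ (by omega) (by omega) z hz, hF _ (by omega) (by omega) z hz]
        rcases Nat.even_or_odd (i : ℕ) with hi | hi
        · have o1 : Odd ((i : ℕ) + 1) := hi.add_one
          have o2 : Odd (s - (i : ℕ)) := Nat.Odd.sub_even i.2.le hodd hi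
          rw [if_pos o1, if_pos o2, if_pos o1]
          ring
        · have o1 : ¬ Odd ((i : ℕ) + 1) := by
            rw [Nat.not_odd_iff_even]; exact hi.add_one
          have o2 : ¬ Odd (s - (i : ℕ)) := by
            rw [Nat.not_odd_iff_even]; exact Nat.Odd.sub_odd hodd hi
          rw [if_neg o1, if_neg o2, if_neg o1, h6]
          have hk : chart a z ^ m = chart a z ^ (m / 2) * chart a z ^ (m - m / 2) := by
            rw [← pow_add]; congr 1; omega
          linear_combination (localSqrt P θ j a z ^ 2 * chart a z ^ m *
            B ((i : ℕ) + 1) (chart a z) * B (s - (i : ℕ)) (chart a z)) * hk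
      rw [e1.deriv_eq, e2.deriv, Finset.sum_congr rfl fun i _ => e3 i, ← Finset.mul_sum,
        (hsq z).resolve_right hv]
      have hk : chart a z ^ m = chart a z ^ (m / 2) * chart a z ^ (m - 1 - m / 2) * chart a z := by
        rw [← pow_add, ← pow_succ]; congr 1; omega
      have hk1 : chart a z ^ (m - 1) = chart a z ^ (m / 2) * chart a z ^ (m - 1 - m / 2) := by
        rw [← pow_add]; congr 1; omega
      have h5 : ((chart a ^ m) z) = chart a z ^ m := rfl
      have h7 : (localSqrt P θ j a * chart a ^ m) z = localSqrt P θ j a z * chart a z ^ m := rfl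
      rw [h7, h5, hk1, hk]
      simp only []
      generalize chart a z ^ (m / 2) = K at *
      generalize chart a z ^ (m - 1 - m / 2) = K' at *
      field_simp

end Coefficients

end TurningPointLG

namespace TurningPointLG

/-! ### Limits of the coefficients at the reference points -/

/-- T is locally constant on U, so a level set and its complement in U are open and cannot split C.
C need not be open: the connected piece in `OneEnded` is only known to be preconnected. -/
theorem exists_eqOn_const_of_deriv_zero {U C : Set ℂ} {T : ℂ → ℂ} (hU : IsOpen U)
    (hC : IsPreconnected C) (hCU : C ⊆ U) (hT : ∀ z ∈ U, HasDerivAt T 0 z) :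
    ∃ c, ∀ z ∈ C, T z = c := by
  rcases C.eq_empty_or_nonempty with rfl | ⟨x, hx⟩
  · exact ⟨0, by simp⟩
  refine ⟨T x, fun y hy => ?_⟩
  by_contra hne
  have hd : DifferentiableOn ℂ T U := fun z hz => (hT z hz).differentiableAt.differentiableWithinAt
  have hd' : U.EqOn (deriv T) 0 := fun z hz => (hT z hz).deriv
  obtain ⟨z, -, hz1, hz2⟩ := hC _ _ (hU.isOpen_inter_preimage_of_deriv_eq_zero hd hd' {T x})
    (hU.isOpen_inter_preimage_of_deriv_eq_zero hd hd' {T x}ᶜ)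
    (fun z hz => by
      by_cases h : T z = T x
      · exact Or.inl ⟨hCU hz, h⟩
      · exact Or.inr ⟨hCU hz, h⟩) ⟨x, hx, hCU hx, rfl⟩ ⟨y, hy, hCU hy, hne⟩
  exact hz2.2 hz1.2

theorem exists_sqrt_near_zero {h : ℂ → ℂ} {ε : ℝ} (hε : 0 < ε)
    (hh : DifferentiableOn ℂ h (Metric.ball 0 ε)) (h0 : h 0 ≠ 0) :
    ∃ δ, 0 < δ ∧ δ ≤ ε ∧ ∃ k : ℂ → ℂ, DifferentiableOn ℂ k (Metric.ball 0 δ) ∧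
      ∀ v ∈ Metric.ball (0 : ℂ) δ, k v ^ 2 = h v := by
  have hb : (0 : ℂ) ∈ Metric.ball (0 : ℂ) ε := by simpa using hε
  have hc : ContinuousAt (fun v => h v / h 0) 0 :=
    (hh.continuousOn.continuousAt (Metric.isOpen_ball.mem_nhds hb)).div_const _
  have h1 : ∀ᶠ v in 𝓝 (0 : ℂ), h v / h 0 ∈ Complex.slitPlane := by
    refine hc.eventually_mem (Complex.isOpen_slitPlane.mem_nhds ?_)
    rw [div_self h0]
    exact Complex.one_mem_slitPlane
  obtain ⟨δ, hδ, hs⟩ := exists_ball h1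
  obtain ⟨c, hc2⟩ := IsAlgClosed.exists_pow_nat_eq (h 0) two_pos
  refine ⟨min δ ε, lt_min hδ hε, min_le_right _ _,
    fun v => c * Complex.exp (1 / 2 * Complex.log (h v / h 0)), ?_, ?_⟩
  · have hh' := hh.mono (Metric.ball_subset_ball (x := (0 : ℂ)) (min_le_right δ ε))
    refine DifferentiableOn.const_mul (DifferentiableOn.cexp (DifferentiableOn.const_mul ?_ _)) _
    exact (hh'.div_const _).clog fun v hv => hs v (Metric.ball_subset_ball (min_le_left _ _) hv)
  · intro v hv
    have h2 := hs v (Metric.ball_subset_ball (min_le_left _ _) hv)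
    rw [mul_pow, hc2, ← Complex.exp_nat_mul]
    have : ((2 : ℕ) : ℂ) * (1 / 2 * Complex.log (h v / h 0)) = Complex.log (h v / h 0) := by
      push_cast; ring
    rw [this, Complex.exp_log (Complex.slitPlane_ne_zero h2)]
    field_simp

section Limits

variable {P : Problem} {θ : ℝ} {j : SignType} {a : OnePoint ℂ} {ε : ℝ} {m : ℕ} {h A : ℂ → ℂ}

/-- The approach to `a` in the region `T_j`. -/
noncomputable def sectorEnd (P : Problem) (θ : ℝ) (j : SignType) (a : OnePoint ℂ) : Filter ℂ :=
  comap (fun z : ℂ => (z : OnePoint ℂ)) (𝓝 a) ⊓ 𝓟 {z | z ∈ P.D ∧ P.ζ z ∈ sectorT θ j}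

theorem IsEnd.mem_nearEnd (hE : IsEnd P a ε m h A) {z : ℂ} (hz : z ∈ P.D)
    (h1 : chart a z ≠ 0) (h2 : ‖chart a z‖ < ε) (hs : P.ζ z ∈ sectorT θ j) :
    z ∈ nearEnd P θ j a ε := by
  refine ⟨⟨hz, rot_slit_of_mem_sectorT ?_ hs⟩, h1, h2⟩
  intro h0
  have h3 := P.ζ_eq z hz
  rw [h0, zero_mul, hE.f_eq z h1 h2] at h3
  have hb : chart a z ∈ Metric.ball (0 : ℂ) ε := by simpa using h2
  exact mul_ne_zero (div_ne_zero (hE.h_ne _ hb) (pow_ne_zero m h1))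
    (pow_ne_zero 2 (dchart_ne_zero h1)) h3.symm

theorem eventually_nearEnd (hE : IsEnd P a ε m h A) (ha : ∀ w : ℂ, a = w → w ∉ P.D) {δ : ℝ}
    (hδ : 0 < δ) :
    ∀ᶠ z in sectorEnd P θ j a, z ∈ nearEnd P θ j a ε ∧ ‖chart a z‖ < δ := by
  have h1 : ∀ᶠ z : ℂ in comap (fun z : ℂ => (z : OnePoint ℂ)) (𝓝 a), ∀ y ∈ P.D,
      (z : OnePoint ℂ) = y → chart a y ≠ 0 ∧ ‖chart a y‖ < min δ ε :=
    tendsto_comap.eventually (eventually_chart ha (lt_min hδ hE.pos))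
  refine (eventually_inf_principal).2 (h1.mono fun z hz hzD => ?_)
  obtain ⟨h2, h3⟩ := hz z hzD.1 rfl
  exact ⟨hE.mem_nearEnd hzD.1 h2 (h3.trans_le (min_le_right _ _)) hzD.2,
    h3.trans_le (min_le_left _ _)⟩

theorem tendsto_chart_sectorEnd (hE : IsEnd P a ε m h A) (ha : ∀ w : ℂ, a = w → w ∉ P.D) :
    Tendsto (chart a) (sectorEnd P θ j a) (𝓝 0) := by
  rw [Metric.tendsto_nhds]
  intro δ hδ
  filter_upwards [eventually_nearEnd hE ha hδ] with z hz
  simpa using hz.2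

/-- A primitive near `a`, tending to zero at `a`. -/
theorem exists_primitive (hE : IsEnd P a ε m h A) {B : ℂ → ℂ}
    (hB : DifferentiableOn ℂ B (Metric.ball 0 ε)) :
    ∃ δ, 0 < δ ∧ δ ≤ ε ∧ ∃ H : ℂ → ℂ,
      (∀ z ∈ nearEnd P θ j a δ,
        HasDerivAt H (chart a z ^ (m / 2) * B (chart a z) * P.sqrtf θ j z) z) ∧
      ∀ η, 0 < η → ∃ δ', 0 < δ' ∧ ∀ z ∈ nearEnd P θ j a δ, ‖chart a z‖ < δ' → ‖H z‖ < η := by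
  obtain ⟨δ, hδ, hδε, k, hk, hk2⟩ := exists_sqrt_near_zero hE.pos hE.diff_h
    (hE.h_ne 0 (by simpa using hE.pos))
  have hBδ := hB.mono (Metric.ball_subset_ball (x := (0 : ℂ)) hδε)
  have hsub : ∀ {z}, z ∈ nearEnd P θ j a δ → z ∈ nearEnd P θ j a ε := fun hz =>
    ⟨hz.1, hz.2.1, hz.2.2.trans_le hδε⟩
  have hkne : ∀ {z}, z ∈ nearEnd P θ j a δ → k (chart a z) ≠ 0 := by
    intro z hz h0
    have := hk2 _ (mem_ball_of_nearEnd hz)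
    rw [h0] at this
    exact hE.h_ne _ (mem_ball_of_nearEnd (hsub hz)) (by rw [← this]; simp)
  -- With c = ⌈m/2⌉ and k² = h, Ψ is a square root of 1 (m even) or of v (m odd): it isolates the
  -- branch ambiguity of f^{1/2}.
  set c := m - m / 2 with hc
  set Ψ : ℂ → ℂ := fun z => localSqrt P θ j a z * chart a z ^ c / k (chart a z) with hΨ
  have hd : ∀ {z}, z ∈ nearEnd P θ j a δ → DifferentiableAt ℂ Ψ z := by
    intro z hz
    refine ((hE.hasDerivAt_localSqrt (hsub hz)).differentiableAt.mul
      ((hasDerivAt_chart hz.2.1).differentiableAt.pow c)).div ?_ (hkne hz)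
    exact ((hk _ (mem_ball_of_nearEnd hz)).differentiableAt
      (Metric.isOpen_ball.mem_nhds (mem_ball_of_nearEnd hz))).comp z
        (hasDerivAt_chart hz.2.1).differentiableAt
  have hsq : ∀ {z}, z ∈ nearEnd P θ j a δ → Ψ z ^ 2 = chart a z ^ (2 * c - m) := by
    intro z hz
    have e : chart a z ^ (2 * c) = chart a z ^ (2 * c - m) * chart a z ^ m := by
      rw [← pow_add]; congr 1; omega
    have h1 := hE.h_ne _ (mem_ball_of_nearEnd (hsub hz))
    have h2 := pow_ne_zero m hz.2.1
    rw [hΨ]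
    dsimp only
    rw [div_pow, mul_pow, hE.localSqrt_sq (hsub hz), hk2 _ (mem_ball_of_nearEnd hz), ← pow_mul,
      mul_comm c, e]
    field_simp
  have hint : ∀ {z}, z ∈ nearEnd P θ j a δ →
      chart a z ^ (m / 2) * B (chart a z) * P.sqrtf θ j z =
      chart a z ^ (m / 2) / chart a z ^ c * (B (chart a z) * k (chart a z)) * Ψ z * dchart a z := by
    intro z hz
    have h1 := dchart_ne_zero hz.2.1
    have h2 := hkne hz
    have h3 := pow_ne_zero c hz.2.1
    rw [hΨ]
    unfold localSqrt
    field_simp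
  clear_value Ψ c
  have hBk : DifferentiableOn ℂ (fun v => B v * k v) (Metric.ball 0 δ) := hBδ.mul hk
  rcases Nat.even_or_odd m with hev | hodd
  · have hcm : c = m / 2 := by obtain ⟨l, hl⟩ := hev; omega
    have hsq1 : ∀ {z}, z ∈ nearEnd P θ j a δ → Ψ z ^ 2 = 1 := by
      intro z hz
      rw [hsq hz, show 2 * c - m = 0 by obtain ⟨l, hl⟩ := hev; omega, pow_zero]
    obtain ⟨K, hK0, hK⟩ := hBk.isExactOn_ball.with_val_at 0 0
    refine ⟨δ, hδ, hδε, fun z => Ψ z * K (chart a z), ?_, ?_⟩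
    · intro z hz
      have h1 : deriv Ψ z = 0 := by
        have e1 : HasDerivAt (Ψ ^ 2) (2 * Ψ z * deriv Ψ z) z := by
          simpa using (hd hz).hasDerivAt.pow 2
        have e2 : (Ψ ^ 2) =ᶠ[𝓝 z] fun _ => 1 := by
          filter_upwards [(isOpen_nearEnd P θ j a δ).mem_nhds hz] with y hy using hsq1 hy
        have e3 := e1.unique ((hasDerivAt_const z 1).congr_of_eventuallyEq e2)
        have h4 : Ψ z ≠ 0 := by
          intro h0; have := hsq1 hz; rw [h0] at this; simp at this
        simpa [h4] using e3
      have e4 := (hd hz).hasDerivAt.mul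
        ((hK _ (mem_ball_of_nearEnd hz)).comp z (hasDerivAt_chart hz.2.1))
      refine e4.congr_deriv ?_
      rw [hint hz, h1, hcm, div_self (pow_ne_zero _ hz.2.1)]
      ring
    · intro η hη
      have hKc : ContinuousAt K 0 := (hK 0 (by simpa using hδ)).continuousAt
      rw [Metric.continuousAt_iff] at hKc
      obtain ⟨δ', hδ', hKδ⟩ := hKc η hη
      refine ⟨δ', hδ', fun z hz hz' => ?_⟩
      have h1 : ‖Ψ z‖ = 1 := by
        have := congrArg norm (hsq1 hz)
        rw [norm_pow, norm_one] at this
        exact (pow_eq_one_iff_of_nonneg (norm_nonneg _) two_ne_zero).1 this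
      have h2 := hKδ (x := chart a z) (by simpa using hz')
      rw [hK0] at h2
      rw [norm_mul, h1, one_mul]
      simpa using h2
  -- For odd m the integrand is v^{-1/2} times an analytic function. In the variable x = Ψ, where v
  -- = x² and dv = 2x dx, the singularity disappears.
  · have hcm : c = m / 2 + 1 := by obtain ⟨l, hl⟩ := hodd; omega
    have hsq1 : ∀ {z}, z ∈ nearEnd P θ j a δ → Ψ z ^ 2 = chart a z := by
      intro z hz
      rw [hsq hz, show 2 * c - m = 1 by obtain ⟨l, hl⟩ := hodd; omega, pow_one]
    have hmaps : ∀ x ∈ Metric.ball (0 : ℂ) (Real.sqrt δ), x ^ 2 ∈ Metric.ball (0 : ℂ) δ := by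
      intro x hx
      have hx' : ‖x‖ < Real.sqrt δ := by simpa using hx
      have : ‖x‖ ^ 2 < δ := (Real.lt_sqrt (norm_nonneg _)).1 hx'
      simpa using this
    have hg : DifferentiableOn ℂ (fun x => 2 * (B (x ^ 2) * k (x ^ 2)))
        (Metric.ball 0 (Real.sqrt δ)) :=
      (hBk.comp (differentiableOn_pow 2) hmaps).const_mul 2
    obtain ⟨K, hK0, hK⟩ := hg.isExactOn_ball.with_val_at 0 0
    have hΨn : ∀ {z}, z ∈ nearEnd P θ j a δ → ‖Ψ z‖ ^ 2 = ‖chart a z‖ := by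
      intro z hz
      rw [← norm_pow, hsq1 hz]
    refine ⟨δ, hδ, hδε, fun z => K (Ψ z), ?_, ?_⟩
    · intro z hz
      have hne : Ψ z ≠ 0 := by
        intro h0; have := hsq1 hz; rw [h0] at this; exact hz.2.1 (by rw [← this]; simp)
      have e1 : HasDerivAt (Ψ ^ 2) (2 * Ψ z * deriv Ψ z) z := by
        simpa using (hd hz).hasDerivAt.pow 2
      have e2 : (Ψ ^ 2) =ᶠ[𝓝 z] chart a := by
        filter_upwards [(isOpen_nearEnd P θ j a δ).mem_nhds hz] with y hy using hsq1 hy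
      have e3 := e1.unique ((hasDerivAt_chart hz.2.1).congr_of_eventuallyEq e2)
      have hmem : Ψ z ∈ Metric.ball (0 : ℂ) (Real.sqrt δ) := by
        rw [mem_ball_zero_iff, Real.lt_sqrt (norm_nonneg _), hΨn hz]
        exact hz.2.2
      have e4 := (hK _ hmem).comp z (hd hz).hasDerivAt
      refine e4.congr_deriv ?_
      rw [hint hz, hcm, ← e3, hsq1 hz]
      have h5 := hz.2.1
      have h6 : chart a z ^ (m / 2) / chart a z ^ (m / 2 + 1) = (chart a z)⁻¹ := by
        rw [pow_succ]
        have := pow_ne_zero (m / 2) h5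
        field_simp
      rw [h6]
      have h7 := hsq1 hz
      have h8 : (chart a z)⁻¹ * (B (chart a z) * k (chart a z)) * Ψ z * (2 * Ψ z * deriv Ψ z) =
          (chart a z)⁻¹ * Ψ z ^ 2 * (2 * (B (chart a z) * k (chart a z)) * deriv Ψ z) := by ring
      rw [h8, h7, inv_mul_cancel₀ h5, one_mul]
    · intro η hη
      have hKc : ContinuousAt K 0 :=
        (hK 0 (by simpa using Real.sqrt_pos.2 hδ)).continuousAt
      rw [Metric.continuousAt_iff] at hKc
      obtain ⟨δ', hδ', hKδ⟩ := hKc η hη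
      refine ⟨δ' ^ 2, by positivity, fun z hz hz' => ?_⟩
      have h1 : ‖Ψ z‖ < δ' := by
        rw [← hΨn hz] at hz'
        exact lt_of_pow_lt_pow_left₀ 2 hδ'.le hz'
      have h2 := hKδ (x := Ψ z) (by simpa using h1)
      rw [hK0] at h2
      simpa using h2

/-- E and the primitive H of `exists_primitive` have the same derivative, so they differ by a
constant on the connected piece of 𝐓_j near the end; since H → 0, that constant is the limit. -/
theorem exists_limit_of_deriv (hE : IsEnd P a ε m h A) (ha : ∀ w : ℂ, a = w → w ∉ P.D)
    (h1 : P.OneEnded θ j a) {B : ℂ → ℂ} (hB : DifferentiableOn ℂ B (Metric.ball 0 ε))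
    {E : ℂ → ℂ} (hd : ∀ z ∈ nearEnd P θ j a ε,
      HasDerivAt E (chart a z ^ (m / 2) * B (chart a z) * P.sqrtf θ j z) z) :
    ∃ ℓ, Tendsto E (sectorEnd P θ j a) (𝓝 ℓ) := by
  obtain ⟨δ, hδ, hδε, H, hH, hH0⟩ := exists_primitive (P := P) (θ := θ) (j := j) hE hB
  obtain ⟨N', hN', C, hC, hCsub, hCN⟩ := h1 _ (eventually_chart ha hδ)
  have hCU : C ⊆ nearEnd P θ j a δ := by
    intro z hz
    obtain ⟨hzD, hzT, hzN⟩ := hCsub z hz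
    obtain ⟨h2, h3⟩ := hzN z hzD rfl
    exact ⟨(hE.mem_nearEnd hzD h2 (h3.trans_le hδε) hzT).1, h2, h3⟩
  obtain ⟨ℓ, hℓ⟩ := exists_eqOn_const_of_deriv_zero (T := fun z => E z - H z)
    (isOpen_nearEnd P θ j a δ) hC hCU (fun z hz => by
      have := (hd z ⟨hz.1, hz.2.1, hz.2.2.trans_le hδε⟩).sub (hH z hz)
      rwa [sub_self] at this)
  refine ⟨ℓ, ?_⟩
  rw [Metric.tendsto_nhds]
  intro η hη
  obtain ⟨δ', hδ', hsm⟩ := hH0 η hη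
  have h2 : ∀ᶠ z : ℂ in comap (fun z : ℂ => (z : OnePoint ℂ)) (𝓝 a), (z : OnePoint ℂ) ∈ N' :=
    tendsto_comap.eventually hN'
  have h3 : ∀ᶠ z : ℂ in sectorEnd P θ j a, (z : OnePoint ℂ) ∈ N' ∧ z ∈ P.D ∧ P.ζ z ∈ sectorT θ j :=
    eventually_inf_principal.2 (h2.mono fun z hz hz' => ⟨hz, hz'⟩)
  filter_upwards [h3, eventually_nearEnd hE ha hδ'] with z hz hz'
  have hzC := hCN z hz.2.1 hz.2.2 hz.1
  have h4 : E z - ℓ = H z := by rw [← hℓ z hzC]; ring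
  rw [dist_eq_norm, h4]
  exact hsm z (hCU hzC) hz'.2

theorem IsEnd.tendsto_Fhat_odd (hE : IsEnd P a ε m h A) {l : Filter ℂ}
    (hl : ∀ᶠ z in l, z ∈ nearEnd P θ j a ε) (l1 : Tendsto (chart a) l (𝓝 0)) {s : ℕ}
    (hs : Odd s) : Tendsto (P.Fhat θ j s) l (𝓝 0) := by
  obtain ⟨B, hB, hF⟩ := hE.exists_Fhat_eq (θ := θ) (j := j) s hs.pos
  have hBc : ContinuousAt B 0 := hB.continuousOn.continuousAt
    (Metric.isOpen_ball.mem_nhds (by simpa using hE.pos))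
  have l2 : Tendsto (fun z => chart a z ^ (m / 2) * B (chart a z)) l
      (𝓝 (0 ^ (m / 2) * B 0)) := (l1.pow _).mul (hBc.tendsto.comp l1)
  have hm : m / 2 ≠ 0 := by have := hE.two_le; omega
  rw [zero_pow hm, zero_mul] at l2
  refine l2.congr' ?_
  filter_upwards [hl] with z hz
  rw [hF z hz, if_pos hs]

theorem tendsto_logCoeff {ι : Type*} {l : Filter ι} {b : ι → ℕ → ℂ} {k : ℕ}
    (hb : ∀ i, 1 ≤ i → Tendsto (fun x => b x i) l (𝓝 0)) :
    Tendsto (fun x => Problem.logCoeff (b x) k) l (𝓝 0) := by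
  have h1 : ∀ n, 1 ≤ n → ∀ k, Tendsto (fun x => PowerSeries.coeff k
      ((PowerSeries.mk fun i => if i = 0 then 0 else b x i) ^ n)) l (𝓝 0) := by
    intro n hn
    induction n, hn using Nat.le_induction with
    | base =>
      intro k
      simp only [pow_one, PowerSeries.coeff_mk]
      split_ifs with hk
      · exact tendsto_const_nhds
      · exact hb k (by omega)
    | succ n hn ih =>
      intro k
      simp only [pow_succ, PowerSeries.coeff_mul]
      have h0 : ∀ i, Tendsto (fun x => PowerSeries.coeff i
          (PowerSeries.mk fun i => if i = 0 then 0 else b x i)) l (𝓝 0) := by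
        intro i
        simp only [PowerSeries.coeff_mk]
        split_ifs with hk
        · exact tendsto_const_nhds
        · exact hb i (by omega)
      have key := tendsto_finsetSum (Finset.HasAntidiagonal.antidiagonal k)
        fun p _ => (ih p.1).mul (h0 p.2)
      simp only [mul_zero, Finset.sum_const_zero] at key
      exact key
  unfold Problem.logCoeff
  have key := tendsto_finsetSum (Finset.Icc 1 k) fun n hn =>
    (h1 n (Finset.mem_Icc.1 hn).1 k).const_mul ((-1) ^ (n + 1) / (n : ℂ))
  simp only [mul_zero, Finset.sum_const_zero] at key
  exact key

/-- Only odd F̂ enter the logarithm, and they vanish at the end because ⌊m/2⌋ ≥ 1. The filter is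
arbitrary, so the limit is also available in the j-th branch at the end of another sector. -/
theorem IsEnd.tendsto_Ehat_even (hE : IsEnd P a ε m h A) {l : Filter ℂ}
    (hl : ∀ᶠ z in l, z ∈ nearEnd P θ j a ε) (l1 : Tendsto (chart a) l (𝓝 0)) (α : ℕ → ℂ)
    (G : ℕ → ℂ → ℂ) {s : ℕ} (hs : Even s) :
    Tendsto (P.Ehat α G θ j s) l (𝓝 (α (s / 2))) := by
  have e : P.Ehat α G θ j s = fun z =>
      -(1 / 2) * Problem.logCoeff (fun i => P.Fhat θ j (2 * i - 1) z) (s / 2) + α (s / 2) := by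
    funext z
    unfold Problem.Ehat
    rw [if_pos hs]
  have h1 : Tendsto (fun z => -(1 / 2) *
      Problem.logCoeff (fun i => P.Fhat θ j (2 * i - 1) z) (s / 2) + α (s / 2)) l
      (𝓝 (-(1 / 2) * 0 + α (s / 2))) := by
    refine ((tendsto_logCoeff fun i hi => ?_).const_mul _).add_const _
    exact hE.tendsto_Fhat_odd hl l1 (by
      obtain ⟨i, rfl⟩ := Nat.exists_eq_add_of_le hi
      exact ⟨i, by omega⟩)
  rw [mul_zero, zero_add] at h1
  rwa [e]

/-- `Ê_s` has a limit at the reference point. -/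
theorem exists_Ehat_limit (hA : P.Admissible a) (h1 : P.OneEnded θ j a) (α : ℕ → ℂ)
    {G : ℕ → ℂ → ℂ} (hG : P.IsOddCoeff θ G) (s : ℕ) :
    ∃ ℓ, Tendsto (P.Ehat α G θ j s) (sectorEnd P θ j a) (𝓝 ℓ) := by
  obtain ⟨ha, ε, m, h, A, hE⟩ := Admissible.exists_isEnd hA
  rcases Nat.even_or_odd s with hev | hodd
  · exact ⟨_, hE.tendsto_Ehat_even ((eventually_nearEnd hE ha hE.pos).mono fun z hz => hz.1)
      (tendsto_chart_sectorEnd hE ha) α G hev⟩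
  · have e : P.Ehat α G θ j s = fun z => powBr θ j (-1 / 2) (P.ζ z) * G s z := by
      funext z
      unfold Problem.Ehat
      rw [if_neg (Nat.not_even_iff_odd.2 hodd)]
    rw [e]
    obtain ⟨B, hB, hF⟩ := hE.exists_Fhat_eq (θ := θ) (j := j) s hodd.pos
    refine exists_limit_of_deriv hE ha h1 hB fun z hz => ?_
    have h2 := (hG s hodd).2.2 j z hz.1.1 hz.1.2
    rwa [hF z hz, if_pos hodd] at h2

end Limits

end TurningPointLG

namespace TurningPointLG

/-! ### Integrability along progressive paths -/

theorem exists_arc {N : ℕ} {τ : Fin (N + 1) → ℝ} {t : ℝ} (h0 : τ 0 < t) (h1 : t < τ (Fin.last N))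
    (hS : t ∉ Set.range τ) : ∃ i : Fin N, t ∈ Set.Ioo (τ i.castSucc) (τ i.succ) := by
  have key : ∀ n : Fin (N + 1), t < τ n → ∃ i : Fin N, t ∈ Set.Ioo (τ i.castSucc) (τ i.succ) := by
    intro n
    induction n using Fin.induction with
    | zero => exact fun h => absurd h h0.not_gt
    | succ i ih =>
      intro h
      by_cases h2 : t < τ i.castSucc
      · exact ih h2
      · exact ⟨i, lt_of_le_of_ne (not_lt.1 h2) fun h3 => hS ⟨_, h3⟩, h⟩
  exact key _ h1

/-- The weight 1 + |z|² makes this a bound on the spherical speed, which is uniform for the charts z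
and 1/z. -/
theorem IsR2Arc.exists_bound {γ : ℝ → ℂ} {a b : ℝ} (hab : a < b) (h : IsR2Arc γ a b) :
    ∃ M, 0 ≤ M ∧ ∀ t ∈ Set.Ioo a b, DifferentiableAt ℝ γ t ∧
      ‖deriv γ t‖ ≤ M * (1 + ‖γ t‖ ^ 2) := by
  obtain ⟨c, hc, -, hγ⟩ := h
  have hc' : ContinuousOn (derivWithin c (Set.Icc a b)) (Set.Icc a b) :=
    hc.continuousOn_derivWithin (uniqueDiffOn_Icc hab) (by norm_num)
  obtain ⟨M, hM⟩ := (isCompact_Icc (a := a) (b := b)).bddAbove_image hc'.norm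
  have hd : ∀ t ∈ Set.Ioo a b, HasDerivAt c (derivWithin c (Set.Icc a b) t) t := fun t ht =>
    ((hc.differentiableOn (by norm_num)) t (Set.Ioo_subset_Icc_self ht)).hasDerivWithinAt.hasDerivAt
      (Icc_mem_nhds ht.1 ht.2)
  have hb : ∀ t ∈ Set.Ioo a b, ‖derivWithin c (Set.Icc a b) t‖ ≤ M := fun t ht =>
    hM ⟨t, Set.Ioo_subset_Icc_self ht, rfl⟩
  have hM0 : 0 ≤ M := by
    have : (a + b) / 2 ∈ Set.Ioo a b := ⟨by linarith, by linarith⟩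
    exact (norm_nonneg _).trans (hb _ this)
  refine ⟨M, hM0, fun t ht => ?_⟩
  rcases hγ with hγ | hγ
  · have e : γ =ᶠ[𝓝 t] c := by
      filter_upwards [Ioo_mem_nhds ht.1 ht.2] with y hy using hγ y hy
    have h1 := (hd t ht).congr_of_eventuallyEq e
    refine ⟨h1.differentiableAt, ?_⟩
    rw [h1.deriv]
    refine (hb t ht).trans ?_
    nlinarith [sq_nonneg ‖γ t‖]
  · have e : γ =ᶠ[𝓝 t] fun y => (c y)⁻¹ := by
      filter_upwards [Ioo_mem_nhds ht.1 ht.2] with y hy using (hγ y hy).2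
    have h1 := ((hd t ht).fun_inv (hγ t ht).1).congr_of_eventuallyEq e
    refine ⟨h1.differentiableAt, ?_⟩
    rw [h1.deriv, (hγ t ht).2, norm_div, norm_neg, norm_pow, norm_inv, div_eq_mul_inv, ← inv_pow]
    calc _ ≤ M * ‖c t‖⁻¹ ^ 2 := by gcongr; exact hb t ht
      _ ≤ _ := by gcongr; linarith

section Path

variable {P : Problem} {θ : ℝ} {e : SignType → OnePoint ℂ} {j k : SignType} {γ : ℝ → ℂ}

theorem IsProgressive.exists_deriv_bound (h : IsProgressive P θ e j k γ) :
    ∃ S : Set ℝ, S.Countable ∧ ∃ M, 0 ≤ M ∧ ∀ t ∈ Set.Ioo (0 : ℝ) 1 \ S,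
      DifferentiableAt ℝ γ t ∧ ‖deriv γ t‖ ≤ M * (1 + ‖γ t‖ ^ 2) := by
  obtain ⟨N, τ, hτ, h0, h1, hc⟩ := h.chain
  choose M hM0 hM using fun i : Fin N =>
    IsR2Arc.exists_bound (hτ (Fin.castSucc_lt_succ (i := i))) (hc i)
  refine ⟨Set.range τ, Set.countable_range τ, ∑ i, M i, Finset.sum_nonneg fun i _ => hM0 i,
    fun t ht => ?_⟩
  obtain ⟨i, hi⟩ := exists_arc (by rw [h0]; exact ht.1.1) (by rw [h1]; exact ht.1.2) ht.2
  obtain ⟨h2, h3⟩ := hM i t hi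
  refine ⟨h2, h3.trans ?_⟩
  gcongr
  exact Finset.single_le_sum (f := M) (fun i _ => hM0 i) (Finset.mem_univ i)

theorem exists_lower_bound {c : ℝ → ℂ} {b : ℝ} (hb : 0 < b) {c' : ℂ} (hc' : c' ≠ 0)
    (hc : HasDerivWithinAt c c' (Set.Icc 0 b) 0) :
    ∀ᶠ t in 𝓝[>] (0 : ℝ), ‖c'‖ / 2 * t ≤ ‖c t - c 0‖ := by
  have h1 := (hasDerivWithinAt_iff_isLittleO.1 hc).def (c := ‖c'‖ / 2)
    (by have := norm_pos_iff.2 hc'; positivity)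
  have h2 : 𝓝[>] (0 : ℝ) ≤ 𝓝[Set.Icc 0 b] 0 := by
    rw [← nhdsWithin_Ioo_eq_nhdsGT hb]
    exact nhdsWithin_mono _ Set.Ioo_subset_Icc_self
  filter_upwards [h2 h1, self_mem_nhdsWithin] with t ht ht0
  have ht0' : (0 : ℝ) < t := ht0
  rw [sub_zero, Real.norm_of_nonneg ht0'.le] at ht
  have h3 : ‖t • c'‖ = t * ‖c'‖ := by rw [norm_smul, Real.norm_of_nonneg ht0'.le]
  have h4 : ‖t • c'‖ ≤ ‖c t - c 0‖ + ‖c t - c 0 - t • c'‖ := by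
    have : t • c' = (c t - c 0) - (c t - c 0 - t • c') := by abel
    calc ‖t • c'‖ = ‖(c t - c 0) - (c t - c 0 - t • c')‖ := by rw [← this]
      _ ≤ _ := norm_sub_le _ _
  nlinarith

/-- The derivative of the arc does not vanish at its endpoint, so the distance to the end grows at
least linearly in t. This excludes arcs that linger at the singularity. -/
theorem IsProgressive.exists_chart_lower_bound (h : IsProgressive P θ e j k γ) :
    ∃ κ, 0 < κ ∧ ∀ᶠ t in 𝓝[>] (0 : ℝ), κ * t ≤ ‖chart (e j) (γ t)‖ := by
  obtain ⟨N, τ, hτ, h0, h1, harc⟩ := h.chain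
  obtain _ | N := N
  · have : (Fin.last 0) = 0 := rfl
    rw [this, h0] at h1
    exact absurd h1 zero_ne_one
  have hb : 0 < τ (Fin.succ 0) := by
    rw [← h0]
    exact hτ (Fin.succ_pos 0)
  have ha := harc 0
  rw [Fin.castSucc_zero, h0] at ha
  generalize τ (Fin.succ 0) = b at hb ha
  obtain ⟨c, hc, hc0, hγ⟩ := ha
  have hm : (0 : ℝ) ∈ Set.Icc 0 b := ⟨le_rfl, hb.le⟩
  have hd := (hc.differentiableOn (by norm_num) 0 hm).hasDerivWithinAt
  have hlow := exists_lower_bound hb (hc0 0 hm) hd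
  set c' := derivWithin c (Set.Icc 0 b) 0
  have hpos : 0 < ‖c'‖ := norm_pos_iff.2 (hc0 0 hm)
  have hct : Tendsto c (𝓝[>] 0) (𝓝 (c 0)) := by
    refine hd.continuousWithinAt.tendsto.mono_left ?_
    rw [← nhdsWithin_Ioo_eq_nhdsGT hb]
    exact nhdsWithin_mono _ Set.Ioo_subset_Icc_self
  have hIoo : ∀ᶠ t in 𝓝[>] (0 : ℝ), t ∈ Set.Ioo 0 b := Ioo_mem_nhdsGT hb
  have hcoe : ∀ z : ℂ, Tendsto γ (𝓝[>] 0) (𝓝 z) → e j = z := fun z hz =>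
    tendsto_nhds_unique h.start (((OnePoint.continuous_coe.tendsto z)).comp hz)
  rcases hγ with hγ | hγ
  · have e1 : e j = c 0 := hcoe _ (hct.congr' (hIoo.mono fun t ht => (hγ t ht).symm))
    refine ⟨‖c'‖ / 2, by positivity, ?_⟩
    filter_upwards [hlow, hIoo] with t ht ht'
    rwa [e1, chart_coe, hγ t ht']
  · by_cases hz : c 0 = 0
    · have e1 : e j = OnePoint.infty := by
        refine tendsto_nhds_unique h.start ?_
        have h2 : Tendsto c (𝓝[>] 0) (𝓝[≠] 0) := by
          refine tendsto_nhdsWithin_iff.2 ⟨hz ▸ hct, hIoo.mono fun t ht => (hγ t ht).1⟩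
        have h3 : Tendsto γ (𝓝[>] 0) (Bornology.cobounded ℂ) :=
          (tendsto_inv₀_nhdsNE_zero.comp h2).congr' (hIoo.mono fun t ht => ((hγ t ht).2).symm)
        rw [Metric.cobounded_eq_cocompact, ← Filter.coclosedCompact_eq_cocompact,
          ← OnePoint.comap_coe_nhds_infty] at h3
        exact tendsto_comap_iff.1 h3
      refine ⟨‖c'‖ / 2, by positivity, ?_⟩
      filter_upwards [hlow, hIoo] with t ht ht'
      rw [e1, chart_infty, (hγ t ht').2, inv_inv]
      rwa [hz, sub_zero] at ht
    -- The arc is given in the chart 1/z but ends at a finite point; the bound is carried over to z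
    -- - w.
    · have e1 : e j = ((c 0)⁻¹ : ℂ) := hcoe _ ((hct.inv₀ hz).congr'
        (hIoo.mono fun t ht => ((hγ t ht).2).symm))
      have hpos0 : 0 < ‖c 0‖ := norm_pos_iff.2 hz
      refine ⟨‖c'‖ / 2 / (2 * ‖c 0‖ * ‖c 0‖), by positivity, ?_⟩
      have hle : ∀ᶠ t in 𝓝[>] (0 : ℝ), ‖c t‖ < 2 * ‖c 0‖ :=
        hct.norm.eventually_lt_const (by linarith)
      filter_upwards [hlow, hIoo, hle, self_mem_nhdsWithin] with t ht ht' ht2 ht3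
      have ht0 : (0 : ℝ) < t := ht3
      have hct0 := (hγ t ht').1
      have e2 : (c t)⁻¹ - (c 0)⁻¹ = -(c t - c 0) / (c t * c 0) := by
        field_simp
        ring
      rw [e1, chart_coe, (hγ t ht').2, e2, norm_div, norm_neg, norm_mul, div_mul_eq_mul_div]
      have : 0 < ‖c t‖ := norm_pos_iff.2 hct0
      gcongr

/-- `|Φ| |f|^{1/2}`. -/
noncomputable def errDensity (P : Problem) (z : ℂ) : ℝ := ‖P.Phi z‖ * Real.sqrt ‖P.f z‖

/-- |Φ| |f|^{1/2} |dz| is O(|v|^{⌊m/2⌋ - m/2}) |dv|, with exponent 0 or -1/2. The factor 1 + |z|² is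
the one from the spherical speed bound; |dv/dz| (1 + |z|²) is bounded near the end. -/
theorem exists_errDensity_bound {a : OnePoint ℂ} {ε : ℝ} {m : ℕ} {h A : ℂ → ℂ}
    (hE : IsEnd P a ε m h A) :
    ∃ δ C, 0 < δ ∧ 0 ≤ C ∧ ∀ z, chart a z ≠ 0 → ‖chart a z‖ < δ →
      errDensity P z * (1 + ‖z‖ ^ 2) ≤ C * ‖chart a z‖ ^ (-(1 / 2) : ℝ) := by
  have hε := hE.pos
  have hsub : Metric.closedBall (0 : ℂ) (ε / 2) ⊆ Metric.ball 0 ε :=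
    Metric.closedBall_subset_ball (by linarith)
  obtain ⟨CA, hCA⟩ := (isCompact_closedBall (0 : ℂ) (ε / 2)).bddAbove_image
    (hE.diff_A.continuousOn.mono hsub).norm
  obtain ⟨Ch, hCh⟩ := (isCompact_closedBall (0 : ℂ) (ε / 2)).bddAbove_image
    (hE.diff_h.continuousOn.mono hsub).norm
  have hCA0 : 0 ≤ CA := (norm_nonneg _).trans (hCA ⟨0, by simp; linarith, rfl⟩)
  obtain ⟨Cd, hCd0, hCd⟩ : ∃ Cd, 0 ≤ Cd ∧ ∀ z, chart a z ≠ 0 → ‖chart a z‖ < 1 →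
      ‖dchart a z‖ * (1 + ‖z‖ ^ 2) ≤ Cd := by
    induction a using OnePoint.rec with
    | coe w =>
      refine ⟨1 + (1 + ‖w‖) ^ 2, by positivity, fun z _ hz => ?_⟩
      rw [chart_coe] at hz
      have : ‖z‖ ≤ 1 + ‖w‖ := by
        have := norm_add_le (z - w) w
        rw [sub_add_cancel] at this
        linarith
      rw [dchart_coe, norm_one, one_mul]
      gcongr
    | infty =>
      refine ⟨2, by norm_num, fun z hz0 hz => ?_⟩
      rw [chart_infty] at hz0
      rw [chart_infty, norm_inv] at hz
      have hz1 : 0 < ‖z‖ := norm_pos_iff.2 (by simpa using hz0)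
      have hz2 : 1 < ‖z‖ := by
        by_contra! h3
        exact absurd (one_le_inv₀ hz1 |>.2 h3) hz.not_ge
      rw [dchart_infty, norm_neg, norm_inv, norm_pow, inv_mul_le_iff₀ (by positivity)]
      nlinarith
  refine ⟨min (ε / 2) 1, CA * Real.sqrt Ch * Cd, by positivity, by positivity,
    fun z hz0 hz => ?_⟩
  have hz1 : ‖chart a z‖ < ε / 2 := hz.trans_le (min_le_left _ _)
  have hz2 : ‖chart a z‖ < 1 := hz.trans_le (min_le_right _ _)
  have hzε : ‖chart a z‖ < ε := by linarith
  have hv : 0 < ‖chart a z‖ := norm_pos_iff.2 hz0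
  have hmem : chart a z ∈ Metric.closedBall (0 : ℂ) (ε / 2) := by simpa using hz1.le
  have h1 : ‖A (chart a z)‖ ≤ CA := hCA ⟨_, hmem, rfl⟩
  have h2 : ‖h (chart a z)‖ ≤ Ch := hCh ⟨_, hmem, rfl⟩
  have h3 := hCd z hz0 hz2
  unfold errDensity
  rw [hE.Phi_eq z hz0 hzε, hE.f_eq z hz0 hzε]
  have e1 : Real.sqrt ‖h (chart a z) / chart a z ^ m * dchart a z ^ 2‖ =
      Real.sqrt ‖h (chart a z)‖ / Real.sqrt (‖chart a z‖ ^ m) * ‖dchart a z‖ := by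
    rw [norm_mul, norm_div, norm_pow, norm_pow, Real.sqrt_mul (by positivity),
      Real.sqrt_div (norm_nonneg _), Real.sqrt_sq (norm_nonneg _)]
  have e2 : ‖chart a z‖ ^ (m / 2) / Real.sqrt (‖chart a z‖ ^ m) ≤
      ‖chart a z‖ ^ (-(1 / 2) : ℝ) := by
    rw [Real.sqrt_eq_rpow, ← Real.rpow_natCast, ← Real.rpow_natCast, ← Real.rpow_mul hv.le,
      ← Real.rpow_sub hv]
    refine Real.rpow_le_rpow_of_exponent_ge hv hz2.le ?_
    have : (m : ℝ) ≤ 2 * ((m / 2 : ℕ) : ℝ) + 1 := by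
      have : m ≤ 2 * (m / 2) + 1 := by omega
      exact_mod_cast this
    linarith
  rw [e1, norm_mul, norm_pow]
  calc _ = (‖chart a z‖ ^ (m / 2) / Real.sqrt (‖chart a z‖ ^ m)) *
        (‖A (chart a z)‖ * Real.sqrt ‖h (chart a z)‖) * (‖dchart a z‖ * (1 + ‖z‖ ^ 2)) := by ring
    _ ≤ ‖chart a z‖ ^ (-(1 / 2) : ℝ) * (CA * Real.sqrt Ch) * Cd := by gcongr
    _ = _ := by ring

theorem continuousOn_Phi (P : Problem) : ContinuousOn P.Phi (P.D \ {P.z₀}) := by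
  have hf := P.analytic_f
  have h1 := hf.deriv P.isOpen_D
  have h2 := h1.deriv P.isOpen_D
  have hs : P.D \ {P.z₀} ⊆ P.D := Set.sdiff_subset
  have h0 : ∀ z ∈ P.D \ {P.z₀}, P.f z ≠ 0 := fun z hz => P.f_ne_zero z hz.1 hz.2
  have c0 := hf.continuousOn.mono hs
  have c1 := h1.continuousOn.mono hs
  have c2 := h2.continuousOn.mono hs
  have cg := P.analytic_g.continuousOn.mono hs
  refine ContinuousOn.add (ContinuousOn.div ?_ (continuousOn_const.mul (c0.pow 3)) ?_)
    (cg.div c0 h0)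
  · exact ((continuousOn_const.mul c0).mul c2).sub (continuousOn_const.mul (c1.pow 2))
  · exact fun z hz => mul_ne_zero (by norm_num) (pow_ne_zero 3 (h0 z hz))

theorem continuousOn_errDensity (P : Problem) : ContinuousOn (errDensity P) (P.D \ {P.z₀}) :=
  (continuousOn_Phi P).norm.mul
    ((P.analytic_f.continuousOn.mono Set.sdiff_subset).norm.sqrt)

theorem IsProgressive.mapsTo (h : IsProgressive P θ e j k γ) :
    Set.MapsTo γ (Set.Ioo 0 1) (P.D \ {P.z₀}) := fun t ht => h.mem t ht

/-- Since |v| ≥ κt near the start, the density is dominated there by a multiple of t^{-1/2}; away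
from it, compactness gives a constant. -/
theorem IsProgressive.integrableOn_half (h : IsProgressive P θ e j k γ)
    (hA : P.Admissible (e j)) :
    MeasureTheory.IntegrableOn (fun t => errDensity P (γ t) * ‖deriv γ t‖) (Set.Ioo 0 (1 / 2)) := by
  obtain ⟨ha, ε, m, hh, A, hE⟩ := Admissible.exists_isEnd hA
  obtain ⟨δ, C, hδ, hC, hbound⟩ := exists_errDensity_bound hE
  obtain ⟨κ, hκ, hlow⟩ := h.exists_chart_lower_bound
  obtain ⟨S, hS, M, hM, hderiv⟩ := h.exists_deriv_bound
  have hsmall : ∀ᶠ t in 𝓝[>] (0 : ℝ), chart (e j) (γ t) ≠ 0 ∧ ‖chart (e j) (γ t)‖ < δ := by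
    filter_upwards [h.start.eventually (eventually_chart ha hδ), Ioo_mem_nhdsGT one_pos] with t ht ht'
    exact ht _ (h.mem t ht').1 rfl
  obtain ⟨η, hη, hη'⟩ := mem_nhdsGT_iff_exists_Ioc_subset.1
    (hlow.and (hsmall.and (Ioo_mem_nhdsGT one_pos)))
  have hη0 : (0 : ℝ) < η := hη
  have hη1 : η < 1 := (hη' ⟨hη0, le_rfl⟩).2.2.2
  have hcont : ContinuousOn (fun t => errDensity P (γ t)) (Set.Ioo 0 1) :=
    (continuousOn_errDensity P).comp h.continuousOn h.mapsTo
  have hcont2 : ContinuousOn (fun t => errDensity P (γ t) * (M * (1 + ‖γ t‖ ^ 2))) (Set.Ioo 0 1) :=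
    hcont.mul (continuousOn_const.mul (continuousOn_const.add (h.continuousOn.norm.pow 2)))
  obtain ⟨K, hK⟩ := (isCompact_Icc (a := η) (b := 1 / 2)).bddAbove_image
    (hcont2.mono fun t ht => ⟨hη0.trans_le ht.1, ht.2.trans_lt (by norm_num)⟩)
  have hsub : Set.Ioo (0 : ℝ) (1 / 2) ⊆ Set.Ioo 0 1 := Set.Ioo_subset_Ioo_right (by norm_num)
  have hdens0 : ∀ z, 0 ≤ errDensity P z := fun z => by unfold errDensity; positivity
  have hrpow : MeasureTheory.IntegrableOn (fun t : ℝ => M * C * κ ^ (-(1 / 2) : ℝ) *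
      t ^ (-(1 / 2) : ℝ) + |K|) (Set.Ioo 0 (1 / 2)) := by
    have h1 : IntervalIntegrable (fun t : ℝ => t ^ (-(1 / 2) : ℝ)) MeasureTheory.volume 0 (1 / 2) :=
      intervalIntegral.intervalIntegrable_rpow' (by norm_num)
    rw [intervalIntegrable_iff_integrableOn_Ioo_of_le (by norm_num)] at h1
    refine MeasureTheory.Integrable.add (h1.const_mul _) ?_
    exact MeasureTheory.integrableOn_const (by simp)
  refine MeasureTheory.Integrable.mono' hrpow ?_ ?_
  · exact ((hcont.mono hsub).aestronglyMeasurable measurableSet_Ioo).mul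
      ((stronglyMeasurable_deriv γ).norm.aestronglyMeasurable)
  · refine (MeasureTheory.ae_restrict_iff' measurableSet_Ioo).2 ?_
    filter_upwards [hS.ae_notMem MeasureTheory.volume] with t htS ht
    have ht1 := hsub ht
    have hd := (hderiv t ⟨ht1, htS⟩).2
    have e1 : errDensity P (γ t) * ‖deriv γ t‖ ≤ errDensity P (γ t) * (M * (1 + ‖γ t‖ ^ 2)) := by
      gcongr
      exact hdens0 _
    rw [Real.norm_of_nonneg (mul_nonneg (hdens0 _) (norm_nonneg _))]
    refine e1.trans ?_
    have hpos : 0 ≤ M * C * κ ^ (-(1 / 2) : ℝ) * t ^ (-(1 / 2) : ℝ) := by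
      have := Real.rpow_nonneg hκ.le (-(1 / 2) : ℝ)
      have := Real.rpow_nonneg ht.1.le (-(1 / 2) : ℝ)
      positivity
    rcases le_total t η with h3 | h3
    · obtain ⟨h4, ⟨h5, h6⟩, -⟩ := hη' ⟨ht.1, h3⟩
      have h7 := hbound _ h5 h6
      have h8 : ‖chart (e j) (γ t)‖ ^ (-(1 / 2) : ℝ) ≤ (κ * t) ^ (-(1 / 2) : ℝ) :=
        Real.rpow_le_rpow_of_nonpos (mul_pos hκ ht.1) h4 (by norm_num)
      rw [Real.mul_rpow hκ.le ht.1.le] at h8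
      calc errDensity P (γ t) * (M * (1 + ‖γ t‖ ^ 2))
          = M * (errDensity P (γ t) * (1 + ‖γ t‖ ^ 2)) := by ring
        _ ≤ M * (C * ‖chart (e j) (γ t)‖ ^ (-(1 / 2) : ℝ)) := by gcongr
        _ ≤ M * (C * (κ ^ (-(1 / 2) : ℝ) * t ^ (-(1 / 2) : ℝ))) := by gcongr
        _ = M * C * κ ^ (-(1 / 2) : ℝ) * t ^ (-(1 / 2) : ℝ) := by ring
        _ ≤ _ := le_add_of_nonneg_right (abs_nonneg _)
    · have h4 : errDensity P (γ t) * (M * (1 + ‖γ t‖ ^ 2)) ≤ K := hK ⟨t, ⟨h3, ht.2.le⟩, rfl⟩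
      exact h4.trans ((le_abs_self K).trans (le_add_of_nonneg_left hpos))

/-- The second half is the first half of the reversed path; `errDensity` does not involve the
branch. -/
theorem IsProgressive.integrableOn (h : IsProgressive P θ e j k γ) (hjk : j ≠ k)
    (hj : P.Admissible (e j)) (hk : P.Admissible (e k)) :
    MeasureTheory.IntegrableOn (fun t => errDensity P (γ t) * ‖deriv γ t‖) (Set.Ioo 0 1) := by
  have h1 := h.integrableOn_half hj
  have h2 := (h.reverse hjk).integrableOn_half hk
  rw [← intervalIntegrable_iff_integrableOn_Ioo_of_le (by norm_num)] at h1 h2 ⊢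
  have h3 := h2.comp_sub_left 1
  have e1 : ∀ t, deriv (fun t => γ (1 - t)) (1 - t) = -deriv γ t := by
    intro t
    rw [deriv_comp_const_sub, sub_sub_cancel]
  simp only [e1, sub_sub_cancel, norm_neg, sub_zero] at h3
  norm_num at h3
  exact h1.trans h3.symm

end Path

end TurningPointLG

namespace TurningPointLG

/-! ### Solutions on the image of `D` and their Wronskians -/

section Solutions

variable {P : Problem} {u : ℂ} {W V : ℂ → ℂ}

theorem Problem.isOpen_image (P : Problem) : IsOpen (P.ζ '' P.D) := by
  have han : AnalyticOnNhd ℂ P.ζ P.D := P.analytic_ζ.analyticOnNhd P.isOpen_D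
  rcases han.is_constant_or_isOpen P.isConnected_D.isPreconnected with ⟨w, hw⟩ | h
  · exfalso
    have hw0 : w = 0 := by rw [← hw _ P.z₀_mem, P.ζ_z₀]
    refine P.deriv_f_z₀ ?_
    have e : P.f =ᶠ[𝓝 P.z₀] fun _ => 0 := by
      filter_upwards [P.isOpen_D.mem_nhds P.z₀_mem] with z hz
      rw [← P.ζ_eq z hz, hw z hz, hw0, zero_mul]
    rw [e.deriv_eq, deriv_const]
  · exact h _ subset_rfl P.isOpen_D

theorem Problem.isPreconnected_image (P : Problem) : IsPreconnected (P.ζ '' P.D) :=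
  P.isConnected_D.isPreconnected.image _ P.analytic_ζ.continuousOn

theorem Problem.zero_mem_image (P : Problem) : (0 : ℂ) ∈ P.ζ '' P.D := ⟨P.z₀, P.z₀_mem, P.ζ_z₀⟩

theorem IsSolution.hasDerivAt (h : IsSolution P u W) {x : ℂ} (hx : x ∈ P.ζ '' P.D) :
    HasDerivAt W (deriv W x) x :=
  ((h.1 x hx).differentiableAt (P.isOpen_image.mem_nhds hx)).hasDerivAt

theorem IsSolution.hasDerivAt_deriv (h : IsSolution P u W) {x : ℂ} (hx : x ∈ P.ζ '' P.D) :
    HasDerivAt (deriv W) (deriv (deriv W) x) x :=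
  ((h.1.deriv P.isOpen_image x hx).differentiableAt (P.isOpen_image.mem_nhds hx)).hasDerivAt

/-- The Wronskian. -/
noncomputable def wronskian (W V : ℂ → ℂ) (x : ℂ) : ℂ := W x * deriv V x - deriv W x * V x

theorem hasDerivAt_wronskian (hW : IsSolution P u W) (hV : IsSolution P u V) {x : ℂ}
    (hx : x ∈ P.ζ '' P.D) :
    HasDerivAt (wronskian W V) (W x * deriv (deriv V) x - deriv (deriv W) x * V x) x := by
  have := ((hW.hasDerivAt hx).mul (hV.hasDerivAt_deriv hx)).sub
    ((hW.hasDerivAt_deriv hx).mul (hV.hasDerivAt hx))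
  refine this.congr_deriv ?_
  ring

theorem deriv_wronskian_eq_zero (hW : IsSolution P u W) (hV : IsSolution P u V) {x : ℂ}
    (hx : x ∈ P.ζ '' P.D) (h0 : x ≠ 0) : deriv (wronskian W V) x = 0 := by
  rw [(hasDerivAt_wronskian hW hV hx).deriv]
  obtain ⟨z, hz, rfl⟩ := hx
  have hz0 : z ≠ P.z₀ := by rintro rfl; exact h0 P.ζ_z₀
  rw [hW.2 z hz hz0, hV.2 z hz hz0]
  ring

/-- `IsSolution` asserts the equation only off ζ = 0; there the derivative of the Wronskian vanishes
by continuity. -/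
theorem exists_wronskian_eq (hW : IsSolution P u W) (hV : IsSolution P u V) :
    ∃ ω, ∀ x ∈ P.ζ '' P.D, wronskian W V x = ω := by
  have hd : DifferentiableOn ℂ (wronskian W V) (P.ζ '' P.D) := fun x hx =>
    (hasDerivAt_wronskian hW hV hx).differentiableAt.differentiableWithinAt
  refine P.isOpen_image.exists_is_const_of_deriv_eq_zero P.isPreconnected_image hd fun x hx => ?_
  by_cases h0 : x = 0
  · subst h0
    have hc : ContinuousAt (deriv (wronskian W V)) 0 :=
      (hd.deriv P.isOpen_image).continuousOn.continuousAt (P.isOpen_image.mem_nhds hx)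
    refine tendsto_nhds_unique (hc.tendsto.mono_left nhdsWithin_le_nhds)
      (tendsto_const_nhds.congr' ?_ : Tendsto _ (𝓝[≠] (0 : ℂ)) _)
    filter_upwards [self_mem_nhdsWithin, nhdsWithin_le_nhds (P.isOpen_image.mem_nhds hx)]
      with y hy hy'
    exact (deriv_wronskian_eq_zero hW hV hy' hy).symm
  · exact deriv_wronskian_eq_zero hW hV hx h0

/-- Near a point with V ≠ 0 the quotient W/V has zero derivative; the identity theorem extends the
resulting relation to the connected image of D. -/
theorem exists_relation_of_wronskian_eq_zero (hW : IsSolution P u W) (hV : IsSolution P u V)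
    (h0 : ∀ x ∈ P.ζ '' P.D, wronskian W V x = 0) :
    ∃ a b : ℂ, ¬(a = 0 ∧ b = 0) ∧ ∀ x ∈ P.ζ '' P.D, a * W x + b * V x = 0 := by
  by_cases hV0 : ∀ x ∈ P.ζ '' P.D, V x = 0
  · exact ⟨0, 1, by simp, fun x hx => by rw [hV0 x hx]; ring⟩
  push Not at hV0
  obtain ⟨y, hy, hVy⟩ := hV0
  have hn : ∀ᶠ x in 𝓝 y, x ∈ P.ζ '' P.D ∧ V x ≠ 0 :=
    by filter_upwards [P.isOpen_image.mem_nhds hy,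
      (hV.hasDerivAt hy).continuousAt.eventually_ne hVy] with x h1 h2 using ⟨h1, h2⟩
  obtain ⟨ε, hε, hb⟩ := Metric.eventually_nhds_iff_ball.1 hn
  have hq : ∀ x ∈ Metric.ball y ε, HasDerivAt (fun x => W x / V x) 0 x := by
    intro x hx
    obtain ⟨hx1, hx2⟩ := hb x hx
    refine ((hW.hasDerivAt hx1).div (hV.hasDerivAt hx1) hx2).congr_deriv ?_
    have := h0 x hx1
    unfold wronskian at this
    rw [div_eq_zero_iff]
    left
    linear_combination -this
  obtain ⟨c, hc⟩ := exists_eqOn_const_of_deriv_zero Metric.isOpen_ball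
    Metric.isPreconnected_ball subset_rfl hq
  refine ⟨1, -c, by simp, fun x hx => ?_⟩
  have han : AnalyticOnNhd ℂ (fun x => 1 * W x + -c * V x) (P.ζ '' P.D) :=
    ((hW.1.const_mul 1).add (hV.1.const_mul (-c))).analyticOnNhd P.isOpen_image
  refine han.eqOn_zero_of_preconnected_of_eventuallyEq_zero P.isPreconnected_image hy ?_ hx
  filter_upwards [Metric.ball_mem_nhds y hε] with w hw
  have h1 := hc w hw
  rw [div_eq_iff (hb w hw).2] at h1
  simp only [h1, Pi.zero_apply]
  ring

theorem relation_of_wronskian_ne_zero (hW : IsSolution P u W) (hV : IsSolution P u V) {x : ℂ}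
    (hx : x ∈ P.ζ '' P.D) (h0 : wronskian W V x ≠ 0) {a b : ℂ}
    (hab : ∀ x ∈ P.ζ '' P.D, a * W x + b * V x = 0) : a = 0 ∧ b = 0 := by
  have h1 := hab x hx
  have h2 : a * deriv W x + b * deriv V x = 0 := by
    have e1 := ((hW.hasDerivAt hx).const_mul a).add ((hV.hasDerivAt hx).const_mul b)
    have e2 : ((fun x => a * W x) + fun x => b * V x) =ᶠ[𝓝 x] fun _ => 0 := by
      filter_upwards [P.isOpen_image.mem_nhds hx] with y hy using hab y hy
    exact e1.unique ((hasDerivAt_const x 0).congr_of_eventuallyEq e2)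
  have h3 : a * wronskian W V x = 0 := by
    unfold wronskian
    linear_combination deriv V x * h1 - V x * h2
  have h4 : b * wronskian W V x = 0 := by
    unfold wronskian
    linear_combination W x * h2 - deriv W x * h1
  exact ⟨(mul_eq_zero.1 h3).resolve_right h0, (mul_eq_zero.1 h4).resolve_right h0⟩

end Solutions

/-! ### The Liouville-Green amplitudes of a solution -/

section Amplitudes

variable {P : Problem} {θ r : ℝ} {j k : SignType} {u : ℂ} {W V : ℂ → ℂ}

/-- `Y = ζ^{1/4} W`. -/
noncomputable def lgY (θ : ℝ) (j : SignType) (W : ℂ → ℂ) (x : ℂ) : ℂ := powBr θ j (1 / 4) x * W x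

/-- The derivative of `lgY` with respect to `tallVar`. -/
noncomputable def lgZ (θ : ℝ) (j : SignType) (W : ℂ → ℂ) (x : ℂ) : ℂ :=
  -(eps j : ℂ) * Complex.exp (-((θ : ℂ) * I)) *
    (1 / 4 * powBr θ j (-5 / 4) x * W x + powBr θ j (-1 / 4) x * deriv W x)

/-- The amplitude of `e^{-rX}` in `lgY`. -/
noncomputable def ampA (r θ : ℝ) (j : SignType) (W : ℂ → ℂ) (x : ℂ) : ℂ :=
  Complex.exp (r * tallVar θ j x) * (lgY θ j W x - lgZ θ j W x / r) / 2

/-- The amplitude of `e^{rX}` in `lgY`, times `e^{2rX}`. -/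
noncomputable def ampB (r θ : ℝ) (j : SignType) (W : ℂ → ℂ) (x : ℂ) : ℂ :=
  Complex.exp (r * tallVar θ j x) * (lgY θ j W x + lgZ θ j W x / r) / 2

theorem ampA_add_ampB (r θ : ℝ) (j : SignType) (W : ℂ → ℂ) (x : ℂ) :
    ampA r θ j W x + ampB r θ j W x = Complex.exp (r * tallVar θ j x) * lgY θ j W x := by
  unfold ampA ampB
  ring

/-- `dX/dζ`. -/
noncomputable def dTall (θ : ℝ) (j : SignType) (x : ℂ) : ℂ :=
  -(eps j : ℂ) * Complex.exp ((θ : ℂ) * I) * powBr θ j (1 / 2) x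

theorem exp_neg_mul_exp (θ : ℝ) :
    Complex.exp (-((θ : ℂ) * I)) * Complex.exp ((θ : ℂ) * I) = 1 := by
  rw [← Complex.exp_add, neg_add_cancel, Complex.exp_zero]

theorem powBr_mul_self {x : ℂ} (a b : ℝ) (n : ℕ) (hx : x ≠ 0) (h : b = a + n) :
    powBr θ j b x = powBr θ j a x * x ^ n := by
  rw [h, ← powBr_mul _ _ hx, powBr_natCast _ hx]

theorem hasDerivAt_lgY (hW : IsSolution P u W) {x : ℂ} (hx : x ∈ P.ζ '' P.D)
    (hs : rot θ j x ∈ Complex.slitPlane) :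
    HasDerivAt (lgY θ j W) (lgZ θ j W x * dTall θ j x) x := by
  have h0 := ne_zero_of_rot hs
  refine ((hasDerivAt_powBr (1 / 4) hs).mul (hW.hasDerivAt hx)).congr_deriv ?_
  have e1 : powBr θ j (1 / 4 - 1) x = powBr θ j (-5 / 4) x * powBr θ j (1 / 2) x := by
    rw [powBr_mul _ _ h0]; norm_num
  have e2 : powBr θ j (1 / 4) x = powBr θ j (-1 / 4) x * powBr θ j (1 / 2) x := by
    rw [powBr_mul _ _ h0]; norm_num
  rw [e1, e2]
  unfold lgZ dTall
  push_cast
  linear_combination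
    -((1 / 4 * powBr θ j (-5 / 4) x * W x + powBr θ j (-1 / 4) x * deriv W x) *
      powBr θ j (1 / 2) x) * exp_neg_mul_exp θ -
    ((1 / 4 * powBr θ j (-5 / 4) x * W x + powBr θ j (-1 / 4) x * deriv W x) *
      powBr θ j (1 / 2) x * Complex.exp (-((θ : ℂ) * I)) * Complex.exp ((θ : ℂ) * I)) * eps_sq j

/-- The term (5/16) ζ^{-2} of ψ is exactly what differentiating ζ^{1/4} twice in the variable X
produces; after the cancellation d²Y/dX² = (r² + e^{-2iθ} Φ) Y. -/
theorem hasDerivAt_lgZ (hu : u = (r : ℂ) * Complex.exp ((θ : ℂ) * I)) (hW : IsSolution P u W)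
    {z : ℂ} (hz : z ∈ P.D) (hz0 : z ≠ P.z₀) (hs : rot θ j (P.ζ z) ∈ Complex.slitPlane) :
    HasDerivAt (lgZ θ j W) ((r ^ 2 + Complex.exp (-((θ : ℂ) * I)) ^ 2 * P.Phi z) *
      lgY θ j W (P.ζ z) * dTall θ j (P.ζ z)) (P.ζ z) := by
  have h0 := ne_zero_of_rot hs
  have hx : P.ζ z ∈ P.ζ '' P.D := ⟨z, hz, rfl⟩
  have h1 := ((((hasDerivAt_powBr (-5 / 4) hs).const_mul (1 / 4)).mul (hW.hasDerivAt hx)).add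
    ((hasDerivAt_powBr (-1 / 4) hs).mul (hW.hasDerivAt_deriv hx))).const_mul
      (-(eps j : ℂ) * Complex.exp (-((θ : ℂ) * I)))
  refine h1.congr_deriv ?_
  rw [hW.2 z hz hz0]
  unfold lgY dTall Problem.psi
  have e1 : powBr θ j (-5 / 4 - 1) (P.ζ z) = powBr θ j (-9 / 4) (P.ζ z) := by norm_num
  have e2 : powBr θ j (-5 / 4) (P.ζ z) = powBr θ j (-9 / 4) (P.ζ z) * P.ζ z ^ 1 :=
    powBr_mul_self _ _ 1 h0 (by norm_num)
  have e3 : powBr θ j (-1 / 4) (P.ζ z) = powBr θ j (-9 / 4) (P.ζ z) * P.ζ z ^ 2 :=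
    powBr_mul_self _ _ 2 h0 (by norm_num)
  have e4 : powBr θ j (-1 / 4 - 1) (P.ζ z) = powBr θ j (-9 / 4) (P.ζ z) * P.ζ z ^ 1 :=
    powBr_mul_self _ _ 1 h0 (by norm_num)
  have e5 : powBr θ j (1 / 4) (P.ζ z) * powBr θ j (1 / 2) (P.ζ z) =
      powBr θ j (-9 / 4) (P.ζ z) * P.ζ z ^ 3 := by
    rw [powBr_mul _ _ h0]
    exact powBr_mul_self _ _ 3 h0 (by norm_num)
  have e6 : ∀ c : ℂ, c * (powBr θ j (1 / 4) (P.ζ z) * W (P.ζ z)) *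
      (-(eps j : ℂ) * Complex.exp ((θ : ℂ) * I) * powBr θ j (1 / 2) (P.ζ z)) =
      c * (powBr θ j (1 / 4) (P.ζ z) * powBr θ j (1 / 2) (P.ζ z)) * W (P.ζ z) *
      (-(eps j : ℂ) * Complex.exp ((θ : ℂ) * I)) := fun c => by ring
  rw [e6, e1, e2, e3, e4, e5, hu]
  push_cast
  have hE := exp_neg_mul_exp θ
  generalize Complex.exp (-((θ : ℂ) * I)) = E' at *
  have hEne : E' ≠ 0 := fun h => by rw [h, zero_mul] at hE; exact zero_ne_one hE
  have hE' : Complex.exp ((θ : ℂ) * I) = E'⁻¹ := eq_inv_of_mul_eq_one_right hE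
  rw [hE']
  field_simp
  ring

theorem hasDerivAt_exp_tallVar {x : ℂ} (c : ℂ) (hs : rot θ j x ∈ Complex.slitPlane) :
    HasDerivAt (fun x => Complex.exp (c * tallVar θ j x))
      (Complex.exp (c * tallVar θ j x) * (c * dTall θ j x)) x :=
  ((hasDerivAt_tallVar hs).const_mul c).cexp

/-- The combinations Y ∓ Y'/r diagonalize the unperturbed equation Y'' = r² Y, so only the Φ term is
left in the derivative. -/
theorem hasDerivAt_ampA (hr : r ≠ 0) (hu : u = (r : ℂ) * Complex.exp ((θ : ℂ) * I))
    (hW : IsSolution P u W) {z : ℂ} (hz : z ∈ P.D) (hz0 : z ≠ P.z₀)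
    (hs : rot θ j (P.ζ z) ∈ Complex.slitPlane) :
    HasDerivAt (ampA r θ j W) (-(Complex.exp (-((θ : ℂ) * I)) ^ 2 * P.Phi z * dTall θ j (P.ζ z) *
      (ampA r θ j W (P.ζ z) + ampB r θ j W (P.ζ z))) / (2 * r)) (P.ζ z) := by
  have hr' : (r : ℂ) ≠ 0 := by exact_mod_cast hr
  have h1 := ((hasDerivAt_exp_tallVar (r : ℂ) hs).mul ((hasDerivAt_lgY hW ⟨z, hz, rfl⟩ hs).sub
    ((hasDerivAt_lgZ hu hW hz hz0 hs).div_const (r : ℂ)))).div_const 2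
  refine h1.congr_deriv ?_
  rw [ampA_add_ampB]
  simp only [Pi.sub_apply]
  field_simp
  ring

theorem hasDerivAt_ampB (hr : r ≠ 0) (hu : u = (r : ℂ) * Complex.exp ((θ : ℂ) * I))
    (hW : IsSolution P u W) {z : ℂ} (hz : z ∈ P.D) (hz0 : z ≠ P.z₀)
    (hs : rot θ j (P.ζ z) ∈ Complex.slitPlane) :
    HasDerivAt (fun x => Complex.exp (-(2 * r * tallVar θ j x)) * ampB r θ j W x)
      (Complex.exp (-(2 * r * tallVar θ j (P.ζ z))) *
      (Complex.exp (-((θ : ℂ) * I)) ^ 2 * P.Phi z * dTall θ j (P.ζ z) *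
      (ampA r θ j W (P.ζ z) + ampB r θ j W (P.ζ z))) / (2 * r)) (P.ζ z) := by
  have hr' : (r : ℂ) ≠ 0 := by exact_mod_cast hr
  have e : ∀ x, Complex.exp (-(2 * r * tallVar θ j x)) * Complex.exp (r * tallVar θ j x) =
      Complex.exp (-r * tallVar θ j x) := by
    intro x
    rw [← Complex.exp_add]
    congr 1
    ring
  have h1 := ((hasDerivAt_exp_tallVar (-r : ℂ) hs).mul ((hasDerivAt_lgY hW ⟨z, hz, rfl⟩ hs).add
    ((hasDerivAt_lgZ hu hW hz hz0 hs).div_const (r : ℂ)))).div_const 2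
  have h2 : (fun x => Complex.exp (-(2 * r * tallVar θ j x)) * ampB r θ j W x) = fun x =>
      Complex.exp (-r * tallVar θ j x) * (lgY θ j W x + lgZ θ j W x / r) / 2 := by
    funext x
    rw [← e]
    unfold ampB
    ring
  rw [h2]
  refine h1.congr_deriv ?_
  rw [ampA_add_ampB]
  have e2 : ∀ c y, Complex.exp (-(2 * r * tallVar θ j (P.ζ z))) *
      (c * (Complex.exp (r * tallVar θ j (P.ζ z)) * y)) =
      Complex.exp (-r * tallVar θ j (P.ζ z)) * (c * y) := by
    intro c y
    rw [← e]
    ring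
  rw [e2]
  simp only [Pi.add_apply]
  field_simp
  ring

theorem exp_kappa_sq {j k : SignType} (hjk : j ≠ k) :
    Complex.exp (2 * Real.pi * (((1 / 4 : ℝ) : ℂ) * turn j k) * I) ^ 2 =
      -(eps j : ℂ) * eps k := by
  rw [← exp_turn_pi hjk, ← Complex.exp_nat_mul]
  congr 1
  push_cast
  ring

/-- The phase between the branches `j` and `k` of `ζ^{1/4}` over `𝐓_k`. -/
noncomputable def kappa (j k : SignType) : ℂ :=
  Complex.exp (2 * Real.pi * (((1 / 4 : ℝ) : ℂ) * turn j k) * I)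

/-- The phase κ satisfies κ² = -ε_j ε_k, so κ^{-1} = -ε_j ε_k κ, and ζ^{-5/4} has the phase of
ζ^{-1/4}. -/
theorem lgY_kappa {x : ℂ} (hjk : j ≠ k) (hk : x ∈ sectorT θ k)
    (hs : rot θ j x ∈ Complex.slitPlane) :
    powBr θ k (1 / 4) x = powBr θ j (1 / 4) x * kappa j k ∧
    powBr θ k (-1 / 4) x = -(powBr θ j (-1 / 4) x * (eps j * eps k * kappa j k)) ∧
    powBr θ k (-5 / 4) x = -(powBr θ j (-5 / 4) x * (eps j * eps k * kappa j k)) := by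
  have h0 := ne_zero_of_rot hs
  have h1 := powBr_eq_of_mem_sectorT hjk hk hs (1 / 4)
  have hsq := exp_kappa_sq hjk
  have e1 : Complex.exp (2 * Real.pi * (((-1 / 4 : ℝ) : ℂ) * turn j k) * I) =
      -(eps j * eps k * kappa j k) := by
    have : Complex.exp (2 * Real.pi * (((-1 / 4 : ℝ) : ℂ) * turn j k) * I) = (kappa j k)⁻¹ := by
      unfold kappa
      rw [← Complex.exp_neg]
      congr 1
      push_cast
      ring
    rw [this]
    have hk0 : kappa j k ≠ 0 := Complex.exp_ne_zero _
    rw [inv_eq_iff_eq_inv, eq_comm]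
    refine inv_eq_of_mul_eq_one_left ?_
    have : kappa j k ^ 2 = -(eps j : ℂ) * eps k := hsq
    linear_combination (-(eps j : ℂ) * eps k) * this + (eps j : ℂ) * eps j * eps_sq k + eps_sq j
  have e2 : Complex.exp (2 * Real.pi * (((-5 / 4 : ℝ) : ℂ) * turn j k) * I) =
      Complex.exp (2 * Real.pi * (((-1 / 4 : ℝ) : ℂ) * turn j k) * I) := by
    rw [Complex.exp_eq_exp_iff_exists_int]
    refine ⟨-turn j k, ?_⟩
    push_cast
    ring
  refine ⟨h1, ?_, ?_⟩
  · rw [powBr_eq_of_mem_sectorT hjk hk hs, e1]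
    ring
  · rw [powBr_eq_of_mem_sectorT hjk hk hs, e2, e1]
    ring

/-- The Wronskian in terms of the amplitudes. -/
theorem amp_wronskian (hr : r ≠ 0) {x : ℂ} (hjk : j ≠ k) (hk : x ∈ sectorT θ k)
    (hs : rot θ j x ∈ Complex.slitPlane) :
    2 * r * (ampB r θ j W x * ampB r θ k V x - ampA r θ j W x * ampA r θ k V x) =
      Complex.exp (-((θ : ℂ) * I)) * eps j * kappa j k * wronskian W V x := by
  have hr' : (r : ℂ) ≠ 0 := by exact_mod_cast hr
  have h0 := ne_zero_of_rot hs
  obtain ⟨e1, e2, e3⟩ := lgY_kappa hjk hk hs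
  -- Over 𝐓_k the two exponents are opposite, so all exponentials drop out. For the same reason the
  -- Wronskian appears with a plus sign below, the two X-derivatives having opposite orientation.
  have hX : Complex.exp (r * tallVar θ j x) * Complex.exp (r * tallVar θ k x) = 1 := by
    rw [tallVar_eq_neg hjk hk hs, ← Complex.exp_add]
    simp
  have h1 : 2 * r * (ampB r θ j W x * ampB r θ k V x - ampA r θ j W x * ampA r θ k V x) =
      Complex.exp (r * tallVar θ j x) * Complex.exp (r * tallVar θ k x) *
        (lgY θ j W x * lgZ θ k V x + lgZ θ j W x * lgY θ k V x) := by
    unfold ampA ampB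
    field_simp
    ring
  have hp : powBr θ j (1 / 4) x * powBr θ j (-1 / 4) x = 1 := by
    rw [powBr_mul _ _ h0]
    have := powBr_natCast (θ := θ) (j := j) 0 h0
    norm_num at this ⊢
    exact this
  rw [h1, hX, one_mul]
  unfold lgY lgZ wronskian
  rw [e1, e2, e3]
  have hk2 := eps_sq k
  generalize powBr θ j (1 / 4) x = p at *
  generalize powBr θ j (-1 / 4) x = q at *
  generalize powBr θ j (-5 / 4) x = s at *
  generalize Complex.exp (-((θ : ℂ) * I)) = E at *
  generalize (eps k : ℂ) = b at *
  generalize (eps j : ℂ) = c at *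
  linear_combination (p * W x * E * c * kappa j k * (1 / 4 * s * V x + q * deriv V x)) * hk2 +
    (E * c * kappa j k * (W x * deriv V x - deriv W x * V x)) * hp

end Amplitudes

end TurningPointLG

namespace TurningPointLG

/-! ### Liouville-Green solutions along progressive paths -/

section Connection

variable {P : Problem} {θ r : ℝ} {e : SignType → OnePoint ℂ} {j k : SignType} {γ : ℝ → ℂ} {u : ℂ}
  {W V : ℂ → ℂ}

/-- The coefficient in the Liouville-Green system along `γ`. -/
noncomputable def pathRate (P : Problem) (θ : ℝ) (j : SignType) (γ : ℝ → ℂ) (t : ℝ) : ℂ :=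
  Complex.exp (-((θ : ℂ) * I)) ^ 2 * P.Phi (γ t) * dTall θ j (P.ζ (γ t)) *
    (deriv P.ζ (γ t) * deriv γ t)

theorem norm_eps (j : SignType) : ‖(eps j : ℂ)‖ = 1 := by
  unfold eps
  split_ifs <;> simp

theorem norm_exp_neg (θ : ℝ) : ‖Complex.exp (-((θ : ℂ) * I))‖ = 1 := by
  have : -((θ : ℂ) * I) = ((-θ : ℝ) : ℂ) * I := by push_cast; ring
  rw [this, Complex.norm_exp_ofReal_mul_I]

theorem IsProgressive.norm_pathRate (h : IsProgressive P θ e j k γ) {t : ℝ}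
    (ht : t ∈ Set.Ioo (0 : ℝ) 1) :
    ‖pathRate P θ j γ t‖ = errDensity P (γ t) * ‖deriv γ t‖ := by
  have h1 : Real.sqrt ‖P.f (γ t)‖ = ‖powBr θ j (1 / 2) (P.ζ (γ t))‖ * ‖deriv P.ζ (γ t)‖ := by
    rw [← sqrtf_sq ⟨(h.mem t ht).1, h.slit ht⟩, norm_pow, Real.sqrt_sq (norm_nonneg _)]
    exact norm_mul _ _
  unfold pathRate errDensity dTall
  rw [h1]
  simp only [norm_mul, norm_pow, norm_exp_neg, norm_neg, norm_eps, Complex.norm_exp_ofReal_mul_I]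
  ring

theorem IsProgressive.intervalIntegrable_pathRate (h : IsProgressive P θ e j k γ) (hjk : j ≠ k)
    (hA : ∀ i, P.Admissible (e i)) :
    IntervalIntegrable (pathRate P θ j γ) MeasureTheory.volume 0 1 := by
  rw [intervalIntegrable_iff_integrableOn_Ioo_of_le zero_le_one]
  refine MeasureTheory.Integrable.mono' (h.integrableOn hjk (hA j) (hA k)) ?_ ?_
  · have c1 : ContinuousOn (fun t => P.Phi (γ t)) (Set.Ioo 0 1) :=
      (continuousOn_Phi P).comp h.continuousOn h.mapsTo
    have c2 : ContinuousOn (fun t => powBr θ j (1 / 2) (P.ζ (γ t))) (Set.Ioo 0 1) := fun t ht =>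
      (hasDerivAt_powBr (1 / 2) (h.slit ht)).continuousAt.comp_continuousWithinAt
        (f := fun t => P.ζ (γ t)) (h.continuousOn_ζ t ht)
    have c3 : ContinuousOn (fun t => deriv P.ζ (γ t)) (Set.Ioo 0 1) :=
      (P.analytic_ζ.deriv P.isOpen_D).continuousOn.comp h.continuousOn fun t ht => (h.mem t ht).1
    exact (((continuousOn_const.mul c1).mul
      (continuousOn_const.mul c2)).aestronglyMeasurable measurableSet_Ioo).mul
      ((c3.aestronglyMeasurable measurableSet_Ioo).mul
        (stronglyMeasurable_deriv γ).aestronglyMeasurable)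
  · refine (MeasureTheory.ae_restrict_iff' measurableSet_Ioo).2 (Eventually.of_forall fun t ht => ?_)
    exact (h.norm_pathRate ht).le

theorem exp_mul_lgY (hu : u = (r : ℂ) * Complex.exp ((θ : ℂ) * I)) (x : ℂ) :
    Complex.exp (r * tallVar θ j x) * lgY θ j W x =
      powBr θ j (1 / 4) x * Complex.exp (-((eps j : ℂ) * u * xi θ j x)) * W x := by
  have : (r : ℂ) * tallVar θ j x = -((eps j : ℂ) * u * xi θ j x) := by
    unfold tallVar
    rw [hu]
    ring
  rw [this]
  unfold lgY
  ring

theorem IsProgressive.isLGFlow (h : IsProgressive P θ e j k γ) (hjk : j ≠ k)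
    (hA : ∀ i, P.Admissible (e i)) (hr : 0 < r) (hu : u = (r : ℂ) * Complex.exp ((θ : ℂ) * I))
    (hW : IsLGSolution P θ e u j W) :
    IsLGFlow r (fun t => tallVar θ j (P.ζ (γ t))) (pathRate P θ j γ)
      (fun t => ampA r θ j W (P.ζ (γ t))) (fun t => ampB r θ j W (P.ζ (γ t))) where
  pos := hr
  cont_x := fun t ht =>
    (hasDerivAt_tallVar (h.slit ht)).continuousAt.comp_continuousWithinAt
      (f := fun t => P.ζ (γ t)) (h.continuousOn_ζ t ht)
  cont_A := fun t ht => ContinuousAt.comp_continuousWithinAt (f := fun t => P.ζ (γ t))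
    (hasDerivAt_ampA hr.ne' hu hW.1 (h.mem t ht).1 (h.mem t ht).2 (h.slit ht)).continuousAt
    (h.continuousOn_ζ t ht)
  cont_b := fun t ht => by
    have hz := h.mem t ht
    have hs := h.slit ht
    have c : ContinuousAt (ampB r θ j W) (P.ζ (γ t)) :=
      ((hasDerivAt_exp_tallVar (r : ℂ) hs).continuousAt.mul
        ((hasDerivAt_lgY hW.1 ⟨_, hz.1, rfl⟩ hs).continuousAt.add
          ((hasDerivAt_lgZ hu hW.1 hz.1 hz.2 hs).continuousAt.div_const (r : ℂ)))).div_const 2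
    exact c.comp_continuousWithinAt (f := fun t => P.ζ (γ t)) (h.continuousOn_ζ t ht)
  deriv_off := by
    obtain ⟨S, hS, M, -, hM⟩ := h.exists_deriv_bound
    refine ⟨S, hS, fun t ht => ?_⟩
    have hz := h.mem t ht.1
    have hs := h.slit ht.1
    have hζ : HasDerivAt (fun t => P.ζ (γ t)) (deriv P.ζ (γ t) * deriv γ t) t := by
      have := (P.hasDerivAt_ζ hz.1).comp_of_eq t (hM t ht).1.hasDerivAt rfl
      exact this
    have hAd := (hasDerivAt_ampA hr.ne' hu hW.1 hz.1 hz.2 hs).comp_of_eq t hζ rfl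
    have hBd := (hasDerivAt_ampB hr.ne' hu hW.1 hz.1 hz.2 hs).comp_of_eq t hζ rfl
    refine ⟨hAd.congr_deriv ?_, hBd.congr_deriv ?_⟩
    · unfold pathRate
      ring
    · unfold pathRate
      ring
  integrable := h.intervalIntegrable_pathRate hjk hA
  antitone := by
    simp only [tallVar_re]
    exact h.antitone
  start := by
    simp only [tallVar_re]
    exact h.start_height
  finish := by
    simp only [tallVar_re]
    exact h.finish_height
  init := by
    simp only [ampA_add_ampB, exp_mul_lgY hu]
    exact hW.2 k hjk γ h

/-- The limit at `e k` of the amplitude of the solution recessive at `e j`, in terms of the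
Wronskian `ω`. -/
noncomputable def connection (r θ : ℝ) (j k : SignType) (ω : ℂ) : ℂ :=
  -(Complex.exp (-((θ : ℂ) * I)) * eps j * kappa j k * ω / (2 * r))

/-- Follow W along the path and V along its reversal. At the common end b_W and b_V tend to 0 and
A_V to 1, so the constant Wronskian equals a known factor times lim A_W. The path does not enter the
value, and lim A_W ≠ 0 forces ω ≠ 0. -/
theorem IsProgressive.tendsto_connection (h : IsProgressive P θ e j k γ) (hjk : j ≠ k)
    (hA : ∀ i, P.Admissible (e i)) (hr : 0 < r) (hu : u = (r : ℂ) * Complex.exp ((θ : ℂ) * I))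
    (hW : IsLGSolution P θ e u j W) (hV : IsLGSolution P θ e u k V) {ω : ℂ}
    (hω : ∀ x ∈ P.ζ '' P.D, wronskian W V x = ω) :
    Tendsto (fun t => Complex.exp (r * tallVar θ j (P.ζ (γ t))) * lgY θ j W (P.ζ (γ t))) (𝓝[<] 1)
      (𝓝 (connection r θ j k ω)) ∧
    (∫ t in (0 : ℝ)..1, errDensity P (γ t) * ‖deriv γ t‖ ≤ r / 4 → ω ≠ 0) := by
  have hr' : (r : ℂ) ≠ 0 := by exact_mod_cast hr.ne'
  obtain ⟨c, hc, hb, hc0⟩ := (h.isLGFlow hjk hA hr hu hW).exists_limit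
  have hrev := (h.reverse hjk).isLGFlow hjk.symm hA hr hu hV
  have l1 := hrev.A_tendsto_one.comp tendsto_one_sub_one
  have l2 := hrev.b_tendsto_zero.comp tendsto_one_sub_one
  simp only [Function.comp_def, sub_sub_cancel] at l1 l2
  have hI1 : ∀ᶠ t in 𝓝[<] (1 : ℝ), t ∈ Set.Ioo (0 : ℝ) 1 := Ioo_mem_nhdsLT one_pos
  have l3 := ((hb.mul l2).sub (hc.mul l1)).const_mul (2 * (r : ℂ))
  have l4 : Tendsto (fun _ : ℝ => Complex.exp (-((θ : ℂ) * I)) * eps j * kappa j k * ω) (𝓝[<] 1)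
      (𝓝 (2 * r * (0 * 0 - c * 1))) := by
    refine l3.congr' ?_
    filter_upwards [hI1, h.finish_sector] with t ht hk
    rw [amp_wronskian hr.ne' hjk hk (h.slit ht), hω _ ⟨_, (h.mem t ht).1, rfl⟩]
  have e1 := tendsto_nhds_unique tendsto_const_nhds l4
  have e2 : c = connection r θ j k ω := by
    unfold connection
    rw [e1]
    field_simp
    ring
  refine ⟨?_, fun hvar h0 => ?_⟩
  · have := hc.add hb
    simp only [ampA_add_ampB] at this
    rwa [add_zero, e2] at this
  · refine hc0 ?_ ?_
    · refine le_trans (le_of_eq ?_) hvar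
      unfold IsLGFlow.variation
      rw [intervalIntegral.integral_of_le zero_le_one, intervalIntegral.integral_of_le zero_le_one,
        MeasureTheory.integral_Ioc_eq_integral_Ioo, MeasureTheory.integral_Ioc_eq_integral_Ioo]
      exact MeasureTheory.setIntegral_congr_fun measurableSet_Ioo fun t ht => h.norm_pathRate ht
    · rw [e2, h0]
      unfold connection
      simp

theorem IsProgressive.tendsto_start (h : IsProgressive P θ e j k γ) :
    Tendsto γ (𝓝[>] 0) (sectorEnd P θ j (e j)) := by
  refine tendsto_inf.2 ⟨tendsto_comap_iff.2 h.start, tendsto_principal.2 ?_⟩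
  filter_upwards [Ioo_mem_nhdsGT (one_pos : (0 : ℝ) < 1), h.start_sector] with t ht hs
    using ⟨(h.mem t ht).1, hs⟩

theorem IsProgressive.tendsto_finish (h : IsProgressive P θ e j k γ) :
    Tendsto γ (𝓝[<] 1) (sectorEnd P θ k (e k)) := by
  refine tendsto_inf.2 ⟨tendsto_comap_iff.2 h.finish, tendsto_principal.2 ?_⟩
  filter_upwards [Ioo_mem_nhdsLT (one_pos : (0 : ℝ) < 1), h.finish_sector] with t ht hs
    using ⟨(h.mem t ht).1, hs⟩

theorem neg_eps_mul_eps_sq (j k : SignType) :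
    (-((eps j : ℂ) * eps k)) * (-((eps j : ℂ) * eps k)) = 1 := by
  linear_combination (eps j : ℂ) * eps j * eps_sq k + eps_sq j

theorem powBr_neg_half_of_mem_sectorT {x : ℂ} (hjk : j ≠ k) (hk : x ∈ sectorT θ k)
    (hs : rot θ j x ∈ Complex.slitPlane) :
    powBr θ j (-1 / 2) x = -((eps j : ℂ) * eps k) * powBr θ k (-1 / 2) x := by
  rw [powBr_eq_of_mem_sectorT hjk hk hs]
  have e1 : Complex.exp (2 * Real.pi * (((-1 / 2 : ℝ) : ℂ) * turn j k) * I) =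
      -((eps j : ℂ) * eps k) := by
    have : Complex.exp (2 * Real.pi * (((-1 / 2 : ℝ) : ℂ) * turn j k) * I) =
        (Complex.exp (Real.pi * turn j k * I))⁻¹ := by
      rw [← Complex.exp_neg]
      congr 1
      push_cast
      ring
    rw [this, exp_turn_pi hjk, inv_eq_iff_eq_inv, eq_comm, neg_mul]
    exact inv_eq_of_mul_eq_one_left (neg_eps_mul_eps_sq j k)
  rw [e1]
  linear_combination -powBr θ j (-1 / 2) x * neg_eps_mul_eps_sq j k

/-- For odd s only the factor ζ^{-1/2} changes with the branch, by the sign -ε_j ε_k. For even s the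
limit is α (s / 2) in either branch. -/
theorem IsProgressive.tendsto_Ehat_finish (h : IsProgressive P θ e j k γ) (hjk : j ≠ k)
    (hA : P.Admissible (e k)) {α : ℕ → ℂ} {G : ℕ → ℂ → ℂ} {s : ℕ} {ℓ : ℂ}
    (hℓ : Tendsto (P.Ehat α G θ k s) (sectorEnd P θ k (e k)) (𝓝 ℓ)) :
    Tendsto (fun t => P.Ehat α G θ j s (γ t)) (𝓝[<] 1)
      (𝓝 ((-((eps j : ℂ) * eps k)) ^ s * ℓ)) := by
  have hfin := h.tendsto_finish
  have hI1 : ∀ᶠ t in 𝓝[<] (1 : ℝ), t ∈ Set.Ioo (0 : ℝ) 1 := Ioo_mem_nhdsLT one_pos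
  rcases Nat.even_or_odd s with hev | hodd
  · obtain ⟨ha, ε, m, f, A, hE⟩ := Admissible.exists_isEnd hA
    have hnear := eventually_nearEnd (θ := θ) (j := k) hE ha hE.pos
    have hchart := tendsto_chart_sectorEnd (θ := θ) (j := k) hE ha
    have e1 : ℓ = α (s / 2) := tendsto_nhds_unique (hℓ.comp hfin)
      ((hE.tendsto_Ehat_even (hnear.mono fun z hz => hz.1) hchart α G hev).comp hfin)
    have e2 : (-((eps j : ℂ) * eps k)) ^ s = 1 := by
      obtain ⟨i, rfl⟩ := hev
      rw [← two_mul, pow_mul, pow_two, neg_eps_mul_eps_sq, one_pow]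
    rw [e1, e2, one_mul]
    refine hE.tendsto_Ehat_even (j := j) (l := map γ (𝓝[<] 1)) ?_ (hchart.comp hfin) α G hev
    rw [eventually_map]
    filter_upwards [hI1, hfin.eventually hnear] with t ht hn
    exact ⟨⟨(h.mem t ht).1, h.slit ht⟩, hn.1.2⟩
  · have e2 : (-((eps j : ℂ) * eps k)) ^ s = -((eps j : ℂ) * eps k) := by
      obtain ⟨i, rfl⟩ := hodd
      rw [pow_succ, pow_mul, pow_two, neg_eps_mul_eps_sq, one_pow, one_mul]
    rw [e2]
    refine ((hℓ.comp hfin).const_mul _).congr' ?_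
    filter_upwards [hI1, h.finish_sector] with t ht hk
    simp only [Function.comp_def]
    unfold Problem.Ehat
    rw [if_neg (Nat.not_even_iff_odd.2 hodd), if_neg (Nat.not_even_iff_odd.2 hodd),
      powBr_neg_half_of_mem_sectorT hjk hk (h.slit ht), mul_assoc]

/-- The exponent of the truncated expansion at `e k` of the solution recessive at `e j`. -/
noncomputable def endSum (u : ℂ) (Ev : ℕ → SignType → ℂ) (n : ℕ) (j k : SignType) : ℂ :=
  ∑ s ∈ Finset.Ico 1 n, (eps j : ℂ) ^ s *
    (((-((eps j : ℂ) * eps k)) ^ s * Ev s k - Ev s j) / u ^ s)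

theorem eta_eq (hu : u = (r : ℂ) * Complex.exp ((θ : ℂ) * I)) (E : ℕ → ℂ → ℂ) (Ej : ℕ → ℂ) (n : ℕ)
    (z : ℂ) :
    eta P θ u j E Ej W n z = Complex.exp (r * tallVar θ j (P.ζ z)) * lgY θ j W (P.ζ z) *
      Complex.exp (-∑ s ∈ Finset.Ico 1 n, (eps j : ℂ) ^ s * ((E s z - Ej s) / u ^ s)) - 1 := by
  rw [exp_mul_lgY hu]
  unfold eta
  rw [neg_add, Complex.exp_add]
  ring

theorem IsProgressive.tendsto_eta (h : IsProgressive P θ e j k γ) (hjk : j ≠ k)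
    (hA : ∀ i, P.Admissible (e i)) (hr : 0 < r) (hu : u = (r : ℂ) * Complex.exp ((θ : ℂ) * I))
    (hW : IsLGSolution P θ e u j W) (hV : IsLGSolution P θ e u k V) {ω : ℂ}
    (hω : ∀ x ∈ P.ζ '' P.D, wronskian W V x = ω) {α : ℕ → ℂ} {G : ℕ → ℂ → ℂ}
    {Ev : ℕ → SignType → ℂ}
    (hEv : ∀ s, Tendsto (P.Ehat α G θ k s) (sectorEnd P θ k (e k)) (𝓝 (Ev s k))) (n : ℕ) :
    Tendsto (fun t => eta P θ u j (P.Ehat α G θ j) (fun s => Ev s j) W n (γ t)) (𝓝[<] 1)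
      (𝓝 (connection r θ j k ω * Complex.exp (-endSum u Ev n j k) - 1)) := by
  simp only [eta_eq hu]
  refine ((h.tendsto_connection hjk hA hr hu hW hV hω).1.mul
    ((Complex.continuous_exp.tendsto _).comp (Tendsto.neg ?_))).sub_const 1
  unfold endSum
  exact tendsto_finsetSum _ fun s _ =>
    (((h.tendsto_Ehat_finish hjk (hA k) (hEv s)).sub_const _).div_const _).const_mul _

theorem kappa_zero (k : SignType) : kappa 0 k = 1 := by
  unfold kappa turn
  simp

theorem kappa_one_neg_one : kappa 1 (-1) = -I := by
  unfold kappa turn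
  norm_num
  rw [show 2 * (Real.pi : ℂ) * (1 / 4) * I = Real.pi / 2 * I by ring, Complex.exp_neg,
    Complex.exp_pi_div_two_mul_I, Complex.inv_I]

theorem kappa_neg_one_one : kappa (-1) 1 = I := by
  unfold kappa turn
  norm_num
  rw [show 2 * (Real.pi : ℂ) * (1 / 4) * I = Real.pi / 2 * I by ring,
    Complex.exp_pi_div_two_mul_I]

end Connection

end TurningPointLG

namespace TurningPointLG

/-! ### Connection constants and the three-term relation -/

section Main

variable {P : Problem} {θ r : ℝ} {e : SignType → OnePoint ℂ} {u : ℂ} {W : SignType → ℂ → ℂ}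

theorem exists_wronskian_value {U V : ℂ → ℂ} (hU : IsSolution P u U) (hV : IsSolution P u V) :
    ∀ x ∈ P.ζ '' P.D, wronskian U V x = wronskian U V 0 := by
  obtain ⟨ω, hω⟩ := exists_wronskian_eq hU hV
  intro x hx
  rw [hω x hx, hω 0 P.zero_mem_image]

theorem Independent.wronskian_ne_zero (h1 : IsSolution P u (W 1)) (h2 : IsSolution P u (W (-1)))
    (h : Independent P W) : wronskian (W 1) (W (-1)) 0 ≠ 0 := by
  intro h0
  obtain ⟨a, b, hab, hrel⟩ := exists_relation_of_wronskian_eq_zero h1 h2 fun x hx => by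
    rw [exists_wronskian_value h1 h2 x hx, h0]
  exact hab (h a b fun z hz => hrel _ ⟨z, hz, rfl⟩)

theorem independent_of_wronskian_ne_zero (h1 : IsSolution P u (W 1))
    (h2 : IsSolution P u (W (-1))) (h : wronskian (W 1) (W (-1)) 0 ≠ 0) : Independent P W := by
  intro a b hab
  refine relation_of_wronskian_ne_zero h1 h2 P.zero_mem_image h ?_
  rintro x ⟨z, hz, rfl⟩
  exact hab z hz

theorem wronskian_swap (U V : ℂ → ℂ) (x : ℂ) : wronskian V U x = -wronskian U V x := by
  unfold wronskian
  ring

theorem connection_ne_zero {j k : SignType} {ω : ℂ} (hr : 0 < r) (hω : ω ≠ 0) :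
    connection r θ j k ω ≠ 0 := by
  have hr' : (r : ℂ) ≠ 0 := by exact_mod_cast hr.ne'
  have hk : kappa j k ≠ 0 := Complex.exp_ne_zero _
  exact neg_ne_zero.2 (div_ne_zero (mul_ne_zero (mul_ne_zero (mul_ne_zero (Complex.exp_ne_zero _)
    (eps_ne_zero j)) hk) hω) (mul_ne_zero two_ne_zero hr'))

theorem connection_div {j k : SignType} {ω ω' : ℂ} (hr : 0 < r) (hj : j ≠ 0) (hω : ω ≠ 0) :
    connection r θ 0 k ω' / connection r θ j k ω = -(ω' / (kappa j k * ω)) := by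
  have hr' : (r : ℂ) ≠ 0 := by exact_mod_cast hr.ne'
  have hk : kappa j k ≠ 0 := Complex.exp_ne_zero _
  have hE := Complex.exp_ne_zero (-((θ : ℂ) * I))
  unfold connection
  rw [kappa_zero]
  unfold eps
  rw [if_pos rfl, if_neg hj]
  push_cast
  field_simp

/-- The expansions of W_0 and W_j are compared at z^{(-j)}: the terms Ê_s(z^{(-j)}) enter both with
the sign (-1)^s and cancel, leaving only the normalizing values at z^{(0)} and z^{(j)}. -/
theorem endSum_identity (u : ℂ) (Ev : ℕ → SignType → ℂ) (n : ℕ) {j : SignType} (hj : j ≠ 0) :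
    -∑ s ∈ Finset.Ico 1 n, (eps j : ℂ) ^ s * (Ev s j / u ^ s) =
      -∑ s ∈ Finset.Ico 1 n, (-1) ^ s * (Ev s 0 / u ^ s) +
        (-endSum u Ev n 0 (-j) - -endSum u Ev n j (-j)) := by
  have hj' : -j ≠ 0 := by simpa using hj
  have e1 : (eps j : ℂ) = 1 := by simp [eps, hj]
  have e2 : (eps (-j) : ℂ) = 1 := by simp [eps, hj]
  have e3 : (eps 0 : ℂ) = -1 := by simp [eps]
  unfold endSum
  simp only [← Finset.sum_neg_distrib, ← Finset.sum_sub_distrib, ← Finset.sum_add_distrib]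
  refine Finset.sum_congr rfl fun s _ => ?_
  rw [e1, e2, e3]
  norm_num
  ring

/-- For j = ±1, 1 + δ_{n,j} is the quotient of 1 + η_{n,0} by 1 + η_{n,j} at z^{(-j)}, and each of
these is a connection constant times an exponential. -/
theorem connection_identity {Ev : ℕ → SignType → ℂ} {c : SignType → SignType → ℂ} (n : ℕ)
    {j : SignType} (hj : j ≠ 0) (hc : c j (-j) ≠ 0) :
    c 0 (-j) / c j (-j) * Complex.exp (-∑ s ∈ Finset.Ico 1 n, (eps j : ℂ) ^ s * (Ev s j / u ^ s)) =
      mu u (fun s => Ev s 0) n *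
        (1 + delta (fun j k => c j k * Complex.exp (-endSum u Ev n j k) - 1) j) := by
  have h1 := Complex.exp_ne_zero (-endSum u Ev n j (-j))
  unfold mu delta
  dsimp only
  rw [if_neg hj, endSum_identity u Ev n hj, Complex.exp_add, Complex.exp_sub]
  generalize Complex.exp (-endSum u Ev n j (-j)) = E at *
  have h2 : c j (-j) * E ≠ 0 := mul_ne_zero hc h1
  have h3 : 1 + (c j (-j) * E - 1) ≠ 0 := by
    intro h
    exact h2 (by linear_combination h)
  field_simp
  ring

end Main

end TurningPointLG

theorem lemma2p1 (P : TurningPointLG.Problem) (θ : ℝ) (e : SignType → OnePoint ℂ)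
    (α : ℕ → ℂ) (G : ℕ → ℂ → ℂ) (hG : P.IsOddCoeff θ G)
    (hyp : TurningPointLG.StandingHyp P θ e) :
    -- the values `Ev s j = Ê_s(z^{(j)})` exist
    ∃ Ev : ℕ → SignType → ℂ,
      (∀ s, 1 ≤ s → ∀ j k, j ≠ k → ∀ γ, TurningPointLG.IsProgressive P θ e j k γ →
        Tendsto (fun t => P.Ehat α G θ j s (γ t)) (𝓝[>] 0) (𝓝 (Ev s j))) ∧
      (∀ r : ℝ, 0 < r → ∀ u : ℂ, u = (r : ℂ) * Complex.exp ((θ : ℂ) * I) →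
        ∀ W : SignType → ℂ → ℂ, (∀ j, TurningPointLG.IsLGSolution P θ e u j (W j)) →
        -- the values `η n j k = η_{n,j}(u, z^{(k)})` exist
        ∃ η : ℕ → SignType → SignType → ℂ,
          (∀ n, 1 ≤ n → ∀ j k, j ≠ k → ∀ γ, TurningPointLG.IsProgressive P θ e j k γ →
            Tendsto (fun t => TurningPointLG.eta P θ u j (P.Ehat α G θ j) (fun s => Ev s j)
              (W j) n (γ t)) (𝓝[<] 1) (𝓝 (η n j k))) ∧
          (TurningPointLG.Independent P W →
            (∀ n, 1 ≤ n → 1 + η n 1 (-1) ≠ 0 ∧ 1 + η n (-1) 1 ≠ 0) ∧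
            ∃ lam : SignType → ℂ, lam 0 = 1 ∧
              (∀ z ∈ P.D, lam (-1) * W (-1) (P.ζ z) =
                I * W 0 (P.ζ z) + lam 1 * W 1 (P.ζ z)) ∧
              ∀ n, 1 ≤ n → ∀ j,
                lam j * Complex.exp (-∑ s ∈ Finset.Ico 1 n,
                    (TurningPointLG.eps j : ℂ) ^ s * (Ev s j / u ^ s)) =
                  TurningPointLG.mu u (fun s => Ev s 0) n *
                    (1 + TurningPointLG.delta (η n) j))) ∧
      -- the proviso of linear independence holds for all large `|u|`
      (∃ R : ℝ, 0 < R ∧ ∀ r : ℝ, R ≤ r → ∀ u : ℂ, u = (r : ℂ) * Complex.exp ((θ : ℂ) * I) →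
        ∀ W : SignType → ℂ → ℂ, (∀ j, TurningPointLG.IsLGSolution P θ e u j (W j)) →
          TurningPointLG.Independent P W) := by
  choose Ev hEv using fun (s : ℕ) (j : SignType) =>
    TurningPointLG.exists_Ehat_limit (hyp.admissible j) (hyp.oneEnded j) α hG s
  refine ⟨Ev, fun s _ j k _ γ hγ => (hEv s j).comp hγ.tendsto_start, ?_, ?_⟩
  · intro r hr u hu W hW
    have hω := fun j k => TurningPointLG.exists_wronskian_value (hW j).1 (hW k).1
    set c : SignType → SignType → ℂ := fun j k =>
      TurningPointLG.connection r θ j k (TurningPointLG.wronskian (W j) (W k) 0) with hc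
    refine ⟨fun n j k => c j k * Complex.exp (-TurningPointLG.endSum u Ev n j k) - 1, ?_, ?_⟩
    · intro n _ j k hjk γ hγ
      exact hγ.tendsto_eta hjk hyp.admissible hr hu (hW j) (hW k) (hω j k) (fun s => hEv s k) n
    · intro hind
      have h1 := hind.wronskian_ne_zero (hW 1).1 (hW (-1)).1
      have h2 : TurningPointLG.wronskian (W (-1)) (W 1) 0 ≠ 0 := by
        rw [TurningPointLG.wronskian_swap]
        exact neg_ne_zero.2 h1
      have hc1 : c 1 (-1) ≠ 0 := TurningPointLG.connection_ne_zero hr h1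
      have hc2 : c (-1) 1 ≠ 0 := TurningPointLG.connection_ne_zero hr h2
      -- At z^{(-j)} the solution W_{-j} is recessive, so the relation must balance W_0 against W_j
      -- there; this determines λ_j as a quotient of amplitudes, without reference to n.
      refine ⟨fun n _ => ⟨?_, ?_⟩, fun j => if j = 0 then 1 else c 0 (-j) / c j (-j), by simp,
        ?_, ?_⟩
      · rw [add_sub_cancel]
        exact mul_ne_zero hc1 (Complex.exp_ne_zero _)
      · rw [add_sub_cancel]
        exact mul_ne_zero hc2 (Complex.exp_ne_zero _)
      · intro z hz
        have hx : P.ζ z ∈ P.ζ '' P.D := ⟨z, hz, rfl⟩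
        show (if (-1 : SignType) = 0 then 1 else c 0 (- -1) / c (-1) (- -1)) * W (-1) (P.ζ z) =
          I * W 0 (P.ζ z) + (if (1 : SignType) = 0 then 1 else c 0 (-1) / c 1 (-1)) * W 1 (P.ζ z)
        rw [if_neg (by decide), if_neg (by decide), neg_neg, hc]
        dsimp only
        rw [TurningPointLG.connection_div hr (by decide) h1,
          TurningPointLG.connection_div hr (by decide) h2, TurningPointLG.kappa_one_neg_one,
          TurningPointLG.kappa_neg_one_one, TurningPointLG.wronskian_swap (W 1) (W (-1))]
        have e1 := hω 1 (-1) _ hx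
        have e2 := hω 0 (-1) _ hx
        have e3 := hω 0 1 _ hx
        -- Expansion of the vanishing determinant whose rows are the three values, the same values
        -- again, and the three derivatives.
        have key : TurningPointLG.wronskian (W 0) (W 1) 0 * W (-1) (P.ζ z) +
            TurningPointLG.wronskian (W 1) (W (-1)) 0 * W 0 (P.ζ z) -
            TurningPointLG.wronskian (W 0) (W (-1)) 0 * W 1 (P.ζ z) = 0 := by
          rw [← e1, ← e2, ← e3]
          unfold TurningPointLG.wronskian
          ring
        field_simp
        linear_combination key -
          TurningPointLG.wronskian (W 1) (W (-1)) 0 * W 0 (P.ζ z) * Complex.I_sq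
      · intro n _ j
        by_cases hj : j = 0
        · subst hj
          simp [TurningPointLG.delta, TurningPointLG.mu, TurningPointLG.eps]
        · dsimp only
          rw [if_neg hj]
          refine TurningPointLG.connection_identity n hj ?_
          cases j with
          | zero => exact absurd rfl hj
          | neg => exact hc2
          | pos => exact hc1
  · obtain ⟨γ, hγ⟩ := hyp.linked 1 (-1) (by decide)
    -- One path suffices. The factor 4 matches the threshold r/4 for nonvanishing of the limit
    -- amplitude; the 1 makes R positive.
    refine ⟨4 * |∫ t in (0 : ℝ)..1, TurningPointLG.errDensity P (γ t) * ‖deriv γ t‖| + 1,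
      by positivity, fun r hr u hu W hW => ?_⟩
    have hr0 : 0 < r := lt_of_lt_of_le (by positivity) hr
    refine TurningPointLG.independent_of_wronskian_ne_zero (hW 1).1 (hW (-1)).1 ?_
    refine (hγ.tendsto_connection (by decide) hyp.admissible hr0 hu (hW 1) (hW (-1))
      (TurningPointLG.exists_wronskian_value (hW 1).1 (hW (-1)).1)).2 ?_
    have := le_abs_self (∫ t in (0 : ℝ)..1, TurningPointLG.errDensity P (γ t) * ‖deriv γ t‖)
    linarith
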